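/- Let $\mathcal R$ be the Levi-Civita field: the functions $x:\mathbb Q\to\mathbb R$ whose support has finitely many elements below each rational, with pointwise sum, Cauchy product, and $x<y$ iff $x(q)<y(q)$ at the least $q$ where $x$ and $y$ differ; $\mathbb R\subset\mathcal R$. Call $x\in\mathcal R$ finite if $|x|<r$ for some $r\in\mathbb R$, and let its standard part be $\operatorname{sh}(x)=\inf\{r\in\mathbb R: x\le r\}\in[-\infty,+\infty]$. Limits and sums of series of numbers are taken in the order topology of $\mathcal R$, unless called weak. A sequence $c_m$ converges weakly to $l$ if for every real $\varepsilon>0$ one has $|(c_m-l)(q)|<\varepsilon$ for all $q\le\varepsilon^{-1}$ and all large $m$. An interval $I(a,b)$ is a bounded interval of $\mathcal R$ with endpoints $a\le b$, each of which may or may not belong to it, and $l(I(a,b))=b-a$. *Measure.* A set $A\subseteq\mathcal R$ is measurable if for every $\varepsilon>0$ in $\mathcal R$ there are sequences of mutually disjoint intervals $(I_n)$, $(J_n)$ with $\bigcup_n I_n\subseteq A\subseteq\bigcup_n J_n$, with $\sum_n l(I_n)$ and $\sum_n l(J_n)$ convergent, and $\sum_n l(J_n)-\sum_n l(I_n)\le\varepsilon$.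 Its measure $m(A)\in\mathcal R$ is the supremum of the sums $\sum_n l(I_n)$, equivalently the infimum of the sums $\sum_n l(J_n)$, over such inner, respectively outer, sequences. *Measurable functions.* A function $f$ is simple on $I(a,b)$ if it is there the sum of a power series $\sum_n a_n(x-x_0)^n$, with $a_n\in\mathcal R$ and $x_0\in[a,b]$, that converges weakly at every point of $I(a,b)$. A function $f:A\to\mathcal R$ on a measurable set $A$ is measurable if for every $\varepsilon>0$ in $\mathcal R$ there is a sequence of mutually disjoint intervals $I_n$ with $\bigcup_n I_n\subseteq A$, $\sum_n l(I_n)$ convergent, $m(A)-\sum_n l(I_n)<\varepsilon$, and $f$ simple on every $I_n$. *Shamseddine–Berz integral.* If $f$ is simple on $I(a,b)$ and $F$ is a simple antiderivative of $f$, then $\int_{I(a,b)}f=\lim_{x\to b}F(x)-\lim_{x\to a}F(x)$. If $f$ is measurable on $A$, then $\int_A f\in\mathcal R$ is the limit of $\sum_n\int_{I_n}f$ as $\sum_n l(I_n)\to m(A)$, over all sequences of mutually disjoint intervals $I_n$ with $\bigcup_n I_n\subseteq A$ on each of which $f$ is simple, when this limit exists in $\mathcal R$. Let $\mathcal L^1(A)$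 be the set of measurable $f:A\to\mathcal R$ for which $\int_A|f|$ exists in $\mathcal R$. *$M$-integral.* For $f:A\to\mathcal R$ put $$L(f)=\sup\Big\{\operatorname{sh}\Big(\int_A g\Big): g\in\mathcal L^1(A),\ g\le f \text{ on } A\Big\},\qquad U(f)=\inf\Big\{\operatorname{sh}\Big(\int_A g\Big): g\in\mathcal L^1(A),\ g\ge f\text{ on } A\Big\}.$$ If $f$ is bounded, it is $M$-integrable iff $L(f)=U(f)$, and then $\int_A^M f=L(f)$. If $f$ is unbounded and non-negative, it is $M$-integrable iff $L(f)<+\infty$, and then $\int_A^M f=L(f)$. If $f$ is unbounded and non-positive, it is $M$-integrable iff $f^-$ is, and then $\int_A^M f=-\int_A^M f^-$. Any other unbounded $f$ is $M$-integrable iff $f^+$ and $f^-$ are, and then $\int_A^M f=\int_A^M f^+-\int_A^M f^-$. **Proposition.** Let $A\subset\mathcal R$ be measurable and let $f\in\mathcal L^1(A)$ be such that $\int_A|f|$ is a finite element of $\mathcal R$. Then $\int_A f$ exists in $\mathcal R$, $f$ is $M$-integrable over $A$, and $$\int_A^M f=\operatorname{sh}\Big(\int_A f\Big).$$ -/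

import Mathlib

open Filter Topology

namespace LC

/-! ### The Levi-Civita field -/

/-- A set of rationals is left-finite if it has finitely many elements below each rational. -/
def LeftFinite (F : Set ℚ) : Prop := ∀ q : ℚ, {x ∈ F | x ≤ q}.Finite

theorem LeftFinite.mono {F G : Set ℚ} (hG : LeftFinite G) (h : F ⊆ G) : LeftFinite F :=
  fun q => (hG q).subset fun _ hx => ⟨h hx.1, hx.2⟩

theorem LeftFinite.union {F G : Set ℚ} (hF : LeftFinite F) (hG : LeftFinite G) :
    LeftFinite (F ∪ G) := by
  intro q
  refine ((hF q).union (hG q)).subset ?_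
  rintro x ⟨hx | hx, hq⟩
  · exact Or.inl ⟨hx, hq⟩
  · exact Or.inr ⟨hx, hq⟩

theorem leftFinite_of_finite {F : Set ℚ} (h : F.Finite) : LeftFinite F :=
  fun _ => h.subset fun _ hx => hx.1

theorem leftFinite_support_mul {x y : HahnSeries ℚ ℝ} (hx : LeftFinite x.support)
    (hy : LeftFinite y.support) : LeftFinite (x * y).support := by
  intro q
  by_cases hx0 : x = 0
  · subst hx0; simp
  by_cases hy0 : y = 0
  · subst hy0; simp
  refine ((hx (q - y.order)).add (hy (q - x.order))).subset ?_
  rintro g ⟨hg, hgq⟩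
  obtain ⟨u, hu, v, hv, rfl⟩ := Set.mem_add.1 (HahnSeries.support_mul_subset hg)
  have h1 : x.order ≤ u := HahnSeries.order_le_of_coeff_ne_zero hu
  have h2 : y.order ≤ v := HahnSeries.order_le_of_coeff_ne_zero hv
  exact Set.add_mem_add ⟨hu, by linarith⟩ ⟨hv, by linarith⟩

theorem leftFinite_support_inv {x : HahnSeries ℚ ℝ} (hx : LeftFinite x.support) :
    LeftFinite (x⁻¹).support := by
  by_cases hx0 : x = 0
  · subst hx0; simpa using hx
  set y := x⁻¹ with hy
  have hxy : x * y = 1 := mul_inv_cancel₀ hx0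
  have hy0 : y ≠ 0 := inv_ne_zero hx0
  have hord : x.order + y.order = 0 := by
    rw [← HahnSeries.order_mul hx0 hy0, hxy, HahnSeries.order_one]
  set o := x.order with ho
  -- the gap after the leading exponent
  obtain ⟨η, hη, hgap⟩ : ∃ η : ℚ, 0 < η ∧ ∀ e ∈ x.support, e ≠ o → o + η ≤ e := by
    have hfin : ({e ∈ x.support | e ≤ o + 1} \ {o}).Finite := (hx (o + 1)).subset Set.sdiff_subset
    rcases Set.eq_empty_or_nonempty ({e ∈ x.support | e ≤ o + 1} \ {o}) with h | h
    · refine ⟨1, one_pos, fun e he hne => ?_⟩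
      by_contra! hlt
      have : e ∈ ({e ∈ x.support | e ≤ o + 1} \ {o}) := ⟨⟨he, hlt.le⟩, hne⟩
      rw [h] at this
      exact this
    · obtain ⟨m, hm, hmin⟩ := Set.exists_min_image _ id hfin h
      have hom : o < m :=
        lt_of_le_of_ne (HahnSeries.order_le_of_coeff_ne_zero hm.1.1) (Ne.symm hm.2)
      refine ⟨m - o, by linarith, fun e he hne => ?_⟩
      by_cases hle : e ≤ o + 1
      · have := hmin e ⟨⟨he, hle⟩, hne⟩
        simp only [id] at this
        linarith
      · have := hm.1.2
        linarith
  -- recursive description of the support of the inverse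
  have hrec : ∀ g ∈ y.support, g = -o ∨
      ∃ e ∈ x.support, e ≠ o ∧ ∃ g' ∈ y.support, g = e - o + g' := by
    intro g hg
    by_contra! hcon
    obtain ⟨h1, h2⟩ := hcon
    have hc : (x * y).coeff (o + g) = x.coeff o * y.coeff g := by
      rw [HahnSeries.coeff_mul]
      refine Finset.sum_eq_single (o, g) ?_ ?_
      · rintro ⟨i, j⟩ hij hne
        rw [Finset.mem_antidiagonal] at hij
        obtain ⟨hi, hj, hs⟩ := hij
        simp only at hi hj hs
        by_cases hio : i = o
        · exact absurd (Prod.ext hio (by simp only; linarith)) hne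
        · exact absurd (by linarith) (h2 i hi hio j hj)
      · intro hn
        by_contra hne
        apply hn
        rw [Finset.mem_antidiagonal]
        exact ⟨left_ne_zero_of_mul hne, hg, rfl⟩
    rw [hxy, HahnSeries.coeff_one, if_neg (fun h => h1 (by linarith))] at hc
    have : x.coeff o ≠ 0 := by
      rw [ho]; exact HahnSeries.coeff_order_eq_zero.not.2 hx0
    exact (mul_ne_zero this hg) hc.symm
  have hfin : ∀ n : ℕ, {g ∈ y.support | g < -o + n * η}.Finite := by
    intro n
    induction n with
    | zero =>
      refine Set.finite_empty.subset ?_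
      rintro g ⟨hg, hlt⟩
      have := HahnSeries.order_le_of_coeff_ne_zero hg
      simp only [Nat.cast_zero, zero_mul, add_zero] at hlt
      linarith
    | succ n ih =>
      refine ((Set.finite_singleton (-o)).union
        (((hx (o + (n + 1) * η)).image (fun e => e - o)).add ih)).subset ?_
      rintro g ⟨hg, hlt⟩
      push_cast at hlt
      rcases hrec g hg with h | ⟨e, he, hne, g', hg', rfl⟩
      · exact Or.inl h
      · right
        have h1 := hgap e he hne
        have h2 : y.order ≤ g' := HahnSeries.order_le_of_coeff_ne_zero hg'
        exact Set.add_mem_add ⟨e, ⟨he, by linarith⟩, rfl⟩ ⟨hg', by linarith⟩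
  intro q
  obtain ⟨n, hn⟩ := exists_nat_gt ((q + o) / η)
  rw [div_lt_iff₀ hη] at hn
  refine (hfin n).subset ?_
  rintro g ⟨hg, hgq⟩
  exact ⟨hg, by linarith⟩

/-- The formal series `ℚ → ℝ` with left-finite support, as a subfield of the field of Hahn
series. Sum and order are those of the Levi-Civita field (pointwise sum, Cauchy product,
`x < y` iff the coefficients at the first exponent where they differ are so ordered). -/
noncomputable def leviCivitaSubfield : Subfield (Lex (HahnSeries ℚ ℝ)) where
  carrier := {x | LeftFinite (ofLex x).support}
  mul_mem' hx hy := leftFinite_support_mul hx hy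
  one_mem' := leftFinite_of_finite ((Set.finite_singleton (0 : ℚ)).subset
    (HahnSeries.support_single_subset (a := (0 : ℚ)) (r := (1 : ℝ))))
  add_mem' hx hy := (LeftFinite.union hx hy).mono (HahnSeries.support_add_subset _ _)
  zero_mem' := leftFinite_of_finite (by simp)
  neg_mem' {x} hx := by
    have : (ofLex (-x)).support = (ofLex x).support := HahnSeries.support_neg
    simpa [this] using hx
  inv_mem' _ hx := leftFinite_support_inv hx

/-- The Levi-Civita field. -/
abbrev LeviCivita : Type := leviCivitaSubfield

/-- The order topology of the Levi-Civita field; its convergence is strong convergence. -/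
instance : TopologicalSpace LeviCivita := Preorder.topology LeviCivita

instance : OrderTopology LeviCivita := ⟨rfl⟩

/-- The value `x(q)` of `x : ℚ → ℝ`. -/
def coeff (x : LeviCivita) (q : ℚ) : ℝ := (ofLex (x : Lex (HahnSeries ℚ ℝ))).coeff q

/-- The real number `r` as an element of the Levi-Civita field. -/
noncomputable def ofReal (r : ℝ) : LeviCivita :=
  ⟨toLex (HahnSeries.single (0 : ℚ) r), leftFinite_of_finite
    ((Set.finite_singleton (0 : ℚ)).subset HahnSeries.support_single_subset)⟩

/-- `x` is finite: bounded in absolute value by a real number. -/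
def IsFinite (x : LeviCivita) : Prop := ∃ r : ℝ, |x| < ofReal r

/-- The standard part, `inf {r ∈ ℝ | x ≤ r}` in the extended reals (so it is `+∞` at positive
infinite numbers and `-∞` at negative infinite ones). -/
noncomputable def st (x : LeviCivita) : EReal :=
  sInf {s : EReal | ∃ r : ℝ, x ≤ ofReal r ∧ s = (r : EReal)}

/-! ### Intervals, measurable sets, and their measure -/

/-- A bounded interval `I(a,b)`, with or without its endpoints. If `a = b` it is `∅` or `{a}`. -/
structure Interval where
  left : LeviCivita
  right : LeviCivita
  left_le_right : left ≤ right
  carrier : Set LeviCivita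
  Ioo_subset : Set.Ioo left right ⊆ carrier
  subset_Icc : carrier ⊆ Set.Icc left right

/-- The length `b - a`. -/
noncomputable def Interval.length (I : Interval) : LeviCivita := I.right - I.left

/-- The closed interval `[a,b]` with the same endpoints. -/
def Interval.closed (I : Interval) : Interval where
  left := I.left
  right := I.right
  left_le_right := I.left_le_right
  carrier := Set.Icc I.left I.right
  Ioo_subset := Set.Ioo_subset_Icc_self
  subset_Icc := subset_rfl

/-- The sequence of intervals is mutually disjoint. -/
def MutuallyDisjoint (I : ℕ → Interval) : Prop :=
  Pairwise fun m n => Disjoint (I m).carrier (I n).carrier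

/-- `∑ u n` strongly converges to `s`. -/
def SeriesTo (u : ℕ → LeviCivita) (s : LeviCivita) : Prop :=
  Tendsto (fun N => ∑ n ∈ Finset.range N, u n) atTop (𝓝 s)

/-- The sums of the lengths of disjoint sequences of intervals contained in `A`. -/
def lowerSums (A : Set LeviCivita) : Set LeviCivita :=
  {s | ∃ I : ℕ → Interval, MutuallyDisjoint I ∧ (⋃ n, (I n).carrier) ⊆ A ∧
    SeriesTo (fun n => (I n).length) s}

/-- The sums of the lengths of disjoint sequences of intervals covering `A`. -/
def upperSums (A : Set LeviCivita) : Set LeviCivita :=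
  {s | ∃ J : ℕ → Interval, MutuallyDisjoint J ∧ A ⊆ (⋃ n, (J n).carrier) ∧
    SeriesTo (fun n => (J n).length) s}

/-- Measurable subsets of the Levi-Civita field. -/
def MeasurableSubset (A : Set LeviCivita) : Prop :=
  ∀ ε : LeviCivita, 0 < ε → ∃ s ∈ lowerSums A, ∃ t ∈ upperSums A, t - s ≤ ε

/-- `μ` is the measure of `A`: the common value of the inner and the outer measure. -/
def IsMeasureOf (A : Set LeviCivita) (μ : LeviCivita) : Prop :=
  IsLUB (lowerSums A) μ ∧ IsGLB (upperSums A) μ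

/-! ### Simple functions and measurable functions -/

/-- The sequence `c` weakly converges to `l`. -/
def WeakTendsto (c : ℕ → LeviCivita) (l : LeviCivita) : Prop :=
  ∀ ε : ℝ, 0 < ε → ∃ n : ℕ, ∀ m : ℕ, n < m → ∀ q : ℚ, (q : ℝ) ≤ ε⁻¹ → |coeff (c m - l) q| < ε

/-- `f` is simple on `I`: it is there the sum of a power series, centred in the closed interval,
that weakly converges at every point of `I`. -/
def IsSimpleOn (f : LeviCivita → LeviCivita) (I : Interval) : Prop :=
  ∃ x₀ ∈ Set.Icc I.left I.right, ∃ a : ℕ → LeviCivita, ∀ x ∈ I.carrier,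
    WeakTendsto (fun N => ∑ n ∈ Finset.range N, a n * (x - x₀) ^ n) (f x)

/-- `f` is a measurable function on the (measurable) set `A`. Only the values on `A` matter. -/
def MeasurableFun (A : Set LeviCivita) (f : LeviCivita → LeviCivita) : Prop :=
  MeasurableSubset A ∧ ∃ μ, IsMeasureOf A μ ∧ ∀ ε : LeviCivita, 0 < ε →
    ∃ (I : ℕ → Interval) (s : LeviCivita), MutuallyDisjoint I ∧ (⋃ n, (I n).carrier) ⊆ A ∧
      SeriesTo (fun n => (I n).length) s ∧ μ - s < ε ∧ ∀ n, IsSimpleOn f (I n)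

/-! ### The integral with values in the Levi-Civita field -/

/-- `f` is the derivative of `F` on `I` (one-sided at endpoints belonging to `I`). -/
def IsDerivOn (F f : LeviCivita → LeviCivita) (I : Interval) : Prop :=
  ∀ x ∈ I.carrier, ∀ ε : LeviCivita, 0 < ε → ∃ δ : LeviCivita, 0 < δ ∧
    ∀ y ∈ I.carrier, |y - x| < δ → |F y - F x - f x * (y - x)| ≤ ε * |y - x|

/-- `v` is the integral over `I(a,b)` of the simple function `f`: `f` has an antiderivative `F`,
simple on `[a,b]`, and `v = lim_{x → b} F(x) - lim_{x → a} F(x)`. -/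
def HasSimpleIntegral (f : LeviCivita → LeviCivita) (I : Interval) (v : LeviCivita) : Prop :=
  IsSimpleOn f I ∧ ∃ F : LeviCivita → LeviCivita, IsSimpleOn F I.closed ∧ IsDerivOn F f I ∧
    ∃ α β : LeviCivita,
      Tendsto F (𝓝[Set.Icc I.left I.right] I.left) (𝓝 α) ∧
      Tendsto F (𝓝[Set.Icc I.left I.right] I.right) (𝓝 β) ∧ v = β - α

/-- The disjoint sequences of intervals contained in `A` on each of which `f` is simple. -/
def simpleFamilies (A : Set LeviCivita) (f : LeviCivita → LeviCivita) : Set (ℕ → Interval) :=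
  {I | MutuallyDisjoint I ∧ (⋃ n, (I n).carrier) ⊆ A ∧ ∀ n, IsSimpleOn f (I n)}

/-- The integral of the measurable function `f` over `A` is defined and equal to the element `v` of
the field: `v` is the limit of `∑ n, ∫_{I n} f` over the families `I` in `simpleFamilies A f` as
`∑ n, l(I n)` tends to the measure of `A`. -/
def HasIntegral (A : Set LeviCivita) (f : LeviCivita → LeviCivita) (v : LeviCivita) : Prop :=
  MeasurableFun A f ∧ ∃ μ, IsMeasureOf A μ ∧ ∀ ε : LeviCivita, 0 < ε →
    ∃ δ : LeviCivita, 0 < δ ∧ ∀ I ∈ simpleFamilies A f, ∀ s : LeviCivita,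
      SeriesTo (fun n => (I n).length) s → |μ - s| < δ →
        ∃ (σ : ℕ → LeviCivita) (t : LeviCivita), (∀ n, HasSimpleIntegral f (I n) (σ n)) ∧
          SeriesTo σ t ∧ |t - v| < ε

/-- `f ∈ L¹(A)`: `f` is measurable and the integral of `|f|` over `A` is defined and not `+∞`. -/
def MemL1 (A : Set LeviCivita) (f : LeviCivita → LeviCivita) : Prop :=
  MeasurableFun A f ∧ ∃ v, HasIntegral A (fun x => |f x|) v

/-! ### The real-valued integral -/

/-- `sup {st (∫_A g) | g ∈ L¹(A), g ≤ f on A}`. -/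
noncomputable def lowerMIntegral (A : Set LeviCivita) (f : LeviCivita → LeviCivita) : EReal :=
  sSup {r : EReal | ∃ g v, MemL1 A g ∧ (∀ x ∈ A, g x ≤ f x) ∧ HasIntegral A g v ∧ r = st v}

/-- `inf {st (∫_A g) | g ∈ L¹(A), g ≥ f on A}`. -/
noncomputable def upperMIntegral (A : Set LeviCivita) (f : LeviCivita → LeviCivita) : EReal :=
  sInf {r : EReal | ∃ g v, MemL1 A g ∧ (∀ x ∈ A, f x ≤ g x) ∧ HasIntegral A g v ∧ r = st v}

/-- `f` is bounded on `A`. -/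
def BoundedOn (A : Set LeviCivita) (f : LeviCivita → LeviCivita) : Prop :=
  ∃ M : LeviCivita, ∀ x ∈ A, |f x| ≤ M

/-- `M`-integrability of functions that are bounded or non-negative on `A`; their integral is
`lowerMIntegral A f`. -/
def BasicMIntegrable (A : Set LeviCivita) (f : LeviCivita → LeviCivita) : Prop :=
  (BoundedOn A f ∧ lowerMIntegral A f = upperMIntegral A f) ∨
    (¬ BoundedOn A f ∧ (∀ x ∈ A, 0 ≤ f x) ∧ lowerMIntegral A f < ⊤)

/-- Positive part. -/
noncomputable def pos (f : LeviCivita → LeviCivita) : LeviCivita → LeviCivita :=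
  fun x => max (f x) 0

/-- Negative part. -/
noncomputable def neg (f : LeviCivita → LeviCivita) : LeviCivita → LeviCivita :=
  fun x => max (-f x) 0

open scoped Classical in
/-- `f` is `M`-integrable over `A`. -/
def MIntegrable (A : Set LeviCivita) (f : LeviCivita → LeviCivita) : Prop :=
  if BoundedOn A f ∨ ∀ x ∈ A, 0 ≤ f x then BasicMIntegrable A f
  else if ∀ x ∈ A, f x ≤ 0 then BasicMIntegrable A (neg f)
  else BasicMIntegrable A (pos f) ∧ BasicMIntegrable A (neg f)

open scoped Classical in
/-- The `M`-integral of `f` over `A`, for `M`-integrable `f`. -/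
noncomputable def mIntegral (A : Set LeviCivita) (f : LeviCivita → LeviCivita) : EReal :=
  if BoundedOn A f ∨ ∀ x ∈ A, 0 ≤ f x then lowerMIntegral A f
  else if ∀ x ∈ A, f x ≤ 0 then -lowerMIntegral A (neg f)
  else lowerMIntegral A (pos f) - lowerMIntegral A (neg f)

end LC

open scoped Pointwise
namespace LC

/-! ### Left-finite sets -/

/-! Once `∫_A f` exists, `f` is itself a competitor in the definitions of `L(f)` and `U(f)`. Since
the integral and the standard part are monotone, it is the best competitor on both sides, so both
numbers equal the standard part of the integral (`HasIntegral.lowerMIntegral_eq`,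
`HasIntegral.upperMIntegral_eq`). For unbounded `f` of mixed sign the same is applied to the
positive and negative parts. These are simple wherever `f` and `|f|` both are, and they are
dominated by `|f|`, so their integrals are finite; on finite elements the standard part is the
coefficient at exponent `0`, hence additive.

The substance is therefore the integral with values in the field: it must be monotone, compatible
with differences, and exist for measurable functions dominated by an integrable one.

On one interval everything rests on `ConvUnit.rapid`. After rescaling, the coefficients of a power
series that converges weakly on `(0,1)` have a common left-finite support and decay at each exponent
faster than any power of `n`. The series may thus be evaluated on the closed unit ball, integrated
term by term, expanded to second order with uniform bounds, and recentred. Monotonicity cannot be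
drawn from completeness as over the reals. Instead the interval is parametrized by real `t` in
`[0,1]`, and real calculus is applied to each coefficient; the least exponent at which the
derivative is not identically zero decides the order (`le_of_isDerivOn_nonneg`).

Over a measurable set, finite families of intervals suffice and two of them have a common
refinement. Integrals of an integrable function over families of small total length are small
(`HasIntegral.absCont`). This property passes to dominated measurable functions
(`AbsCont.of_abs_le`), and with completeness it yields their integrals
(`AbsCont.exists_hasIntegral`). -/

theorem LeftFinite.isPWO {S : Set ℚ} (h : LeftFinite S) : S.IsPWO := by
  rw [Set.isPWO_iff_isWF, Set.isWF_iff_no_descending_seq]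
  intro f hf hmem
  refine Set.infinite_range_of_injective hf.injective ((h (f 0)).subset ?_)
  rintro _ ⟨n, rfl⟩
  exact ⟨hmem n, hf.antitone (Nat.zero_le n)⟩

theorem LeftFinite.exists_le {S : Set ℚ} (h : LeftFinite S) : ∃ m : ℚ, ∀ q ∈ S, m ≤ q := by
  obtain ⟨m, hm⟩ := (h 0).bddBelow
  refine ⟨min m 0, fun q hq => ?_⟩
  rcases le_total q 0 with h0 | h0
  · exact (min_le_left _ _).trans (hm ⟨hq, h0⟩)
  · exact (min_le_right _ _).trans h0

theorem LeftFinite.add {S T : Set ℚ} (hS : LeftFinite S) (hT : LeftFinite T) :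
    LeftFinite (S + T) := by
  obtain ⟨a, ha⟩ := hS.exists_le
  obtain ⟨b, hb⟩ := hT.exists_le
  intro q
  refine ((hS (q - b)).add (hT (q - a))).subset ?_
  rintro g ⟨hg, hgq⟩
  obtain ⟨u, hu, v, hv, rfl⟩ := Set.mem_add.1 hg
  have h1 := ha u hu
  have h2 := hb v hv
  exact Set.add_mem_add ⟨hu, by linarith⟩ ⟨hv, by linarith⟩

/-! ### Coefficients -/

theorem coeff_add (x y : LeviCivita) (q : ℚ) : coeff (x + y) q = coeff x q + coeff y q := rfl

theorem coeff_neg (x : LeviCivita) (q : ℚ) : coeff (-x) q = -coeff x q := rfl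

theorem coeff_sub (x y : LeviCivita) (q : ℚ) : coeff (x - y) q = coeff x q - coeff y q := rfl

theorem coeff_zero (q : ℚ) : coeff 0 q = 0 := rfl

theorem coeff_sum {ι : Type*} (s : Finset ι) (f : ι → LeviCivita) (q : ℚ) :
    coeff (∑ i ∈ s, f i) q = ∑ i ∈ s, coeff (f i) q :=
  map_sum (⟨⟨fun x => coeff x q, coeff_zero q⟩, fun x y => coeff_add x y q⟩ : LeviCivita →+ ℝ) f s

theorem coeff_ext {x y : LeviCivita} (h : ∀ q, coeff x q = coeff y q) : x = y :=
  Subtype.ext (HahnSeries.ext (funext h))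

/-- The set `S` contains the support of `x`. -/
def HasSupp (S : Set ℚ) (x : LeviCivita) : Prop := ∀ q, coeff x q ≠ 0 → q ∈ S

theorem leftFinite_supp (x : LeviCivita) : LeftFinite {q | coeff x q ≠ 0} := x.2

theorem HasSupp.eq_zero {S : Set ℚ} {x : LeviCivita} (h : HasSupp S x) {q : ℚ} (hq : q ∉ S) :
    coeff x q = 0 := by
  by_contra h0
  exact hq (h q h0)

/-- The element with given coefficients. -/
noncomputable def ofFun (c : ℚ → ℝ) (h : LeftFinite (Function.support c)) : LeviCivita :=
  ⟨toLex ⟨c, h.isPWO⟩, h⟩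

theorem coeff_ofFun (c : ℚ → ℝ) (h : LeftFinite (Function.support c)) (q : ℚ) :
    coeff (ofFun c h) q = c q := rfl

/-- Arbitrary left-finite sets around the supports are allowed so that one finite index set serves a
whole family of products. -/
theorem coeff_mul {S T : Set ℚ} (hS : LeftFinite S) (hT : LeftFinite T) {x y : LeviCivita}
    (hx : HasSupp S x) (hy : HasSupp T y) (q : ℚ) :
    coeff (x * y) q =
      ∑ ij ∈ Finset.antidiagonal hS.isPWO hT.isPWO q, coeff x ij.1 * coeff y ij.2 := by
  refine (HahnSeries.coeff_mul (x := ofLex (x : Lex (HahnSeries ℚ ℝ)))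
    (y := ofLex (y : Lex (HahnSeries ℚ ℝ)))).trans ?_
  refine Finset.sum_subset ?_ ?_
  · intro ij hij
    rw [Finset.mem_antidiagonal] at hij ⊢
    exact ⟨hx _ hij.1, hy _ hij.2.1, hij.2.2⟩
  · intro ij hij hn
    rw [Finset.mem_antidiagonal] at hij hn
    by_contra h0
    exact hn ⟨left_ne_zero_of_mul h0, right_ne_zero_of_mul h0, hij.2.2⟩

theorem HasSupp.mul {S T : Set ℚ} {x y : LeviCivita}
    (hx : HasSupp S x) (hy : HasSupp T y) : HasSupp (S + T) (x * y) := by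
  intro q hq
  rw [coeff_mul (leftFinite_supp x) (leftFinite_supp y) (fun _ h => h) (fun _ h => h)] at hq
  obtain ⟨ij, hij, -⟩ := Finset.exists_ne_zero_of_sum_ne_zero hq
  rw [Finset.mem_antidiagonal] at hij
  exact Set.mem_add.2 ⟨_, hx _ hij.1, _, hy _ hij.2.1, hij.2.2⟩

/-- The monomial with coefficient `r` at `q`. -/
noncomputable def monomial (q : ℚ) (r : ℝ) : LeviCivita :=
  ⟨toLex (HahnSeries.single q r), leftFinite_of_finite
    ((Set.finite_singleton q).subset HahnSeries.support_single_subset)⟩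

theorem coeff_monomial (p q : ℚ) (r : ℝ) : coeff (monomial p r) q = if q = p then r else 0 := by
  by_cases h : q = p
  · subst h
    rw [if_pos rfl]
    exact HahnSeries.coeff_single_same q r
  · rw [if_neg h]
    exact HahnSeries.coeff_single_of_ne h

theorem ofReal_eq (r : ℝ) : ofReal r = monomial 0 r := rfl

theorem monomial_mul (p q : ℚ) (r s : ℝ) :
    monomial p r * monomial q s = monomial (p + q) (r * s) :=
  Subtype.ext (HahnSeries.single_mul_single)

theorem coeff_monomial_mul (p q : ℚ) (r : ℝ) (x : LeviCivita) :
    coeff (monomial p r * x) q = r * coeff x (q - p) := by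
  have h := HahnSeries.coeff_single_mul_add (r := r) (x := ofLex (x : Lex (HahnSeries ℚ ℝ)))
    (a := q - p) (b := p)
  rw [sub_add_cancel] at h
  exact h

theorem coeff_ofReal_mul (q : ℚ) (r : ℝ) (x : LeviCivita) :
    coeff (ofReal r * x) q = r * coeff x q := by
  rw [ofReal_eq, coeff_monomial_mul, sub_zero]

theorem coeff_ofReal (q : ℚ) (r : ℝ) : coeff (ofReal r) q = if q = 0 then r else 0 :=
  coeff_monomial 0 q r

theorem ofReal_one : ofReal 1 = 1 := rfl

theorem ofReal_zero : ofReal 0 = 0 := coeff_ext fun q => by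
  rw [coeff_ofReal, coeff_zero]; simp

theorem ofReal_add (r s : ℝ) : ofReal (r + s) = ofReal r + ofReal s := coeff_ext fun q => by
  simp only [coeff_add, coeff_ofReal]; split_ifs <;> simp

theorem ofReal_mul (r s : ℝ) : ofReal (r * s) = ofReal r * ofReal s := by
  rw [ofReal_eq, ofReal_eq, ofReal_eq, monomial_mul, add_zero]

theorem ofReal_neg (r : ℝ) : ofReal (-r) = -ofReal r := coeff_ext fun q => by
  simp only [coeff_neg, coeff_ofReal]; split_ifs <;> simp

theorem ofReal_sub (r s : ℝ) : ofReal (r - s) = ofReal r - ofReal s := by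
  rw [sub_eq_add_neg, ofReal_add, ofReal_neg, sub_eq_add_neg]

theorem ofReal_pow (r : ℝ) (n : ℕ) : ofReal (r ^ n) = ofReal r ^ n := by
  induction n with
  | zero => simp [ofReal_one]
  | succ n ih => rw [pow_succ, pow_succ, ofReal_mul, ih]

theorem ofReal_natCast (n : ℕ) : ofReal n = n := by
  induction n with
  | zero => simp [ofReal_zero]
  | succ n ih => push_cast; rw [ofReal_add, ih, ofReal_one]

theorem coeff_natCast_mul (n : ℕ) (x : LeviCivita) (q : ℚ) :
    coeff (n * x) q = n * coeff x q := by
  rw [← ofReal_natCast, coeff_ofReal_mul]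

theorem coeff_one (q : ℚ) : coeff 1 q = if q = 0 then 1 else 0 := coeff_ofReal q 1

/-! ### Order -/

theorem lt_iff_coeff {x y : LeviCivita} :
    x < y ↔ ∃ q, (∀ j < q, coeff x j = coeff y j) ∧ coeff x q < coeff y q :=
  HahnSeries.lt_iff (x : Lex (HahnSeries ℚ ℝ)) y

/-- The support of `x` lies in `[m, ∞)`. -/
def SuppGE (m : ℚ) (x : LeviCivita) : Prop := ∀ q < m, coeff x q = 0

theorem SuppGE.mono {m m' : ℚ} {x : LeviCivita} (h : SuppGE m x) (hm : m' ≤ m) : SuppGE m' x :=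
  fun q hq => h q (hq.trans_le hm)

theorem SuppGE.hasSupp {m : ℚ} {x : LeviCivita} (h : SuppGE m x) : HasSupp (Set.Ici m) x := by
  intro q hq
  by_contra hn
  exact hq (h q (not_le.1 hn))

theorem SuppGE.add {m : ℚ} {x y : LeviCivita} (hx : SuppGE m x) (hy : SuppGE m y) :
    SuppGE m (x + y) := fun q hq => by rw [coeff_add, hx q hq, hy q hq, add_zero]

theorem SuppGE.neg {m : ℚ} {x : LeviCivita} (hx : SuppGE m x) : SuppGE m (-x) :=
  fun q hq => by rw [coeff_neg, hx q hq, neg_zero]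

theorem SuppGE.sub {m : ℚ} {x y : LeviCivita} (hx : SuppGE m x) (hy : SuppGE m y) :
    SuppGE m (x - y) := by
  rw [sub_eq_add_neg]; exact hx.add hy.neg

theorem SuppGE.sum {ι : Type*} {m : ℚ} {s : Finset ι} {f : ι → LeviCivita}
    (h : ∀ i ∈ s, SuppGE m (f i)) : SuppGE m (∑ i ∈ s, f i) := fun q hq => by
  rw [coeff_sum]; exact Finset.sum_eq_zero fun i hi => h i hi q hq

theorem SuppGE.mul {a b : ℚ} {x y : LeviCivita} (hx : SuppGE a x) (hy : SuppGE b y) :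
    SuppGE (a + b) (x * y) := by
  intro q hq
  by_contra h0
  obtain ⟨u, hu, v, hv, h⟩ := Set.mem_add.1 (hx.hasSupp.mul hy.hasSupp q h0)
  have h1 : a ≤ u := hu
  have h2 : b ≤ v := hv
  linarith

theorem suppGE_one : SuppGE 0 1 := fun q hq => by rw [coeff_one, if_neg hq.ne]

theorem suppGE_zero (m : ℚ) : SuppGE m 0 := fun _ _ => rfl

theorem suppGE_monomial (m : ℚ) (r : ℝ) : SuppGE m (monomial m r) := fun q hq => by
  rw [coeff_monomial, if_neg hq.ne]

theorem suppGE_ofReal (r : ℝ) : SuppGE 0 (ofReal r) := suppGE_monomial 0 r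

theorem SuppGE.pow {e : ℚ} {x : LeviCivita} (hx : SuppGE e x) (n : ℕ) :
    SuppGE (n * e) (x ^ n) := by
  induction n with
  | zero => simpa using suppGE_one
  | succ n ih =>
    rw [pow_succ]
    exact (ih.mul hx).mono (by push_cast; linarith)

theorem SuppGE.pow_zero {x : LeviCivita} (hx : SuppGE 0 x) (n : ℕ) : SuppGE 0 (x ^ n) := by
  simpa using hx.pow n

theorem pos_iff {x : LeviCivita} : 0 < x ↔ ∃ q, SuppGE q x ∧ 0 < coeff x q := by
  rw [lt_iff_coeff]
  refine exists_congr fun q => and_congr ?_ Iff.rfl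
  exact forall₂_congr fun j _ => eq_comm

theorem coeff_nonneg_of_nonneg {m : ℚ} {x : LeviCivita} (hx : 0 ≤ x) (h : SuppGE m x) :
    0 ≤ coeff x m := by
  by_contra hn
  exact absurd hx (not_le.2 (lt_iff_coeff.2 ⟨m, h, not_le.1 hn⟩))

/-- A positive element whose leading exponent lies below `m` exceeds every element supported in `[m,
∞)`. This turns order estimates into statements about supports. -/
theorem SuppGE.of_abs_le {m : ℚ} {x y : LeviCivita} (hxy : |x| ≤ y) (hy : SuppGE m y) :
    SuppGE m x := by
  have key : ∀ z : LeviCivita, 0 ≤ z → z ≤ y → SuppGE m z := by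
    intro z hz hzy
    rcases hz.eq_or_lt with rfl | hz
    · exact suppGE_zero m
    obtain ⟨q, h1, h2⟩ := pos_iff.1 hz
    refine h1.mono ?_
    by_contra! hq
    refine absurd hzy (not_le.2 (lt_iff_coeff.2 ⟨q, fun j hj => ?_, ?_⟩))
    · rw [h1 j hj, hy j (hj.trans hq)]
    · rwa [hy q hq]
  have := key |x| (abs_nonneg x) hxy
  rcases abs_choice x with h | h
  · rwa [h] at this
  · rw [h] at this
    simpa using this.neg

theorem abs_suppGE {m : ℚ} {x : LeviCivita} (hx : SuppGE m x) : SuppGE m |x| := by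
  rcases abs_choice x with h | h
  · rwa [h]
  · rw [h]; exact hx.neg

theorem monomial_pos (m : ℚ) {r : ℝ} (hr : 0 < r) : 0 < monomial m r :=
  pos_iff.2 ⟨m, suppGE_monomial m r, by rwa [coeff_monomial, if_pos rfl]⟩

theorem SuppGE.abs_lt_monomial {m m' : ℚ} {x : LeviCivita} (hx : SuppGE m x) (h : m' < m)
    {r : ℝ} (hr : 0 < r) : |x| < monomial m' r := by
  refine lt_iff_coeff.2 ⟨m', fun j hj => ?_, ?_⟩
  · rw [abs_suppGE hx j (hj.trans h), suppGE_monomial m' r j hj]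
  · rw [abs_suppGE hx m' h, coeff_monomial, if_pos rfl]
    exact hr

theorem exists_suppGE_lt {ε : LeviCivita} (hε : 0 < ε) :
    ∃ m : ℚ, ∀ x, SuppGE m x → |x| < ε := by
  obtain ⟨q, h1, h2⟩ := pos_iff.1 hε
  -- Any exponent strictly above the leading exponent `q` of `ε` would do.
  refine ⟨q + 1, fun x hx => lt_iff_coeff.2 ⟨q, fun j hj => ?_, ?_⟩⟩
  · rw [abs_suppGE hx j (by linarith), h1 j hj]
  · rwa [abs_suppGE hx q (by linarith)]

theorem exists_monomial_lt {ε : LeviCivita} (hε : 0 < ε) : ∃ m : ℚ, monomial m 1 < ε := by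
  obtain ⟨m, hm⟩ := exists_suppGE_lt hε
  exact ⟨m, lt_of_abs_lt (hm _ (suppGE_monomial m 1))⟩

theorem suppGE_of_abs_le_ofReal {r : ℝ} {x : LeviCivita} (h : |x| ≤ ofReal r) : SuppGE 0 x :=
  SuppGE.of_abs_le h (suppGE_ofReal r)

theorem abs_coeff_le_of_abs_le {r : ℝ} {x : LeviCivita} (h : |x| ≤ ofReal r) :
    |coeff x 0| ≤ r := by
  have hx := suppGE_of_abs_le_ofReal h
  have h1 := coeff_nonneg_of_nonneg (sub_nonneg.2 (le_of_abs_le h)) ((suppGE_ofReal r).sub hx)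
  have h2 := coeff_nonneg_of_nonneg (neg_le_iff_add_nonneg'.1 (neg_le_of_abs_le h))
    ((suppGE_ofReal r).add hx)
  rw [coeff_sub, coeff_ofReal, if_pos rfl] at h1
  rw [coeff_add, coeff_ofReal, if_pos rfl] at h2
  exact abs_le.2 ⟨by linarith, by linarith⟩

theorem ofReal_le {r s : ℝ} (h : r ≤ s) : ofReal r ≤ ofReal s := by
  rcases h.eq_or_lt with rfl | h
  · exact le_rfl
  · rw [← sub_nonneg, ← ofReal_sub]
    exact (monomial_pos 0 (sub_pos.2 h)).le

theorem ofReal_lt {r s : ℝ} (h : r < s) : ofReal r < ofReal s := by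
  rw [← sub_pos, ← ofReal_sub]
  exact monomial_pos 0 (sub_pos.2 h)

/-! ### Strong convergence -/

theorem tendsto_zero_iff {u : ℕ → LeviCivita} :
    Tendsto u atTop (𝓝 0) ↔ ∀ m : ℚ, ∀ᶠ n in atTop, SuppGE m (u n) := by
  rw [LinearOrderedAddCommGroup.tendsto_nhds]
  constructor
  · intro h m
    filter_upwards [h (monomial m 1) (monomial_pos m one_pos)] with n hn
    rw [sub_zero] at hn
    exact SuppGE.of_abs_le hn.le (suppGE_monomial m 1)
  · intro h ε hε
    obtain ⟨m, hm⟩ := exists_suppGE_lt hε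
    filter_upwards [h m] with n hn
    rw [sub_zero]
    exact hm _ hn

/-- Cauchy sequences converge: if consecutive differences tend to zero, there is a limit. -/
theorem exists_tendsto {S : ℕ → LeviCivita}
    (h : ∀ m : ℚ, ∃ N, ∀ n ≥ N, SuppGE m (S n - S N)) : ∃ l, Tendsto S atTop (𝓝 l) := by
  choose N hN using h
  have hagree : ∀ q m : ℚ, q < m → ∀ n ≥ N m, coeff (S n) q = coeff (S (N (q + 1))) q := by
    intro q m hqm n hn
    have e1 := hN m n hn q hqm
    have e2 := hN m (max (N m) (N (q + 1))) (le_max_left _ _) q hqm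
    have e3 := hN (q + 1) (max (N m) (N (q + 1))) (le_max_right _ _) q (by linarith)
    rw [coeff_sub] at e1 e2 e3
    linarith
  -- Up to `q` the candidate limit agrees with the single element `S (N (q + 1))`, whose support is
  -- left-finite.
  have hlf : LeftFinite (Function.support fun q => coeff (S (N (q + 1))) q) := by
    intro q
    refine ((leftFinite_supp (S (N (q + 1)))) q).subset ?_
    rintro g ⟨hg, hgq⟩
    refine ⟨?_, hgq⟩
    have : coeff (S (N (q + 1))) g = coeff (S (N (g + 1))) g :=
      hagree g (q + 1) (by linarith) _ le_rfl
    exact fun h0 => hg (this.symm.trans h0)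
  refine ⟨ofFun _ hlf, ?_⟩
  rw [← tendsto_sub_nhds_zero_iff, tendsto_zero_iff]
  intro m
  filter_upwards [eventually_ge_atTop (N m)] with n hn q hq
  rw [coeff_sub, coeff_ofFun, hagree q m hq n hn, sub_self]

/-- The topology is non-Archimedean: a block of the series is supported beyond `m` as soon as each
of its terms is. -/
theorem exists_seriesTo {u : ℕ → LeviCivita} (h : Tendsto u atTop (𝓝 0)) :
    ∃ s, SeriesTo u s := by
  refine exists_tendsto fun m => ?_
  obtain ⟨N, hN⟩ := eventually_atTop.1 (tendsto_zero_iff.1 h m)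
  refine ⟨N, fun n hn => ?_⟩
  rw [← Finset.sum_Ico_eq_sub _ hn]
  exact SuppGE.sum fun i hi => hN i (Finset.mem_Ico.1 hi).1

theorem SeriesTo.tendsto_zero {u : ℕ → LeviCivita} {s : LeviCivita} (h : SeriesTo u s) :
    Tendsto u atTop (𝓝 0) := by
  have h1 := (h.comp (tendsto_add_atTop_nat 1)).sub h
  rw [sub_self] at h1
  refine h1.congr fun n => ?_
  simp [Finset.sum_range_succ]

/-! ### Weak convergence and weak sums -/

theorem WeakTendsto.tendsto_coeff {c : ℕ → LeviCivita} {l : LeviCivita} (h : WeakTendsto c l)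
    (q : ℚ) : Tendsto (fun n => coeff (c n) q) atTop (𝓝 (coeff l q)) := by
  rw [Metric.tendsto_atTop]
  intro ε hε
  have hb : (0 : ℝ) < |(q : ℝ)| + 1 := by positivity
  -- The tolerance is at most `ε`, and its inverse is large enough for the window of controlled
  -- exponents to contain `q`.
  obtain ⟨n, hn⟩ := h (min ε (|(q : ℝ)| + 1)⁻¹) (lt_min hε (inv_pos.2 hb))
  refine ⟨n + 1, fun m hm => ?_⟩
  have h1 := hn m hm q ?_
  · rw [coeff_sub] at h1
    exact h1.trans_le (min_le_left _ _)
  · have h2 : |(q : ℝ)| + 1 ≤ (min ε (|(q : ℝ)| + 1)⁻¹)⁻¹ := by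
      rw [← inv_inv (|(q : ℝ)| + 1)]
      exact inv_anti₀ (lt_min hε (by positivity)) (by rw [inv_inv]; exact min_le_right _ _)
    linarith [le_abs_self (q : ℝ)]

theorem WeakTendsto.unique {c : ℕ → LeviCivita} {l l' : LeviCivita} (h : WeakTendsto c l)
    (h' : WeakTendsto c l') : l = l' :=
  coeff_ext fun q => tendsto_nhds_unique (h.tendsto_coeff q) (h'.tendsto_coeff q)

theorem WeakTendsto.add {c c' : ℕ → LeviCivita} {l l' : LeviCivita} (h : WeakTendsto c l)
    (h' : WeakTendsto c' l') : WeakTendsto (fun n => c n + c' n) (l + l') := by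
  intro ε hε
  obtain ⟨n, hn⟩ := h (ε / 2) (half_pos hε)
  obtain ⟨n', hn'⟩ := h' (ε / 2) (half_pos hε)
  refine ⟨max n n', fun m hm q hq => ?_⟩
  have hq' : (q : ℝ) ≤ (ε / 2)⁻¹ :=
    hq.trans (inv_anti₀ (half_pos hε) (half_le_self hε.le))
  have h1 := hn m ((le_max_left _ _).trans_lt hm) q hq'
  have h2 := hn' m ((le_max_right _ _).trans_lt hm) q hq'
  rw [add_sub_add_comm, coeff_add]
  linarith [abs_add_le (coeff (c m - l) q) (coeff (c' m - l') q)]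

/-- The bound on `r` lets the same index `n` serve; only the factors `-1` and `1/2` are needed. -/
theorem WeakTendsto.ofReal_mul {c : ℕ → LeviCivita} {l : LeviCivita} {r : ℝ} (hr : |r| ≤ 1)
    (h : WeakTendsto c l) : WeakTendsto (fun n => ofReal r * c n) (ofReal r * l) := by
  intro ε hε
  obtain ⟨n, hn⟩ := h ε hε
  refine ⟨n, fun m hm q hq => ?_⟩
  rw [← mul_sub, coeff_ofReal_mul, abs_mul]
  exact (mul_le_of_le_one_left (abs_nonneg _) hr).trans_lt (hn m hm q hq)

/-- The family `w`, whose members have their supports in a common left-finite set, sums up to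
`s` at each exponent. -/
structure HasWSum {ι : Type*} (w : ι → LeviCivita) (s : LeviCivita) : Prop where
  supp : ∃ S, LeftFinite S ∧ ∀ i, HasSupp S (w i)
  hasSum : ∀ q, HasSum (fun i => coeff (w i) q) (coeff s q)

namespace HasWSum

variable {ι κ : Type*} {w w' : ι → LeviCivita} {s s' : LeviCivita}

theorem unique (h : HasWSum w s) (h' : HasWSum w s') : s = s' :=
  coeff_ext fun q => (h.hasSum q).unique (h'.hasSum q)

theorem hasSupp (h : HasWSum w s) {S : Set ℚ} (hS : ∀ i, HasSupp S (w i)) : HasSupp S s := by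
  intro q hq
  by_contra hn
  apply hq
  have h1 := h.hasSum q
  have h2 : (fun i => coeff (w i) q) = fun _ => 0 := funext fun i => (hS i).eq_zero hn
  rw [h2] at h1
  exact h1.unique hasSum_zero

theorem suppGE (h : HasWSum w s) {m : ℚ} (hm : ∀ i, SuppGE m (w i)) : SuppGE m s := fun q hq =>
  (h.hasSupp (fun i => (hm i).hasSupp)).eq_zero (by simpa using hq)

theorem add (h : HasWSum w s) (h' : HasWSum w' s') : HasWSum (fun i => w i + w' i) (s + s') := by
  obtain ⟨S, hS, hw⟩ := h.supp
  obtain ⟨S', hS', hw'⟩ := h'.supp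
  refine ⟨⟨S ∪ S', hS.union hS', fun i q hq => ?_⟩, fun q => (h.hasSum q).add (h'.hasSum q)⟩
  by_contra hn
  rw [Set.mem_union, not_or] at hn
  exact hq (by rw [coeff_add, (hw i).eq_zero hn.1, (hw' i).eq_zero hn.2, add_zero])

theorem mul_left (c : LeviCivita) (h : HasWSum w s) : HasWSum (fun i => c * w i) (c * s) := by
  obtain ⟨S, hS, hw⟩ := h.supp
  have hc := leftFinite_supp c
  refine ⟨⟨_, hc.add hS, fun i => HasSupp.mul (fun _ h => h) (hw i)⟩, fun q => ?_⟩
  simp only [coeff_mul hc hS (fun _ h => h) (hw _), coeff_mul hc hS (fun _ h => h) (h.hasSupp hw)]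
  exact hasSum_sum fun ij _ => (h.hasSum ij.2).mul_left _

theorem prod_fiberwise {w : ι × κ → LeviCivita} {r : ι → LeviCivita} (h : HasWSum w s)
    (hr : ∀ i, HasWSum (fun k => w (i, k)) (r i)) : HasWSum r s := by
  obtain ⟨S, hS, hw⟩ := h.supp
  exact ⟨⟨S, hS, fun i => (hr i).hasSupp fun k => hw (i, k)⟩,
    fun q => (h.hasSum q).prod_fiberwise fun i => (hr i).hasSum q⟩

theorem swap {w : ι × κ → LeviCivita} (h : HasWSum w s) :
    HasWSum (fun p : κ × ι => w p.swap) s := by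
  obtain ⟨S, hS, hw⟩ := h.supp
  exact ⟨⟨S, hS, fun i => hw _⟩, fun q => (Equiv.prodComm κ ι).hasSum_iff.2 (h.hasSum q)⟩

/-- Below a bound just above `ε⁻¹` the common support has finitely many exponents, so convergence at
each of them is uniform there; elsewhere all coefficients vanish. -/
theorem weakTendsto {w : ℕ → LeviCivita} (h : HasWSum w s) :
    WeakTendsto (fun N => ∑ n ∈ Finset.range N, w n) s := by
  obtain ⟨S, hS, hw⟩ := h.supp
  intro ε hε
  obtain ⟨r, hr⟩ := exists_nat_gt ε⁻¹
  have hev : ∀ᶠ N in atTop, ∀ q ∈ {x ∈ S | x ≤ (r : ℚ)},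
      |coeff ((∑ n ∈ Finset.range N, w n) - s) q| < ε := by
    rw [(hS r).eventually_all]
    intro q _
    have h1 := (h.hasSum q).tendsto_sum_nat
    filter_upwards [Metric.tendsto_nhds.1 h1 ε hε] with N hN
    rwa [coeff_sub, coeff_sum]
  obtain ⟨n, hn⟩ := eventually_atTop.1 hev
  refine ⟨n, fun m hm q hq => ?_⟩
  by_cases hqS : q ∈ S
  · refine hn m hm.le q ⟨hqS, ?_⟩
    have : (q : ℝ) ≤ r := hq.trans hr.le
    exact_mod_cast this
  · rw [coeff_sub, coeff_sum, (h.hasSupp hw).eq_zero hqS,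
      Finset.sum_eq_zero fun i _ => (hw i).eq_zero hqS]
    simpa using hε

end HasWSum

theorem exists_hasWSum {ι : Type*} {w : ι → LeviCivita} {S : Set ℚ} (hS : LeftFinite S)
    (hw : ∀ i, HasSupp S (w i)) (h : ∀ q, Summable fun i => coeff (w i) q) :
    ∃ s, HasWSum w s := by
  have hlf : LeftFinite (Function.support fun q => ∑' i, coeff (w i) q) := by
    refine hS.mono fun q hq => ?_
    by_contra hn
    apply hq
    simp only [(hw _).eq_zero hn, tsum_zero]
  exact ⟨ofFun _ hlf, ⟨S, hS, hw⟩, fun q => (h q).hasSum⟩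

/-! ### Coefficientwise domination -/

/-- The coefficients of `b` dominate the absolute values of those of `x`. -/
def Dom (x b : LeviCivita) : Prop := ∀ q, |coeff x q| ≤ coeff b q

namespace Dom

variable {x y b c : LeviCivita}

theorem nonneg (h : Dom x b) (q : ℚ) : 0 ≤ coeff b q := (abs_nonneg _).trans (h q)

theorem refl_of_nonneg (h : ∀ q, 0 ≤ coeff b q) : Dom b b := fun q => (abs_of_nonneg (h q)).le

theorem refl_right (h : Dom x b) : Dom b b := refl_of_nonneg h.nonneg

theorem trans (h : Dom x b) (h' : Dom b c) : Dom x c := fun q =>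
  (h q).trans ((le_abs_self _).trans (h' q))

theorem hasSupp (h : Dom x b) {S : Set ℚ} (hb : HasSupp S b) : HasSupp S x := by
  intro q hq
  refine hb q fun h0 => hq ?_
  have := h q
  rw [h0] at this
  exact abs_nonpos_iff.1 this

theorem suppGE (h : Dom x b) {m : ℚ} (hb : SuppGE m b) : SuppGE m x := fun q hq =>
  (h.hasSupp hb.hasSupp).eq_zero (by simpa using hq)

theorem add (h : Dom x b) (h' : Dom y c) : Dom (x + y) (b + c) := fun q => by
  rw [coeff_add, coeff_add]
  exact (abs_add_le _ _).trans (add_le_add (h q) (h' q))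

theorem mul (h : Dom x b) (h' : Dom y c) : Dom (x * y) (b * c) := fun q => by
  have hb := leftFinite_supp b
  have hc := leftFinite_supp c
  rw [coeff_mul hb hc (h.hasSupp fun _ h => h) (h'.hasSupp fun _ h => h),
    coeff_mul hb hc (fun _ h => h) (fun _ h => h)]
  refine (Finset.abs_sum_le_sum_abs _ _).trans (Finset.sum_le_sum fun ij _ => ?_)
  rw [abs_mul]
  exact mul_le_mul (h _) (h' _) (abs_nonneg _) (h.nonneg _)

theorem one : Dom 1 1 := refl_of_nonneg fun q => by rw [coeff_one]; split_ifs <;> simp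

theorem pow (h : Dom x b) (n : ℕ) : Dom (x ^ n) (b ^ n) := by
  induction n with
  | zero => simpa using one
  | succ n ih => rw [pow_succ, pow_succ]; exact ih.mul h

end Dom

/-- Coefficientwise absolute value. -/
noncomputable def absC (x : LeviCivita) : LeviCivita :=
  ofFun (fun q => |coeff x q|) ((leftFinite_supp x).mono fun _ h => abs_ne_zero.1 h)

theorem coeff_absC (x : LeviCivita) (q : ℚ) : coeff (absC x) q = |coeff x q| := rfl

theorem dom_absC (x : LeviCivita) : Dom x (absC x) := fun _ => le_rfl

theorem SuppGE.absC {m : ℚ} {x : LeviCivita} (h : SuppGE m x) : SuppGE m (absC x) := fun q hq => by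
  rw [coeff_absC, h q hq, abs_zero]

theorem HasSupp.absC {S : Set ℚ} {x : LeviCivita} (h : HasSupp S x) : HasSupp S (absC x) :=
  fun q hq => h q (abs_ne_zero.1 hq)

theorem HasWSum.of_dom {ι : Type*} {w b : ι → LeviCivita} {B : LeviCivita} (hb : HasWSum b B)
    (h : ∀ i, Dom (w i) (b i)) : ∃ s, HasWSum w s ∧ Dom s B := by
  obtain ⟨S, hS, hbS⟩ := hb.supp
  have habs : ∀ q, Summable fun i => |coeff (w i) q| := fun q =>
    Summable.of_nonneg_of_le (fun i => abs_nonneg _) (fun i => h i q) (hb.hasSum q).summable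
  obtain ⟨s, hs⟩ := exists_hasWSum hS (fun i => (h i).hasSupp (hbS i))
    fun q => (habs q).of_abs
  exact ⟨s, hs, fun q => (hs.hasSum q).norm_le_of_bounded (hb.hasSum q) fun i => h i q⟩

/-! ### Rapidly decreasing sequences and sequences of polynomial growth -/

/-- At each exponent the sequence decreases faster than any power. -/
structure Rapid (v : ℕ → LeviCivita) : Prop where
  supp : ∃ S, LeftFinite S ∧ ∀ n, HasSupp S (v n)
  summable : ∀ q (k : ℕ), Summable fun n : ℕ => ((n : ℝ) + 1) ^ k * |coeff (v n) q|

/-- At each exponent the sequence is bounded by a polynomial. -/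
structure PolyGrowth (y : ℕ → LeviCivita) : Prop where
  supp : ∃ S, LeftFinite S ∧ ∀ n, HasSupp S (y n)
  bound : ∀ q, ∃ (C : ℝ) (K : ℕ), ∀ n : ℕ, |coeff (y n) q| ≤ C * ((n : ℝ) + 1) ^ K

theorem Rapid.of_dom {v b : ℕ → LeviCivita} (hb : Rapid b) (h : ∀ n, Dom (v n) (b n)) :
    Rapid v := by
  obtain ⟨S, hS, hbS⟩ := hb.supp
  refine ⟨⟨S, hS, fun n => (h n).hasSupp (hbS n)⟩, fun q k => ?_⟩
  refine Summable.of_nonneg_of_le (fun n => by positivity) (fun n => ?_) (hb.summable q k)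
  exact mul_le_mul_of_nonneg_left ((h n q).trans (le_abs_self _)) (by positivity)

theorem Rapid.absC {v : ℕ → LeviCivita} (hv : Rapid v) : Rapid fun n => absC (v n) := by
  obtain ⟨S, hS, hvS⟩ := hv.supp
  refine ⟨⟨S, hS, fun n => (hvS n).absC⟩, fun q k => ?_⟩
  simpa only [coeff_absC, abs_abs] using hv.summable q k

theorem Rapid.exists_hasWSum {v : ℕ → LeviCivita} (hv : Rapid v) : ∃ s, HasWSum v s := by
  obtain ⟨S, hS, hvS⟩ := hv.supp
  refine LC.exists_hasWSum hS hvS fun q => ?_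
  have := hv.summable q 0
  simp only [pow_zero, one_mul] at this
  exact this.of_abs

/-- At a fixed exponent the coefficient of the product is a sum over a finite index set independent
of `n`, and each summand is a rapidly decreasing factor times one of polynomial growth. -/
theorem Rapid.mul_polyGrowth {v y : ℕ → LeviCivita} (hv : Rapid v) (hy : PolyGrowth y) :
    Rapid fun n => v n * y n := by
  obtain ⟨S, hS, hvS⟩ := hv.supp
  obtain ⟨T, hT, hyT⟩ := hy.supp
  refine ⟨⟨_, hS.add hT, fun n => (hvS n).mul (hyT n)⟩, fun q k => ?_⟩
  choose C K hCK using hy.bound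
  refine Summable.of_nonneg_of_le (fun n => by positivity) (fun n => ?_)
    (summable_sum (s := Finset.antidiagonal hS.isPWO hT.isPWO q) fun ij _ =>
      (hv.summable ij.1 (k + K ij.2)).mul_left (C ij.2))
  rw [coeff_mul hS hT (hvS n) (hyT n)]
  refine (mul_le_mul_of_nonneg_left (Finset.abs_sum_le_sum_abs _ _) (by positivity)).trans ?_
  rw [Finset.mul_sum]
  refine Finset.sum_le_sum fun ij _ => ?_
  rw [abs_mul, pow_add]
  calc ((n : ℝ) + 1) ^ k * (|coeff (v n) ij.1| * |coeff (y n) ij.2|)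
      ≤ ((n : ℝ) + 1) ^ k * (|coeff (v n) ij.1| * (C ij.2 * ((n : ℝ) + 1) ^ K ij.2)) := by
        gcongr
        exact hCK _ n
    _ = _ := by ring

theorem PolyGrowth.mul_natCast_pow {y : ℕ → LeviCivita} (hy : PolyGrowth y) (j : ℕ) :
    PolyGrowth fun n => ((n + 1) ^ j : ℕ) * y n := by
  obtain ⟨T, hT, hyT⟩ := hy.supp
  refine ⟨⟨T, hT, fun n q hq => hyT n q fun h0 => hq ?_⟩, fun q => ?_⟩
  · rw [coeff_natCast_mul, h0, mul_zero]
  · obtain ⟨C, K, h⟩ := hy.bound q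
    refine ⟨C, j + K, fun n => ?_⟩
    rw [coeff_natCast_mul, abs_mul, Nat.abs_cast, pow_add]
    push_cast
    calc ((n : ℝ) + 1) ^ j * |coeff (y n) q| ≤ ((n : ℝ) + 1) ^ j * (C * ((n : ℝ) + 1) ^ K) := by
          gcongr; exact h n
      _ = _ := by ring

/-- `Z = 1 + θ` with `θ` infinitesimal and of nonnegative coefficients. -/
def NearOne (Z : LeviCivita) : Prop :=
  ∃ (θ : LeviCivita) (e : ℚ), 0 < e ∧ SuppGE e θ ∧ (∀ q, 0 ≤ coeff θ q) ∧ Z = 1 + θ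

/-- The support of `θ ^ m` starts no earlier than `m * e`, so only the first `K + 1` binomial terms
reach `q`, however large `n` is. -/
theorem coeff_one_add_pow {θ : LeviCivita} {e : ℚ} (hθ : SuppGE e θ) {q : ℚ} {K : ℕ}
    (hK : q < (K + 1) * e) (he : 0 < e) (n : ℕ) :
    coeff ((1 + θ) ^ n) q = ∑ m ∈ Finset.range (K + 1), (n.choose m : ℝ) * coeff (θ ^ m) q := by
  have h1 : coeff ((1 + θ) ^ n) q =
      ∑ m ∈ Finset.range (n + 1), (n.choose m : ℝ) * coeff (θ ^ m) q := by
    rw [add_comm, add_pow, coeff_sum]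
    refine Finset.sum_congr rfl fun m _ => ?_
    rw [one_pow, mul_one, mul_comm, coeff_natCast_mul]
  rw [h1]
  have e1 : Finset.range (n + 1) ⊆ Finset.range (n + 1 + K) :=
    Finset.range_subset_range.2 (by omega)
  have e2 : Finset.range (K + 1) ⊆ Finset.range (n + 1 + K) :=
    Finset.range_subset_range.2 (by omega)
  rw [Finset.sum_subset e1, Finset.sum_subset e2]
  · intro m _ hm
    rw [Finset.mem_range, not_lt] at hm
    have h2 : ((K : ℚ) + 1) ≤ m := by exact_mod_cast hm
    rw [hθ.pow m q (hK.trans_le (by gcongr)), mul_zero]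
  · intro m _ hm
    rw [Finset.mem_range, not_lt] at hm
    rw [Nat.choose_eq_zero_of_lt (by omega), Nat.cast_zero, zero_mul]

theorem exists_nat_lt_mul (q : ℚ) {e : ℚ} (he : 0 < e) : ∃ K : ℕ, q < (K + 1) * e := by
  obtain ⟨K, hK⟩ := exists_nat_gt (q / e)
  rw [div_lt_iff₀ he] at hK
  exact ⟨K, by linarith⟩

/-- By the truncated binomial formula, the coefficient of `Z ^ n` at `q` is a polynomial in `n` of
degree at most `K`. -/
theorem NearOne.polyGrowth {Z : LeviCivita} (hZ : NearOne Z) : PolyGrowth fun n => Z ^ n := by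
  obtain ⟨θ, e, he, hθ, -, rfl⟩ := hZ
  refine ⟨⟨{q | ∃ m : ℕ, coeff (θ ^ m) q ≠ 0}, ?_, ?_⟩, ?_⟩
  · intro r
    obtain ⟨K, hK⟩ := exists_nat_lt_mul r he
    refine ((Finset.range (K + 1)).finite_toSet.biUnion fun m _ =>
      leftFinite_supp (θ ^ m) r).subset ?_
    rintro q ⟨⟨m, hm⟩, hqr⟩
    refine Set.mem_biUnion (x := m) ?_ ⟨hm, hqr⟩
    rw [Finset.mem_coe, Finset.mem_range]
    by_contra hmK
    have h2 : ((K : ℚ) + 1) ≤ m := by exact_mod_cast not_lt.1 hmK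
    exact hm (hθ.pow m q (hqr.trans_lt (hK.trans_le (by gcongr))))
  · intro n q hq
    obtain ⟨K, hK⟩ := exists_nat_lt_mul q he
    rw [coeff_one_add_pow hθ hK he] at hq
    obtain ⟨m, -, hm⟩ := Finset.exists_ne_zero_of_sum_ne_zero hq
    exact ⟨m, right_ne_zero_of_mul hm⟩
  · intro q
    obtain ⟨K, hK⟩ := exists_nat_lt_mul q he
    refine ⟨∑ m ∈ Finset.range (K + 1), |coeff (θ ^ m) q|, K, fun n => ?_⟩
    rw [coeff_one_add_pow hθ hK he, Finset.sum_mul]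
    refine (Finset.abs_sum_le_sum_abs _ _).trans (Finset.sum_le_sum fun m hm => ?_)
    rw [abs_mul, Nat.abs_cast, mul_comm]
    refine mul_le_mul_of_nonneg_left ?_ (abs_nonneg _)
    have h1 : (n.choose m : ℝ) ≤ (n : ℝ) ^ m := by exact_mod_cast Nat.choose_le_pow n m
    have h2 : (n : ℝ) ^ m ≤ ((n : ℝ) + 1) ^ m := by gcongr; linarith
    have h3 : ((n : ℝ) + 1) ^ m ≤ ((n : ℝ) + 1) ^ K :=
      pow_le_pow_right₀ (by linarith [n.cast_nonneg (α := ℝ)])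
        (by have := Finset.mem_range.1 hm; omega)
    linarith

theorem LeftFinite.exists_gap {S : Set ℚ} (hS : LeftFinite S) :
    ∃ e : ℚ, 0 < e ∧ ∀ q ∈ S, 0 < q → e ≤ q := by
  have hfin : {x ∈ {x ∈ S | x ≤ 1} | 0 < x}.Finite := (hS 1).subset fun x hx => hx.1
  rcases Set.eq_empty_or_nonempty {x ∈ {x ∈ S | x ≤ 1} | 0 < x} with h | h
  · refine ⟨1, one_pos, fun q hq h0 => ?_⟩
    by_contra! hlt
    have : q ∈ {x ∈ {x ∈ S | x ≤ 1} | 0 < x} := ⟨⟨hq, hlt.le⟩, h0⟩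
    rw [h] at this
    exact this
  · obtain ⟨m, hm, hmin⟩ := Set.exists_min_image _ id hfin h
    refine ⟨m, hm.2, fun q hq h0 => ?_⟩
    rcases le_total q 1 with h1 | h1
    · exact hmin q ⟨⟨hq, h1⟩, h0⟩
    · exact hm.1.2.trans h1

/-- An element with support in `[0, ∞)`, whose coefficients are nonnegative, and with `b(0) ≤ 1`
is dominated by some `1 + θ`. -/
theorem exists_nearOne {b : LeviCivita} (hb : SuppGE 0 b) (h0 : ∀ q, 0 ≤ coeff b q)
    (h1 : coeff b 0 ≤ 1) : ∃ Z, NearOne Z ∧ Dom b Z := by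
  have hlf : LeftFinite (Function.support fun q => if q ≤ 0 then 0 else coeff b q) := by
    refine (leftFinite_supp b).mono fun q hq => ?_
    rw [Function.mem_support] at hq
    split_ifs at hq
    · exact absurd rfl hq
    · exact hq
  obtain ⟨e, he, hgap⟩ := (leftFinite_supp b).exists_gap
  refine ⟨1 + ofFun _ hlf, ⟨_, e, he, fun q hq => ?_, fun q => ?_, rfl⟩, fun q => ?_⟩
  · rw [coeff_ofFun]
    split_ifs with h
    · rfl
    · by_contra hne
      exact absurd (hgap q hne (not_le.1 h)) (not_le.2 hq)
  · rw [coeff_ofFun]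
    split_ifs
    · exact le_rfl
    · exact h0 q
  · rw [coeff_add, coeff_one, coeff_ofFun, abs_of_nonneg (h0 q)]
    rcases lt_trichotomy q 0 with h | h | h
    · rw [hb q h, if_neg h.ne, if_pos h.le, add_zero]
    · subst h; simpa using h1
    · rw [if_neg h.ne', if_neg (not_le.2 h), zero_add]

theorem NearOne.one_dom {Z : LeviCivita} (hZ : NearOne Z) : Dom 1 Z := by
  obtain ⟨θ, e, he, hθ, h0, rfl⟩ := hZ
  intro q
  rw [coeff_add, coeff_one]
  have := h0 q
  split_ifs <;> simp [this]

theorem NearOne.suppGE {Z : LeviCivita} (hZ : NearOne Z) : SuppGE 0 Z := by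
  obtain ⟨θ, e, he, hθ, h0, rfl⟩ := hZ
  exact suppGE_one.add (hθ.mono he.le)

/-- The bound forces the support into `[0, ∞)` and the coefficient at `0` into `[-1,1]`; all else is
infinitesimal and goes into `θ`. Through this lemma rapidly decreasing series are summed on the
whole closed unit ball, including its boundary. -/
theorem exists_nearOne_of_abs_le {z : LeviCivita} (hz : |z| ≤ 1) : ∃ Z, NearOne Z ∧ Dom z Z := by
  rw [← ofReal_one] at hz
  obtain ⟨Z, hZ, h⟩ := exists_nearOne (suppGE_of_abs_le_ofReal hz).absC
    (fun q => abs_nonneg _) (abs_coeff_le_of_abs_le hz)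
  exact ⟨Z, hZ, (dom_absC z).trans h⟩

/-! ### Power series that converge weakly on `(0,1)` are rapidly decreasing -/

/-- The bound `C` makes the sum analytic on the ball of radius `3/4`, and the infinite set `W` has
an accumulation point in the compact interval `[1/4, 1/2]` inside it. The identity theorem applies.
-/
theorem eq_zero_of_tendsto_zero_of_infinite {c : ℕ → ℝ} {C : ℝ}
    (hC : ∀ n, |c n| * (3 / 4 : ℝ) ^ n ≤ C) {W : Set ℝ} (hW : W.Infinite)
    (hWs : W ⊆ Set.Icc (1 / 4) (1 / 2))
    (h : ∀ r ∈ W, Tendsto (fun N => ∑ n ∈ Finset.range N, c n * r ^ n) atTop (𝓝 0)) (n : ℕ) :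
    c n = 0 := by
  set p := FormalMultilinearSeries.ofScalars ℝ c with hp
  have hrad : ((3 / 4 : NNReal) : ENNReal) ≤ p.radius := by
    refine p.le_radius_of_bound C fun n => ?_
    rw [hp, FormalMultilinearSeries.ofScalars_norm]
    simpa using hC n
  have hpos : 0 < p.radius := lt_of_lt_of_le (by norm_num) hrad
  have hfp := p.hasFPowerSeriesOnBall hpos
  have hmem : ∀ x : ℝ, |x| < 3 / 4 → x ∈ Metric.eball (0 : ℝ) p.radius := by
    intro x hx
    rw [Metric.mem_eball, edist_zero_right]
    refine lt_of_lt_of_le ?_ hrad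
    rw [enorm_eq_nnnorm]
    have : ‖x‖₊ < 3 / 4 := by
      rw [← NNReal.coe_lt_coe]; simpa using hx
    exact_mod_cast this
  have hsum : ∀ x : ℝ, |x| < 3 / 4 → HasSum (fun n => c n * x ^ n) (p.sum x) := by
    intro x hx
    have := hfp.hasSum (hmem x hx)
    simpa [hp, mul_comm] using this
  have han : AnalyticOnNhd ℝ p.sum (Metric.ball (0 : ℝ) (3 / 4)) := fun x hx =>
    hfp.analyticOnNhd x (hmem x (by simpa using hx))
  obtain ⟨x, hx, hacc⟩ := hW.exists_accPt_of_subset_isCompact isCompact_Icc hWs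
  have hz : ∀ r ∈ W, p.sum r = 0 := fun r hr => by
    refine tendsto_nhds_unique (hsum r ?_).tendsto_sum_nat (h r hr)
    have := hWs hr
    rw [abs_lt]
    constructor <;> linarith [this.1, this.2]
  have hfreq : ∃ᶠ z in 𝓝[≠] x, p.sum z = 0 :=
    (accPt_iff_frequently_nhdsNE.1 hacc).mono fun z hz' => hz z hz'
  have hE := han.eqOn_zero_of_preconnected_of_frequently_eq_zero
    (convex_ball (0 : ℝ) (3 / 4)).isPreconnected (z₀ := x)
    (by rw [Metric.mem_ball, dist_zero_right, Real.norm_eq_abs, abs_lt]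
        constructor <;> linarith [hx.1, hx.2]) hfreq
  have h0 : HasFPowerSeriesAt (0 : ℝ → ℝ) p 0 := by
    refine (hfp.hasFPowerSeriesAt).congr ?_
    filter_upwards [Metric.ball_mem_nhds (0 : ℝ) (by norm_num : (0 : ℝ) < 3 / 4)] with z hz'
    exact hE hz'
  have hp0 := h0.eq_zero
  have := (FormalMultilinearSeries.ofScalars_series_eq_zero ℝ).1 (hp.symm.trans hp0)
  exact congrFun this n

theorem coeff_partialSum_ofReal (v : ℕ → LeviCivita) (r : ℝ) (N : ℕ) (q : ℚ) :
    coeff (∑ n ∈ Finset.range N, v n * ofReal r ^ n) q =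
      ∑ n ∈ Finset.range N, coeff (v n) q * r ^ n := by
  rw [coeff_sum]
  refine Finset.sum_congr rfl fun n _ => ?_
  rw [← ofReal_pow, mul_comm, coeff_ofReal_mul, mul_comm]

theorem tendsto_zero_of_tendsto_partialSum {u : ℕ → ℝ} {l : ℝ}
    (h : Tendsto (fun N => ∑ n ∈ Finset.range N, u n) atTop (𝓝 l)) : Tendsto u atTop (𝓝 0) := by
  have h1 := (h.comp (tendsto_add_atTop_nat 1)).sub h
  rw [sub_self] at h1
  refine h1.congr fun n => ?_
  simp [Finset.sum_range_succ]

/-- The power series with coefficients `v` converges weakly on `(0,1)`. -/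
def ConvUnit (v : ℕ → LeviCivita) : Prop :=
  ∀ z : LeviCivita, 0 < z → z < 1 →
    ∃ l, WeakTendsto (fun N => ∑ n ∈ Finset.range N, v n * z ^ n) l

/-- Suppose infinitely many exponents below `q₀` occur. At each real `r` the weak limit has only
finitely many of them in its support, and uncountability of the real points makes one of these
exponents absent from the limit for infinitely many `r`. The real power series at that exponent then
vanishes identically, a contradiction. -/
theorem ConvUnit.supp {v : ℕ → LeviCivita} (hv : ConvUnit v) :
    ∃ S, LeftFinite S ∧ ∀ n, HasSupp S (v n) := by
  refine ⟨{q | ∃ n, coeff (v n) q ≠ 0}, ?_, fun n q hq => ⟨n, hq⟩⟩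
  intro q₀
  by_contra hinf
  have hreal : ∀ r : ℝ, 0 < r → r < 1 → ∃ l : LeviCivita, ∀ q,
      Tendsto (fun N => ∑ n ∈ Finset.range N, coeff (v n) q * r ^ n) atTop (𝓝 (coeff l q)) := by
    intro r h0 h1
    obtain ⟨l, hl⟩ := hv (ofReal r) (ofReal_zero ▸ ofReal_lt h0) (ofReal_one ▸ ofReal_lt h1)
    refine ⟨l, fun q => (hl.tendsto_coeff q).congr fun N => coeff_partialSum_ofReal v r N q⟩
  choose! l hl using hreal
  set g := Set.Infinite.natEmbedding _ hinf with hg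
  have hfinal : ∀ r : ℝ, ∃ J : ℕ, ∀ j ≥ J, coeff (l r) (g j) = 0 := by
    intro r
    have hfin : {j : ℕ | coeff (l r) (g j) ≠ 0}.Finite := by
      refine Set.Finite.of_finite_image (f := fun j => (g j : ℚ)) ?_ ?_
      · refine (leftFinite_supp (l r) q₀).subset ?_
        rintro _ ⟨j, hj, rfl⟩
        exact ⟨hj, (g j).2.2⟩
      · exact fun i _ j _ h => g.injective (Subtype.ext h)
    obtain ⟨J, hJ⟩ := hfin.bddAbove
    refine ⟨J + 1, fun j hj => ?_⟩
    by_contra hne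
    have := hJ hne
    omega
  have hunc : ¬ (Set.Icc (1 / 4 : ℝ) (1 / 2)).Countable := by
    rw [← Cardinal.le_aleph0_iff_set_countable, Cardinal.mk_Icc_real (by norm_num), not_le]
    exact Cardinal.aleph0_lt_continuum
  -- The uncountable interval is the union over `J` of these sets, so they cannot all be finite.
  obtain ⟨J, hJ⟩ : ∃ J : ℕ,
      {r ∈ Set.Icc (1 / 4 : ℝ) (1 / 2) | ∀ j ≥ J, coeff (l r) (g j) = 0}.Infinite := by
    by_contra! hcon
    apply hunc
    refine (Set.countable_iUnion fun J => (hcon J).countable).mono fun r hr => ?_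
    obtain ⟨J, hJ⟩ := hfinal r
    exact Set.mem_iUnion.2 ⟨J, hr, hJ⟩
  obtain ⟨n, hn⟩ := (g J).2.1
  refine hn ?_
  -- Convergence at the real point `3/4` bounds the terms there.
  have hb := (tendsto_zero_of_tendsto_partialSum
    (hl (3 / 4) (by norm_num) (by norm_num) (g J))).norm.bddAbove_range
  obtain ⟨C, hC⟩ := hb
  refine eq_zero_of_tendsto_zero_of_infinite (c := fun n => coeff (v n) (g J)) (C := C)
    (fun n => ?_) hJ (fun r hr => hr.1) (fun r hr => ?_) n
  · have := hC ⟨n, rfl⟩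
    simpa [abs_mul] using this
  · have := hl r (by linarith [hr.1.1]) (by linarith [hr.1.2]) (g J)
    rwa [hr.2 J le_rfl] at this

/-- Replacing `c` by `2 * c` and subtracting `2 ^ K` times the original cancels the term of degree
`K` and multiplies each lower one by a nonzero constant; then induct on the degree. -/
theorem tendsto_zero_of_polynomial {K : ℕ} {α : ℕ → ℕ → ℝ}
    (h : ∀ c : ℝ, 0 < c →
      Tendsto (fun n => ∑ m ∈ Finset.range K, c ^ m * α m n) atTop (𝓝 0)) :
    ∀ m < K, Tendsto (α m) atTop (𝓝 0) := by
  induction K generalizing α with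
  | zero => intro m hm; omega
  | succ K ih =>
    have hlow : ∀ m < K, Tendsto (α m) atTop (𝓝 0) := by
      have h1 : ∀ m < K, Tendsto (fun n => ((2 : ℝ) ^ m - 2 ^ K) * α m n) atTop (𝓝 0) := by
        refine ih (α := fun m n => ((2 : ℝ) ^ m - 2 ^ K) * α m n) fun c hc => ?_
        have h2 := (h (2 * c) (by positivity)).sub ((h c hc).const_mul (2 ^ K))
        rw [mul_zero, sub_zero] at h2
        refine h2.congr fun n => ?_
        rw [Finset.sum_range_succ, Finset.sum_range_succ, mul_add, Finset.mul_sum,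
          add_sub_add_comm, ← Finset.sum_sub_distrib, mul_pow 2 c K]
        rw [show (2 : ℝ) ^ K * c ^ K * α K n - 2 ^ K * (c ^ K * α K n) = 0 by ring, add_zero]
        refine Finset.sum_congr rfl fun m _ => ?_
        rw [mul_pow]; ring
      intro m hm
      have hne : (2 : ℝ) ^ m - 2 ^ K ≠ 0 := by
        have : (2 : ℝ) ^ m < 2 ^ K := pow_lt_pow_right₀ (by norm_num) hm
        linarith
      have := (h1 m hm).const_mul ((2 : ℝ) ^ m - 2 ^ K)⁻¹
      rw [mul_zero] at this
      refine this.congr fun n => ?_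
      rw [inv_mul_cancel_left₀ hne]
    intro m hm
    rcases Nat.lt_succ_iff_lt_or_eq.1 hm with hm | rfl
    · exact hlow m hm
    · have h1 := h 1 one_pos
      have h2 : Tendsto (fun n => ∑ i ∈ Finset.range m, (1 : ℝ) ^ i * α i n) atTop (𝓝 0) := by
        rw [← Finset.sum_const_zero (s := Finset.range m)]
        refine tendsto_finsetSum _ fun i hi => ?_
        simpa using hlow i (Finset.mem_range.1 hi)
      have h3 := h1.sub h2
      rw [sub_zero] at h3
      refine h3.congr fun n => ?_
      rw [Finset.sum_range_succ]; simp

theorem monomial_pow (q : ℚ) (r : ℝ) (m : ℕ) : monomial q r ^ m = monomial (m * q) (r ^ m) := by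
  induction m with
  | zero => simp only [pow_zero, Nat.cast_zero, zero_mul]; rfl
  | succ m ih => rw [pow_succ, ih, monomial_mul, pow_succ]; congr 1; push_cast; ring

theorem coeff_mul_one_sub_pow {x : LeviCivita} {m₀ q : ℚ} (hx : SuppGE m₀ x) {K : ℕ}
    (hK : q - K < m₀) (c : ℝ) (n : ℕ) :
    coeff (x * (1 - monomial 1 c) ^ n) q =
      ∑ m ∈ Finset.range K, c ^ m * ((-1) ^ m * (n.choose m : ℝ) * coeff x (q - m)) := by
  have hm : -monomial 1 c = monomial 1 (-c) := coeff_ext fun q => by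
    rw [coeff_neg, coeff_monomial, coeff_monomial]; split_ifs <;> simp
  have h1 : coeff (x * (1 - monomial 1 c) ^ n) q =
      ∑ m ∈ Finset.range (n + 1), c ^ m * ((-1) ^ m * (n.choose m : ℝ) * coeff x (q - m)) := by
    rw [sub_eq_add_neg, hm, add_comm 1, add_pow, Finset.mul_sum, coeff_sum]
    refine Finset.sum_congr rfl fun m _ => ?_
    rw [one_pow, mul_one, monomial_pow, show x * (monomial (m * 1) ((-c) ^ m) * (n.choose m : LeviCivita)) =
      n.choose m * (monomial (m * 1) ((-c) ^ m) * x) by ring, coeff_natCast_mul, coeff_monomial_mul]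
    rw [mul_one, neg_pow]; ring
  rw [h1]
  have e1 : Finset.range (n + 1) ⊆ Finset.range (n + 1 + K) :=
    Finset.range_subset_range.2 (by omega)
  have e2 : Finset.range K ⊆ Finset.range (n + 1 + K) :=
    Finset.range_subset_range.2 (by omega)
  rw [Finset.sum_subset e1, Finset.sum_subset e2]
  · intro m _ hm
    rw [Finset.mem_range, not_lt] at hm
    have h2 : (K : ℚ) ≤ m := by exact_mod_cast hm
    rw [hx (q - m) (by linarith), mul_zero, mul_zero]
  · intro m _ hm
    rw [Finset.mem_range, not_lt] at hm
    rw [Nat.choose_eq_zero_of_lt (by omega)]; simp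

/-- The series is tested at points infinitely close to `1`, namely `1 - c d` with `d` the monomial
of exponent `1`. At exponent `q + k` its terms are polynomials in `c` of bounded degree tending to
zero for each `c > 0`, and the coefficient of `c ^ k` is, up to sign, the quantity wanted. -/
theorem ConvUnit.tendsto_choose_mul {v : ℕ → LeviCivita} (hv : ConvUnit v) (q : ℚ) (k : ℕ) :
    Tendsto (fun n => (n.choose k : ℝ) * coeff (v n) q) atTop (𝓝 0) := by
  obtain ⟨S, hS, hvS⟩ := hv.supp
  obtain ⟨m₀, hm₀⟩ := hS.exists_le
  have hge : ∀ n, SuppGE m₀ (v n) := fun n p hp => by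
    by_contra hne
    exact absurd (hm₀ p (hvS n p hne)) (not_le.2 hp)
  obtain ⟨K, hK⟩ := exists_nat_gt (q + k - m₀)
  have h1 : ∀ c : ℝ, 0 < c → Tendsto (fun n => ∑ m ∈ Finset.range (K + k + 1),
      c ^ m * ((-1) ^ m * (n.choose m : ℝ) * coeff (v n) (q + k - m))) atTop (𝓝 0) := by
    intro c hc
    have hpos : 0 < monomial 1 c := monomial_pos 1 hc
    have hlt : monomial 1 c < 1 :=
      lt_of_abs_lt ((suppGE_monomial 1 c).abs_lt_monomial (m' := 0) (by norm_num) one_pos)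
    obtain ⟨l, hl⟩ := hv (1 - monomial 1 c) (sub_pos.2 hlt) (sub_lt_self 1 hpos)
    have h2 := hl.tendsto_coeff (q + k)
    simp only [coeff_sum] at h2
    refine (tendsto_zero_of_tendsto_partialSum h2).congr fun n => ?_
    exact coeff_mul_one_sub_pow (hge n) (by push_cast; linarith [k.cast_nonneg (α := ℚ)]) c n
  have h2 := (tendsto_zero_of_polynomial h1 k (by omega)).const_mul ((-1) ^ k)
  rw [mul_zero] at h2
  refine h2.congr fun n => ?_
  rw [add_sub_cancel_right, ← mul_assoc, ← mul_assoc, ← mul_pow]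
  simp

theorem add_one_pow_le_choose {n j : ℕ} (h : 2 * j ≤ n + 1) :
    ((n : ℝ) + 1) ^ j ≤ 2 ^ j * j.factorial * n.choose j := by
  have h1 : (n + 1) ^ j ≤ 2 ^ j * (j.factorial * n.choose j) := by
    rw [← Nat.descFactorial_eq_factorial_mul_choose]
    calc (n + 1) ^ j ≤ (2 * (n + 1 - j)) ^ j := Nat.pow_le_pow_left (by omega) j
      _ = 2 ^ j * (n + 1 - j) ^ j := mul_pow _ _ _
      _ ≤ _ := Nat.mul_le_mul_left _ (Nat.pow_sub_le_descFactorial n j)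
  rw [mul_assoc]
  exact_mod_cast h1

theorem ConvUnit.rapid {v : ℕ → LeviCivita} (hv : ConvUnit v) : Rapid v := by
  refine ⟨hv.supp, fun q k => ?_⟩
  -- The two powers beyond `k` pay for the convergent majorant `1 / (n + 1) ^ 2`.
  have h1 := hv.tendsto_choose_mul q (k + 2)
  have hsum : Summable fun n : ℕ =>
      (2 ^ (k + 2) * (k + 2).factorial : ℝ) * (1 / ((n : ℝ) + 1) ^ 2) := by
    refine Summable.mul_left _ ?_
    have := (summable_nat_add_iff 1).2 (Real.summable_one_div_nat_pow.2 (one_lt_two))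
    simpa using this
  refine Summable.of_norm_bounded_eventually_nat hsum ?_
  filter_upwards [Metric.tendsto_nhds.1 h1 1 one_pos, eventually_ge_atTop (2 * (k + 2))]
    with n hn hk
  rw [Real.dist_eq, sub_zero, abs_mul, Nat.abs_cast] at hn
  rw [Real.norm_of_nonneg (by positivity), mul_one_div, le_div_iff₀ (by positivity)]
  calc ((n : ℝ) + 1) ^ k * |coeff (v n) q| * ((n : ℝ) + 1) ^ 2
      = ((n : ℝ) + 1) ^ (k + 2) * |coeff (v n) q| := by rw [pow_add]; ring
    _ ≤ 2 ^ (k + 2) * (k + 2).factorial * n.choose (k + 2) * |coeff (v n) q| := by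
        gcongr
        exact add_one_pow_le_choose (by omega)
    _ = 2 ^ (k + 2) * (k + 2).factorial * (n.choose (k + 2) * |coeff (v n) q|) := by ring
    _ ≤ 2 ^ (k + 2) * (k + 2).factorial * 1 := by gcongr
    _ = _ := mul_one _

/-! ### Second-order Taylor expansion of rapidly decreasing series. -/

theorem hasWSum_of_finite {w : ℕ → LeviCivita} {N : ℕ} (h : ∀ n, N ≤ n → w n = 0) :
    HasWSum w (∑ n ∈ Finset.range N, w n) := by
  refine ⟨⟨⋃ n ∈ Finset.range N, {q | coeff (w n) q ≠ 0}, ?_, fun n q hq => ?_⟩, fun q => ?_⟩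
  · intro r
    refine ((Finset.range N).finite_toSet.biUnion fun m _ => leftFinite_supp (w m) r).subset ?_
    rintro q ⟨hq, hqr⟩
    obtain ⟨m, hm, hq⟩ := Set.mem_iUnion₂.1 hq
    exact Set.mem_biUnion (Finset.mem_coe.2 hm) ⟨hq, hqr⟩
  · refine Set.mem_iUnion₂.2 ⟨n, ?_, hq⟩
    rw [Finset.mem_range]
    by_contra hn
    rw [h n (not_lt.1 hn)] at hq
    exact hq rfl
  · rw [coeff_sum]
    refine hasSum_sum_of_ne_finset_zero fun n hn => ?_
    rw [h n (not_lt.1 fun h' => hn (Finset.mem_range.2 h'))]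
    rfl

theorem Dom.natCast_mul {x b : LeviCivita} (h : Dom x b) {m n : ℕ} (hmn : m ≤ n) :
    Dom (m * x) (n * b) := fun q => by
  rw [coeff_natCast_mul, coeff_natCast_mul, abs_mul, Nat.abs_cast]
  have : (m : ℝ) ≤ n := by exact_mod_cast hmn
  exact mul_le_mul this (h q) (abs_nonneg _) (Nat.cast_nonneg _)

theorem NearOne.dom_pow_pow {Z : LeviCivita} (hZ : NearOne Z) {m n : ℕ} (h : m ≤ n) :
    Dom (Z ^ m) (Z ^ n) := by
  obtain ⟨k, rfl⟩ := Nat.exists_eq_add_of_le h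
  have := (hZ.one_dom.refl_right.pow m).mul (hZ.one_dom.pow k)
  rwa [one_pow, mul_one, ← pow_add] at this

theorem Rapid.mul_pow {v : ℕ → LeviCivita} (hv : Rapid v) {z Z : LeviCivita} (hZ : NearOne Z)
    (hz : Dom z Z) : Rapid fun n => v n * z ^ n :=
  (hv.absC.mul_polyGrowth hZ.polyGrowth).of_dom fun n => (dom_absC _).mul (hz.pow n)

theorem Rapid.exists_suppGE {v : ℕ → LeviCivita} (hv : Rapid v) : ∃ m, ∀ n, SuppGE m (v n) := by
  obtain ⟨S, hS, hvS⟩ := hv.supp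
  obtain ⟨m, hm⟩ := hS.exists_le
  refine ⟨m, fun n q hq => (hvS n).eq_zero fun h => ?_⟩
  exact absurd (hm q h) (not_le.2 hq)

/-- The remainder is kept as an explicit factor `Q n` whose growth is only quadratic in `n` times `Z
^ n`, which a rapidly decreasing sequence absorbs. -/
theorem exists_pow_taylor {z z' Z : LeviCivita} (hZ : NearOne Z) (hz : Dom z Z)
    (hz' : Dom z' Z) : ∃ Q : ℕ → LeviCivita,
      (∀ n : ℕ, z' ^ n = z ^ n + n * z ^ (n - 1) * (z' - z) + Q n * (z' - z) ^ 2) ∧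
      ∀ n, Dom (Q n) (((n + 1) ^ 2 : ℕ) * Z ^ n) := by
  have key : ∀ n : ℕ, ∃ Q : LeviCivita,
      z' ^ n = z ^ n + n * z ^ (n - 1) * (z' - z) + Q * (z' - z) ^ 2 ∧
      Dom Q (((n + 1) ^ 2 : ℕ) * Z ^ n) := by
    intro n
    induction n with
    | zero =>
      refine ⟨0, by simp, fun q => ?_⟩
      have := hZ.one_dom.refl_right.pow 0 |>.nonneg q
      rw [coeff_zero, abs_zero, coeff_natCast_mul]
      positivity
    | succ n ih =>
      obtain ⟨Q, h1, h2⟩ := ih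
      -- Obtained by multiplying the expansion of `z' ^ n` by `z' = z + (z' - z)`.
      refine ⟨Q * z' + n * z ^ (n - 1), ?_, ?_⟩
      · have h3 : (n : LeviCivita) * z ^ (n - 1) * z = n * z ^ n := by
          rcases n with _ | n
          · simp
          · rw [Nat.add_sub_cancel, mul_assoc, ← pow_succ]
        rw [Nat.add_sub_cancel, pow_succ, pow_succ z]
        push_cast
        linear_combination z' * h1 + (z' - z) * h3
      · have h3 := h2.mul hz'
        rw [mul_assoc, ← pow_succ] at h3
        have h4 := ((hz.pow (n - 1)).trans (hZ.dom_pow_pow (n := n + 1) (by omega))).natCast_mul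
          (le_refl n)
        refine (h3.add h4).trans ?_
        rw [← add_mul, ← Nat.cast_add]
        -- The constants fit because `(n + 1) ^ 2 + n ≤ (n + 2) ^ 2`.
        exact (hZ.dom_pow_pow le_rfl).natCast_mul (by ring_nf; omega)
  choose Q hQ using key
  exact ⟨Q, fun n => (hQ n).1, fun n => (hQ n).2⟩

/-- The expansions of the powers are summed term by term. Two uniformities matter: `B` is fixed
before the points, which serves the real parametrization of an interval, and `m` does not depend on
`Z`, which serves the derivative estimate, where `Z` varies with the point. -/
theorem Rapid.exists_taylor {v : ℕ → LeviCivita} (hv : Rapid v) {Z : LeviCivita}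
    (hZ : NearOne Z) {m : ℚ} (hm : ∀ n, SuppGE m (v n)) :
    ∃ B : LeviCivita, ∀ z z' s s' : LeviCivita, Dom z Z → Dom z' Z →
      HasWSum (fun n => v n * z ^ n) s → HasWSum (fun n => v n * z' ^ n) s' →
      ∃ d K, HasWSum (fun n => v n * (n * z ^ (n - 1))) d ∧ Dom d B ∧ Dom K B ∧
        SuppGE m d ∧ SuppGE m K ∧ s' = s + d * (z' - z) + K * (z' - z) ^ 2 := by
  obtain ⟨B, hB⟩ := (hv.absC.mul_polyGrowth (hZ.polyGrowth.mul_natCast_pow 2)).exists_hasWSum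
  refine ⟨B, fun z z' s s' hz hz' hs hs' => ?_⟩
  obtain ⟨Q, hQ, hQd⟩ := exists_pow_taylor hZ hz hz'
  have hge : ∀ n, SuppGE 0 (((n + 1) ^ 2 : ℕ) * Z ^ n) := fun n q hq => by
    rw [coeff_natCast_mul, hZ.suppGE.pow_zero n q hq, mul_zero]
  have hdd : ∀ n : ℕ, Dom (n * z ^ (n - 1)) (((n + 1) ^ 2 : ℕ) * Z ^ n) := fun n =>
    ((hz.pow (n - 1)).trans (hZ.dom_pow_pow (by omega))).natCast_mul (by nlinarith)
  obtain ⟨d, hd, hdB⟩ := hB.of_dom fun n => (dom_absC (v n)).mul (hdd n)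
  obtain ⟨K, hK, hKB⟩ := hB.of_dom fun n => (dom_absC (v n)).mul (hQd n)
  refine ⟨d, K, hd, hdB, hKB, hd.suppGE fun n => ?_, hK.suppGE fun n => ?_, ?_⟩
  · simpa using (hm n).mul ((hdd n).suppGE (hge n))
  · simpa using (hm n).mul ((hQd n).suppGE (hge n))
  · refine hs'.unique ?_
    have h := (hs.add (hd.mul_left (z' - z))).add (hK.mul_left ((z' - z) ^ 2))
    rw [mul_comm d, mul_comm K]
    refine cast (congrArg (fun w => HasWSum w _) (funext fun n => ?_)) h
    rw [hQ n]; ring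

/-! ### Representation of simple functions by rapidly decreasing series -/

/-- On `D` the function `f` is the sum of the series `∑ v n * ((x - x₀) / H) ^ n`, where `v` is
rapidly decreasing and `D` lies within distance `|H|` of `x₀`. -/
structure Rep (f : LeviCivita → LeviCivita) (D : Set LeviCivita) (x₀ H : LeviCivita)
    (v : ℕ → LeviCivita) : Prop where
  ne_zero : H ≠ 0
  rapid : Rapid v
  dist_le : ∀ x ∈ D, |x - x₀| ≤ |H|
  hasWSum : ∀ x ∈ D, HasWSum (fun n => v n * ((x - x₀) / H) ^ n) (f x)

theorem abs_div_le_one {x H : LeviCivita} (hH : H ≠ 0) (h : |x| ≤ |H|) : |x / H| ≤ 1 := by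
  rw [abs_div, div_le_one (abs_pos.2 hH)]
  exact h

theorem Rapid.exists_hasWSum_pow {v : ℕ → LeviCivita} (hv : Rapid v) {z : LeviCivita}
    (hz : |z| ≤ 1) : ∃ s, HasWSum (fun n => v n * z ^ n) s := by
  obtain ⟨Z, hZ, hzZ⟩ := exists_nearOne_of_abs_le hz
  exact (hv.mul_pow hZ hzZ).exists_hasWSum

/-- Take for `H` the signed distance from the centre to the farther endpoint. The points `x₀ + H *
z` with `0 < z < 1` then stay inside the interval, so the rescaled series converges weakly on
`(0,1)`, while the whole closed interval lies within `|H|` of `x₀`. -/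
theorem IsSimpleOn.exists_rep {f : LeviCivita → LeviCivita} {I : Interval} (h : IsSimpleOn f I)
    (hI : I.left < I.right) :
    ∃ x₀ ∈ Set.Icc I.left I.right, ∃ H v,
      (∀ x ∈ Set.Icc I.left I.right, |x - x₀| ≤ |H|) ∧ Rep f I.carrier x₀ H v := by
  obtain ⟨x₀, hx₀, a, ha⟩ := h
  obtain ⟨H, hH, hdist, hin⟩ : ∃ H : LeviCivita, H ≠ 0 ∧
      (∀ x ∈ Set.Icc I.left I.right, |x - x₀| ≤ |H|) ∧
      ∀ z, 0 < z → z < 1 → x₀ + H * z ∈ Set.Ioo I.left I.right := by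
    rcases le_total (x₀ - I.left) (I.right - x₀) with hle | hle
    · have hpos : 0 < I.right - x₀ := by linarith
      refine ⟨I.right - x₀, hpos.ne', fun x hx => ?_, fun z h0 h1 => ?_⟩
      · rw [abs_of_pos hpos]
        exact abs_le.2 ⟨by linarith [hx.1], by linarith [hx.2]⟩
      · constructor <;> nlinarith [hx₀.1, hx₀.2]
    · have hpos : 0 < x₀ - I.left := by linarith
      refine ⟨I.left - x₀, by linarith, fun x hx => ?_, fun z h0 h1 => ?_⟩
      · rw [abs_sub_comm I.left, abs_of_pos hpos]
        exact abs_le.2 ⟨by linarith [hx.1], by linarith [hx.2]⟩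
      · constructor <;> nlinarith [hx₀.1, hx₀.2]
  have hcu : ConvUnit fun n => a n * H ^ n := by
    intro z h0 h1
    refine ⟨_, (cast (congrArg (fun w => WeakTendsto w _) (funext fun N => ?_))
      (ha _ (I.Ioo_subset (hin z h0 h1))))⟩
    refine Finset.sum_congr rfl fun n _ => ?_
    rw [add_sub_cancel_left, mul_pow, mul_assoc]
  refine ⟨x₀, hx₀, H, _, hdist, hH, hcu.rapid, fun x hx => hdist x (I.subset_Icc hx),
    fun x hx => ?_⟩
  obtain ⟨s, hs⟩ := hcu.rapid.exists_hasWSum_pow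
    (abs_div_le_one hH (hdist x (I.subset_Icc hx)))
  have hs' := hs.weakTendsto
  have : s = f x := by
    refine hs'.unique (cast (congrArg (fun w => WeakTendsto w _) (funext fun N => ?_)) (ha x hx))
    refine Finset.sum_congr rfl fun n _ => ?_
    rw [div_pow, mul_assoc, mul_div_cancel₀ _ (pow_ne_zero n hH)]
  rwa [this] at hs

theorem Rep.isSimpleOn {f : LeviCivita → LeviCivita} {I : Interval} {x₀ H : LeviCivita}
    {v : ℕ → LeviCivita} (h : Rep f I.carrier x₀ H v) (hx₀ : x₀ ∈ Set.Icc I.left I.right) :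
    IsSimpleOn f I := by
  refine ⟨x₀, hx₀, fun n => v n / H ^ n, fun x hx => ?_⟩
  refine cast (congrArg (fun w => WeakTendsto w _) (funext fun N => ?_))
    (h.hasWSum x hx).weakTendsto
  refine Finset.sum_congr rfl fun n _ => ?_
  rw [div_pow]; ring

theorem hasWSum_binomial (V a c : LeviCivita) (n : ℕ) :
    HasWSum (fun k => V * ((n.choose k : LeviCivita) * (a ^ (n - k) * c ^ k)))
      (V * (a + c) ^ n) := by
  have h : V * (a + c) ^ n = ∑ k ∈ Finset.range (n + 1),
      V * ((n.choose k : LeviCivita) * (a ^ (n - k) * c ^ k)) := by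
    rw [add_comm a c, add_pow, Finset.mul_sum]
    refine Finset.sum_congr rfl fun k _ => ?_
    ring
  rw [h]
  refine hasWSum_of_finite fun k hk => ?_
  rw [Nat.choose_eq_zero_of_lt (by omega), Nat.cast_zero, zero_mul, mul_zero]

/-- Here `h0` encodes that all terms have nonnegative coefficients. Summability over pairs then
follows from that of the row sums `v n * (a + c) ^ n`. -/
theorem Rapid.exists_hasWSum_double {v : ℕ → LeviCivita} (hv : Rapid v) {a c : LeviCivita}
    (h0 : ∀ n k, Dom (v n * ((n.choose k : LeviCivita) * (a ^ (n - k) * c ^ k)))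
      (v n * ((n.choose k : LeviCivita) * (a ^ (n - k) * c ^ k))))
    {Z : LeviCivita} (hZ : NearOne Z) (hac : Dom (a + c) Z) :
    ∃ B, HasWSum (fun p : ℕ × ℕ =>
      v p.1 * ((p.1.choose p.2 : LeviCivita) * (a ^ (p.1 - p.2) * c ^ p.2))) B := by
  have hrap := hv.mul_pow hZ hac
  have hfib := fun n => hasWSum_binomial (v n) a c n
  obtain ⟨S, hS, hvS⟩ := hrap.supp
  have hbbS : ∀ n k, HasSupp S (v n * ((n.choose k : LeviCivita) * (a ^ (n - k) * c ^ k))) := by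
    intro n k
    refine Dom.hasSupp (b := v n * (a + c) ^ n) (fun q => ?_) (hvS n)
    refine (h0 n k q).trans ?_
    exact le_hasSum ((hfib n).hasSum q) k fun j _ => (h0 n j).nonneg q
  refine LC.exists_hasWSum hS (fun p => hbbS p.1 p.2) fun q => ?_
  rw [summable_prod_of_nonneg fun p => (h0 p.1 p.2).nonneg q]
  refine ⟨fun n => ((hfib n).hasSum q).summable, ?_⟩
  have h1 := hrap.summable q 0
  simp only [pow_zero, one_mul] at h1
  exact h1.of_abs.congr fun n => (((hfib n).hasSum q).tsum_eq).symm

/-- Expansion about another centre `x₁`. -/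
theorem Rep.recenter {f : LeviCivita → LeviCivita} {D : Set LeviCivita} {x₀ H : LeviCivita}
    {v : ℕ → LeviCivita} (h : Rep f D x₀ H v) {x₁ : LeviCivita} (hx₁ : |x₁ - x₀| ≤ |H|)
    {E : Set LeviCivita} (hE : E ⊆ D) (hle : ∀ x ∈ E, |x₁ - x₀| + |x - x₁| ≤ |H|) :
    ∃ b : ℕ → LeviCivita, ∀ x ∈ E, HasWSum (fun k => b k * (x - x₁) ^ k) (f x) := by
  have hH := h.ne_zero
  set z₁ := (x₁ - x₀) / H with hz₁
  obtain ⟨Z₁, hZ₁, hzZ₁⟩ := exists_nearOne_of_abs_le (abs_div_le_one hH hx₁)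
  have hβ : ∀ k : ℕ, ∃ β, HasWSum (fun n => v n * (n.choose k * z₁ ^ (n - k))) β := by
    intro k
    obtain ⟨B, hB⟩ :=
      (h.rapid.absC.mul_polyGrowth (hZ₁.polyGrowth.mul_natCast_pow k)).exists_hasWSum
    obtain ⟨β, hβ, -⟩ := hB.of_dom fun n => (dom_absC (v n)).mul
      (((hzZ₁.pow (n - k)).trans (hZ₁.dom_pow_pow (n.sub_le k))).natCast_mul
        ((Nat.choose_le_pow n k).trans (Nat.pow_le_pow_left n.le_succ k)))
    exact ⟨β, hβ⟩
  choose β hβ using hβ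
  refine ⟨fun k => β k / H ^ k, fun x hx => ?_⟩
  set y := (x - x₁) / H with hy
  have hzy : z₁ + y = (x - x₀) / H := by rw [hz₁, hy]; ring
  have habs : |z₁| + |y| ≤ 1 := by
    rw [hz₁, hy, abs_div, abs_div, ← add_div, div_le_one (abs_pos.2 hH)]
    exact hle x hx
  -- The double binomial series is majorized by the one with coefficientwise absolute values. The
  -- sum `b₀` can be dominated by some `1 + θ` because its coefficient at `0` is at most `1`, as the
  -- bounds for `z₁ + y` and `z₁ - y` show together.
  set b₀ := absC z₁ + absC y with hb₀
  have hb₀c : ∀ q, coeff b₀ q = |coeff z₁ q| + |coeff y q| := fun q => rfl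
  have hb₀n : ∀ q, 0 ≤ coeff b₀ q := fun q => by rw [hb₀c]; positivity
  have hz1 : |z₁| ≤ ofReal 1 := by rw [ofReal_one]; linarith [abs_nonneg y]
  have hy1 : |y| ≤ ofReal 1 := by rw [ofReal_one]; linarith [abs_nonneg z₁]
  obtain ⟨Z, hZ, hbZ⟩ : ∃ Z, NearOne Z ∧ Dom b₀ Z := by
    refine exists_nearOne ((suppGE_of_abs_le_ofReal hz1).absC.add
      (suppGE_of_abs_le_ofReal hy1).absC) hb₀n ?_
    have h1 : |coeff (z₁ + y) 0| ≤ 1 :=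
      abs_coeff_le_of_abs_le ((abs_add_le _ _).trans (habs.trans_eq ofReal_one.symm))
    have h2 : |coeff (z₁ - y) 0| ≤ 1 :=
      abs_coeff_le_of_abs_le ((abs_sub _ _).trans (habs.trans_eq ofReal_one.symm))
    rw [coeff_add] at h1
    rw [coeff_sub] at h2
    rw [hb₀c]
    rw [abs_le] at h1 h2
    rcases abs_cases (coeff z₁ 0) with h3 | h3 <;> rcases abs_cases (coeff y 0) with h4 | h4 <;>
      linarith [h1.1, h1.2, h2.1, h2.2]
  have hdom : ∀ p : ℕ × ℕ, Dom (v p.1 * (p.1.choose p.2 * (z₁ ^ (p.1 - p.2) * y ^ p.2)))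
      (absC (v p.1) * (p.1.choose p.2 * (absC z₁ ^ (p.1 - p.2) * absC y ^ p.2))) :=
    fun p => (dom_absC _).mul ((((dom_absC z₁).pow _).mul ((dom_absC y).pow _)).natCast_mul le_rfl)
  obtain ⟨B, hB⟩ := h.rapid.absC.exists_hasWSum_double
    (fun n k => (hdom (n, k)).refl_right) hZ hbZ
  obtain ⟨s, hs, -⟩ := hB.of_dom hdom
  have hs1 : HasWSum (fun n => v n * (z₁ + y) ^ n) s :=
    hs.prod_fiberwise fun n => hasWSum_binomial (v n) z₁ y n
  rw [hzy] at hs1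
  -- The same double sum, added up in the other order.
  have hs2 : HasWSum (fun k => y ^ k * β k) s := by
    refine hs.swap.prod_fiberwise fun k => ?_
    refine cast (congrArg (fun w => HasWSum w _) (funext fun n => ?_)) ((hβ k).mul_left (y ^ k))
    simp only [Prod.swap_prod_mk]
    ring
  rw [hs1.unique (h.hasWSum x (hE hx))] at hs2
  refine cast (congrArg (fun w => HasWSum w _) (funext fun k => ?_)) hs2
  rw [hy, div_pow]; ring

/-! ### Operations on simple functions -/

theorem isSimpleOn_of_left_eq_right (f : LeviCivita → LeviCivita) {I : Interval}
    (h : I.left = I.right) : IsSimpleOn f I := by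
  refine ⟨I.left, ⟨le_rfl, h.le⟩, fun n => if n = 0 then f I.left else 0, fun x hx => ?_⟩
  have hx' := I.subset_Icc hx
  rw [← h, Set.Icc_self, Set.mem_singleton_iff] at hx'
  have h1 := (hasWSum_of_finite (w := fun n => (if n = 0 then f I.left else 0) *
    (x - I.left) ^ n) (N := 1) (fun n hn => by rw [if_neg (by omega), zero_mul])).weakTendsto
  simpa [hx'] using h1

theorem isSimpleOn_const (c : LeviCivita) (I : Interval) : IsSimpleOn (fun _ => c) I := by
  refine ⟨I.left, ⟨le_rfl, I.left_le_right⟩, fun n => if n = 0 then c else 0, fun x hx => ?_⟩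
  have h1 := (hasWSum_of_finite (w := fun n => (if n = 0 then c else 0) *
    (x - I.left) ^ n) (N := 1) (fun n hn => by rw [if_neg (by omega), zero_mul])).weakTendsto
  simpa using h1

theorem IsSimpleOn.congr {f g : LeviCivita → LeviCivita} {I : Interval} (h : IsSimpleOn f I)
    (hfg : ∀ x ∈ I.carrier, f x = g x) : IsSimpleOn g I := by
  obtain ⟨x₀, hx₀, a, ha⟩ := h
  exact ⟨x₀, hx₀, a, fun x hx => hfg x hx ▸ ha x hx⟩

theorem Interval.Icc_subset_Icc {I J : Interval} (hJI : J.carrier ⊆ I.carrier)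
    (hJ : J.left < J.right) : I.left ≤ J.left ∧ J.right ≤ I.right := by
  constructor
  · by_contra! h
    obtain ⟨x, h1, h2⟩ := exists_between (lt_min h hJ)
    have := (I.subset_Icc (hJI (J.Ioo_subset ⟨h1, h2.trans_le (min_le_right _ _)⟩))).1
    exact absurd (h2.trans_le (min_le_left _ _)) (not_lt.2 this)
  · by_contra! h
    obtain ⟨x, h1, h2⟩ := exists_between (max_lt h hJ)
    have := (I.subset_Icc (hJI (J.Ioo_subset ⟨(le_max_right _ _).trans_lt h1, h2⟩))).2
    exact absurd ((le_max_left _ _).trans_lt h1) (not_lt.2 this)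

/-- On a subinterval, a simple function has an expansion about the midpoint. -/
theorem IsSimpleOn.exists_midpoint {f : LeviCivita → LeviCivita} {I J : Interval}
    (h : IsSimpleOn f I) (hJI : J.carrier ⊆ I.carrier) (hJ : J.left < J.right) :
    ∃ b : ℕ → LeviCivita, ∀ x ∈ J.carrier, WeakTendsto
      (fun N => ∑ n ∈ Finset.range N, b n * (x - (J.left + J.right) / 2) ^ n) (f x) := by
  obtain ⟨hl, hr⟩ := Interval.Icc_subset_Icc hJI hJ
  obtain ⟨x₀, hx₀, H, v, hdist, hrep⟩ := h.exists_rep (hl.trans_lt (hJ.trans_le hr))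
  have h1 := hdist J.left ⟨hl, hJ.le.trans hr⟩
  have h2 := hdist J.right ⟨hl.trans hJ.le, hr⟩
  have h3 := hdist ((J.left + J.right) / 2) ⟨by linarith, by linarith⟩
  -- The distance from `x₀` to the midpoint plus half the length of `J` is the larger of the
  -- distances from `x₀` to the endpoints of `J`.
  obtain ⟨b, hb⟩ := hrep.recenter (x₁ := (J.left + J.right) / 2) h3 hJI (fun x hx => by
    have hx' := J.subset_Icc hx
    have h4 : |x - (J.left + J.right) / 2| ≤ (J.right - J.left) / 2 :=
      abs_le.2 ⟨by linarith [hx'.1], by linarith [hx'.2]⟩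
    have h5 := neg_abs_le (J.left - x₀)
    have h6 := le_abs_self (J.right - x₀)
    rcases abs_cases ((J.left + J.right) / 2 - x₀) with h7 | h7 <;> linarith [h7.1])
  exact ⟨b, fun x hx => (hb x hx).weakTendsto⟩

theorem Interval.midpoint_mem (J : Interval) :
    (J.left + J.right) / 2 ∈ Set.Icc J.left J.right :=
  ⟨by linarith [J.left_le_right], by linarith [J.left_le_right]⟩

theorem IsSimpleOn.restrict {f : LeviCivita → LeviCivita} {I J : Interval}
    (h : IsSimpleOn f I) (hJI : J.carrier ⊆ I.carrier) : IsSimpleOn f J := by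
  rcases J.left_le_right.eq_or_lt with hJ | hJ
  · exact isSimpleOn_of_left_eq_right f hJ
  · obtain ⟨b, hb⟩ := h.exists_midpoint hJI hJ
    exact ⟨_, J.midpoint_mem, b, hb⟩

theorem IsSimpleOn.add {f g : LeviCivita → LeviCivita} {I : Interval}
    (hf : IsSimpleOn f I) (hg : IsSimpleOn g I) : IsSimpleOn (fun x => f x + g x) I := by
  rcases I.left_le_right.eq_or_lt with hI | hI
  · exact isSimpleOn_of_left_eq_right _ hI
  -- The two given expansions may have different centres; the midpoint is a centre for both.
  · obtain ⟨a, ha⟩ := hf.exists_midpoint subset_rfl hI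
    obtain ⟨b, hb⟩ := hg.exists_midpoint subset_rfl hI
    refine ⟨_, I.midpoint_mem, fun n => a n + b n, fun x hx => ?_⟩
    simpa only [add_mul, Finset.sum_add_distrib] using (ha x hx).add (hb x hx)

theorem IsSimpleOn.ofReal_mul {f : LeviCivita → LeviCivita} {I : Interval} {r : ℝ} (hr : |r| ≤ 1)
    (hf : IsSimpleOn f I) : IsSimpleOn (fun x => ofReal r * f x) I := by
  obtain ⟨x₀, hx₀, a, ha⟩ := hf
  refine ⟨x₀, hx₀, fun n => ofReal r * a n, fun x hx => ?_⟩
  simpa only [mul_assoc, Finset.mul_sum] using (ha x hx).ofReal_mul hr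

theorem IsSimpleOn.neg {f : LeviCivita → LeviCivita} {I : Interval}
    (hf : IsSimpleOn f I) : IsSimpleOn (fun x => -f x) I := by
  refine (hf.ofReal_mul (r := -1) (by simp)).congr fun x _ => ?_
  rw [ofReal_neg, ofReal_one, neg_one_mul]

theorem IsSimpleOn.sub {f g : LeviCivita → LeviCivita} {I : Interval}
    (hf : IsSimpleOn f I) (hg : IsSimpleOn g I) : IsSimpleOn (fun x => f x - g x) I :=
  (hf.add hg.neg).congr fun _ _ => (sub_eq_add_neg _ _).symm

/-! ### Derivatives of simple functions -/

theorem exists_nearOne_pair {z z' : LeviCivita} (hz : |z| ≤ 1) (hz' : |z'| ≤ 1) :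
    ∃ Z, NearOne Z ∧ Dom z Z ∧ Dom z' Z := by
  obtain ⟨_, ⟨θ, e, he, hθ, h0, rfl⟩, h⟩ := exists_nearOne_of_abs_le hz
  obtain ⟨_, ⟨θ', e', he', hθ', h0', rfl⟩, h'⟩ := exists_nearOne_of_abs_le hz'
  refine ⟨1 + (θ + θ'), ⟨θ + θ', min e e', lt_min he he', (hθ.mono (min_le_left _ _)).add
    (hθ'.mono (min_le_right _ _)), fun q => add_nonneg (h0 q) (h0' q), rfl⟩, fun q => ?_,
    fun q => ?_⟩
  · refine (h q).trans ?_
    simp only [coeff_add]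
    linarith [h0' q]
  · refine (h' q).trans ?_
    simp only [coeff_add]
    linarith [h0 q]

theorem Rapid.exists_hasWSum_deriv {v : ℕ → LeviCivita} (hv : Rapid v) {z : LeviCivita}
    (hz : |z| ≤ 1) : ∃ d, HasWSum (fun n => v n * (n * z ^ (n - 1))) d := by
  obtain ⟨Z, hZ, hzZ⟩ := exists_nearOne_of_abs_le hz
  obtain ⟨m, hm⟩ := hv.exists_suppGE
  obtain ⟨s, hs⟩ := hv.exists_hasWSum_pow hz
  obtain ⟨B, hB⟩ := hv.exists_taylor hZ hm
  obtain ⟨d, -, hd, -⟩ := hB z z s s hzZ hzZ hs hs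
  exact ⟨d, hd⟩

theorem Rep.exists_deriv {F : LeviCivita → LeviCivita} {D : Set LeviCivita}
    {x₀ H : LeviCivita} {v : ℕ → LeviCivita} (h : Rep F D x₀ H v) {x d : LeviCivita} (hx : x ∈ D)
    (hd : HasWSum (fun n => v n * (n * ((x - x₀) / H) ^ (n - 1))) d) {ε : LeviCivita}
    (hε : 0 < ε) : ∃ δ : LeviCivita, 0 < δ ∧
      ∀ y ∈ D, |y - x| < δ → |F y - F x - d / H * (y - x)| ≤ ε * |y - x| := by
  obtain ⟨m, hm⟩ := h.rapid.exists_suppGE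
  have hM : (0 : LeviCivita) < monomial (m - 1) 1 := monomial_pos _ one_pos
  have hH2 : 0 < H ^ 2 := by have := h.ne_zero; positivity
  -- The remainder is `K * (y - x) ^ 2 / H ^ 2` with `|K|` below this monomial for every `y`.
  refine ⟨ε * H ^ 2 / monomial (m - 1) 1, by positivity, fun y hy hyx => ?_⟩
  obtain ⟨Z, hZ, hz, hz'⟩ := exists_nearOne_pair (abs_div_le_one h.ne_zero (h.dist_le x hx))
    (abs_div_le_one h.ne_zero (h.dist_le y hy))
  obtain ⟨B, hB⟩ := h.rapid.exists_taylor hZ hm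
  obtain ⟨d', K, hd', -, -, -, hK, hF⟩ := hB _ _ _ _ hz hz' (h.hasWSum x hx) (h.hasWSum y hy)
  rw [hd'.unique hd] at hF
  have hdz : (y - x₀) / H - (x - x₀) / H = (y - x) / H := by ring
  have heq : F y - F x - d / H * (y - x) = K * ((y - x) ^ 2 / H ^ 2) := by
    rw [hF, hdz]; ring
  have hKM : |K| < monomial (m - 1) 1 := hK.abs_lt_monomial (by linarith) one_pos
  rw [lt_div_iff₀ hM] at hyx
  rw [heq, abs_mul, abs_of_nonneg (by positivity : 0 ≤ (y - x) ^ 2 / H ^ 2), ← sq_abs (y - x),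
    ← mul_div_assoc, div_le_iff₀ hH2]
  have h0 := abs_nonneg (y - x)
  calc |K| * |y - x| ^ 2 ≤ monomial (m - 1) 1 * |y - x| ^ 2 := by gcongr
    _ = |y - x| * monomial (m - 1) 1 * |y - x| := by ring
    _ ≤ ε * H ^ 2 * |y - x| := by gcongr
    _ = _ := by ring

theorem IsSimpleOn.exists_rep_closed {F : LeviCivita → LeviCivita} {I : Interval}
    (h : IsSimpleOn F I.closed) (hI : I.left < I.right) :
    ∃ x₀ ∈ Set.Icc I.left I.right, ∃ H v, Rep F (Set.Icc I.left I.right) x₀ H v := by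
  obtain ⟨x₀, hx₀, H, v, -, hrep⟩ := h.exists_rep hI
  exact ⟨x₀, hx₀, H, v, hrep⟩

theorem IsSimpleOn.tendsto {F : LeviCivita → LeviCivita} {I : Interval}
    (h : IsSimpleOn F I.closed) {x : LeviCivita} (hx : x ∈ Set.Icc I.left I.right) :
    Tendsto F (𝓝[Set.Icc I.left I.right] x) (𝓝 (F x)) := by
  rcases I.left_le_right.eq_or_lt with hI | hI
  · rw [← hI, Set.Icc_self] at hx ⊢
    rw [Set.mem_singleton_iff] at hx
    rw [hx, nhdsWithin_singleton]
    exact tendsto_pure_nhds F _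
  obtain ⟨x₀, hx₀, H, v, hrep⟩ := h.exists_rep_closed hI
  obtain ⟨d, hd⟩ := hrep.rapid.exists_hasWSum_deriv
    (abs_div_le_one hrep.ne_zero (hrep.dist_le x hx))
  obtain ⟨δ, hδ, hδF⟩ := hrep.exists_deriv hx hd one_pos
  rw [LinearOrderedAddCommGroup.tendsto_nhds]
  intro ε hε
  have hc : 0 < 1 + |d / H| := by positivity
  have h1 := eventually_abs_sub_lt x (lt_min hδ (div_pos hε hc))
  filter_upwards [mem_nhdsWithin_of_mem_nhds h1, self_mem_nhdsWithin] with y hy hyI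
  have hy' : |y - x| < min δ (ε / (1 + |d / H|)) := hy
  have h2 := hδF y hyI (hy'.trans_le (min_le_left _ _))
  have h3 := hy'.trans_le (min_le_right _ _)
  rw [lt_div_iff₀ hc] at h3
  have h4 := abs_add_le (F y - F x - d / H * (y - x)) (d / H * (y - x))
  rw [sub_add_cancel, abs_mul] at h4
  linarith

theorem eq_of_deriv {F : LeviCivita → LeviCivita} {a b x c c' : LeviCivita}
    (hx : x ∈ Set.Ioo a b)
    (h : ∀ ε : LeviCivita, 0 < ε → ∃ δ : LeviCivita, 0 < δ ∧ ∀ y ∈ Set.Ioo a b,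
      |y - x| < δ → |F y - F x - c * (y - x)| ≤ ε * |y - x|)
    (h' : ∀ ε : LeviCivita, 0 < ε → ∃ δ : LeviCivita, 0 < δ ∧ ∀ y ∈ Set.Ioo a b,
      |y - x| < δ → |F y - F x - c' * (y - x)| ≤ ε * |y - x|) : c = c' := by
  by_contra hne
  have hpos : 0 < |c - c'| := abs_pos.2 (sub_ne_zero.2 hne)
  obtain ⟨δ, hδ, h1⟩ := h (|c - c'| / 4) (by positivity)
  obtain ⟨δ', hδ', h2⟩ := h' (|c - c'| / 4) (by positivity)
  obtain ⟨y, hy1, hy2⟩ := exists_between (lt_min hx.2 (lt_min (lt_add_of_pos_right x hδ)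
    (lt_add_of_pos_right x hδ')))
  rw [lt_min_iff, lt_min_iff] at hy2
  have hyx : 0 < y - x := sub_pos.2 hy1
  have hyI : y ∈ Set.Ioo a b := ⟨hx.1.trans hy1, hy2.1⟩
  have e1 := h1 y hyI (by rw [abs_of_pos hyx]; linarith [hy2.2.1])
  have e2 := h2 y hyI (by rw [abs_of_pos hyx]; linarith [hy2.2.2])
  have e3 : |(c - c') * (y - x)| ≤ |F y - F x - c' * (y - x)| + |F y - F x - c * (y - x)| := by
    rw [show (c - c') * (y - x) =
      (F y - F x - c' * (y - x)) - (F y - F x - c * (y - x)) by ring]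
    exact abs_sub _ _
  rw [abs_mul, abs_of_pos hyx] at e3
  rw [abs_of_pos hyx] at e1 e2
  nlinarith [mul_pos hpos hyx]

/-! ### Monotonicity from the sign of the derivative. -/

/-- The quadratic error makes `D` the derivative of `φ`, so `φ` is monotone, and equal end values
force it to be constant. The second conclusion detects strict increase of a coefficient. -/
theorem le_of_quadratic_approx {φ D : ℝ → ℝ} {C : ℝ}
    (h : ∀ t ∈ Set.Icc (0 : ℝ) 1, ∀ t' ∈ Set.Icc (0 : ℝ) 1,
      |φ t' - φ t - D t * (t' - t)| ≤ C * (t' - t) ^ 2)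
    (h0 : ∀ t ∈ Set.Ioo (0 : ℝ) 1, 0 ≤ D t) :
    φ 0 ≤ φ 1 ∧ (φ 0 = φ 1 → ∀ t ∈ Set.Ioo (0 : ℝ) 1, D t = 0) := by
  have hd : ∀ t ∈ Set.Icc (0 : ℝ) 1, HasDerivWithinAt φ (D t) (Set.Icc 0 1) t := by
    intro t ht
    rw [hasDerivWithinAt_iff_isLittleO]
    have h1 : (fun t' => φ t' - φ t - (t' - t) • D t) =O[𝓝[Set.Icc (0 : ℝ) 1] t]
        fun t' => (t' - t) ^ 2 := by
      refine Asymptotics.IsBigO.of_bound C ?_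
      filter_upwards [self_mem_nhdsWithin] with t' ht'
      rw [smul_eq_mul, mul_comm, Real.norm_eq_abs, norm_pow, Real.norm_eq_abs, sq_abs]
      exact h t ht t' ht'
    refine h1.trans_isLittleO ?_
    have h2 : (fun x : ℝ => x ^ 2) =o[𝓝 0] fun x => x := by
      simpa using Asymptotics.isLittleO_pow_id (𝕜 := ℝ) (n := 2) (by norm_num)
    refine h2.comp_tendsto (k := fun t' => t' - t) ?_
    rw [tendsto_sub_nhds_zero_iff]
    exact tendsto_nhdsWithin_of_tendsto_nhds tendsto_id
  have hda : ∀ t ∈ Set.Ioo (0 : ℝ) 1, HasDerivAt φ (D t) t := fun t ht =>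
    (hd t ⟨ht.1.le, ht.2.le⟩).hasDerivAt (Icc_mem_nhds ht.1 ht.2)
  have hmono : MonotoneOn φ (Set.Icc 0 1) := by
    refine monotoneOn_of_deriv_nonneg (convex_Icc 0 1)
      (fun t ht => (hd t ht).continuousWithinAt) ?_ ?_
    · rw [interior_Icc]
      exact fun t ht => (hda t ht).differentiableAt.differentiableWithinAt
    · rw [interior_Icc]
      exact fun t ht => (hda t ht).deriv ▸ h0 t ht
  refine ⟨hmono (by simp) (by simp) zero_le_one, fun heq t ht => ?_⟩
  have hconst : φ =ᶠ[𝓝 t] fun _ => φ 0 := by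
    filter_upwards [Ioo_mem_nhds ht.1 ht.2] with s hs
    have hs' : s ∈ Set.Icc (0 : ℝ) 1 := ⟨hs.1.le, hs.2.le⟩
    refine le_antisymm ?_ (hmono (by simp) hs' hs.1.le)
    rw [heq]
    exact hmono hs' (by simp) hs.2.le
  exact (hda t ht).unique ((hasDerivAt_const t (φ 0)).congr_of_eventuallyEq hconst)

/-- Uniform expansions of a simple function along the real parametrization of an interval. -/
theorem Rep.exists_quadratic_approx {F : LeviCivita → LeviCivita} {a b x₀ H : LeviCivita}
    {v : ℕ → LeviCivita} (hab : a ≤ b) (h : Rep F (Set.Icc a b) x₀ H v) :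
    ∃ (e : ℝ → LeviCivita) (B : LeviCivita), ∀ t ∈ Set.Icc (0 : ℝ) 1,
      (∃ d, HasWSum (fun n => v n * (n * ((a + (b - a) * ofReal t - x₀) / H) ^ (n - 1))) d ∧
        e t = (b - a) * (d / H)) ∧ Dom (e t) B ∧ ∀ t' ∈ Set.Icc (0 : ℝ) 1, ∀ q,
        |coeff (F (a + (b - a) * ofReal t')) q - coeff (F (a + (b - a) * ofReal t)) q
          - coeff (e t) q * (t' - t)| ≤ coeff B q * (t' - t) ^ 2 := by
  have hmem : ∀ t ∈ Set.Icc (0 : ℝ) 1, a + (b - a) * ofReal t ∈ Set.Icc a b := by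
    intro t ht
    have h0 : 0 ≤ ofReal t := ofReal_zero ▸ ofReal_le ht.1
    have h1 : ofReal t ≤ 1 := ofReal_one ▸ ofReal_le ht.2
    constructor <;> nlinarith
  set α := (a - x₀) / H
  set β := (b - a) / H with hβ
  have hz : ∀ t, (a + (b - a) * ofReal t - x₀) / H = α + β * ofReal t := fun t => by ring
  have hle : ∀ t ∈ Set.Icc (0 : ℝ) 1, |α + β * ofReal t| ≤ 1 := fun t ht => by
    rw [← hz]; exact abs_div_le_one h.ne_zero (h.dist_le _ (hmem t ht))
  have hα : SuppGE 0 α := by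
    have := hle 0 ⟨le_rfl, zero_le_one⟩
    rw [ofReal_zero, mul_zero, add_zero, ← ofReal_one] at this
    exact suppGE_of_abs_le_ofReal this
  have hβ0 : SuppGE 0 β := by
    have := hle 1 ⟨zero_le_one, le_rfl⟩
    rw [ofReal_one, mul_one, ← ofReal_one] at this
    simpa using (suppGE_of_abs_le_ofReal this).sub hα
  have hcoeff : ∀ t q, coeff (α + β * ofReal t) q = coeff α q + t * coeff β q := fun t q => by
    rw [coeff_add, mul_comm, coeff_ofReal_mul]
  obtain ⟨Z, hZ, hZd⟩ : ∃ Z, NearOne Z ∧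
      ∀ t ∈ Set.Icc (0 : ℝ) 1, Dom (α + β * ofReal t) Z := by
    -- One majorant for all `t`: at exponent `0` the value `1` comes from `|α + β t| ≤ 1`, and
    -- elsewhere the triangle inequality is enough.
    have hlf : LeftFinite (Function.support fun q => if q = 0 then (1 : ℝ) else
        |coeff α q| + |coeff β q|) := by
      refine (((leftFinite_supp α).union (leftFinite_supp β)).union
        (leftFinite_of_finite (Set.finite_singleton (0 : ℚ)))).mono fun q hq => ?_
      by_contra hn
      simp only [Set.mem_union, not_or, Set.mem_ofPred_eq, not_not, Set.mem_singleton_iff] at hn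
      apply hq
      simp [hn.2, hn.1.1, hn.1.2]
    obtain ⟨Z, hZ, hd⟩ := exists_nearOne (b := ofFun _ hlf)
      (fun q hq => by rw [coeff_ofFun, if_neg hq.ne, hα q hq, hβ0 q hq]; simp)
      (fun q => by rw [coeff_ofFun]; split_ifs <;> positivity)
      (by rw [coeff_ofFun, if_pos rfl])
    refine ⟨Z, hZ, fun t ht => Dom.trans (fun q => ?_) hd⟩
    rw [coeff_ofFun]
    split_ifs with hq
    · subst hq
      exact abs_coeff_le_of_abs_le ((hle t ht).trans_eq ofReal_one.symm)
    · rw [hcoeff]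
      refine (abs_add_le _ _).trans (add_le_add le_rfl ?_)
      rw [abs_mul, abs_of_nonneg ht.1]
      exact mul_le_of_le_one_left (abs_nonneg _) ht.2
  obtain ⟨m, hm⟩ := h.rapid.exists_suppGE
  obtain ⟨B, hB⟩ := h.rapid.exists_taylor hZ hm
  have hd : ∀ t, ∃ d, t ∈ Set.Icc (0 : ℝ) 1 →
      HasWSum (fun n => v n * (n * (α + β * ofReal t) ^ (n - 1))) d := by
    intro t
    by_cases ht : t ∈ Set.Icc (0 : ℝ) 1
    · obtain ⟨d, hd⟩ := h.rapid.exists_hasWSum_deriv (hle t ht)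
      exact ⟨d, fun _ => hd⟩
    · exact ⟨0, fun h => absurd h ht⟩
  choose d hd using hd
  have hF : ∀ t ∈ Set.Icc (0 : ℝ) 1, HasWSum (fun n => v n * (α + β * ofReal t) ^ n)
      (F (a + (b - a) * ofReal t)) := fun t ht => hz t ▸ h.hasWSum _ (hmem t ht)
  have hB' := fun t (ht : t ∈ Set.Icc (0 : ℝ) 1) t' (ht' : t' ∈ Set.Icc (0 : ℝ) 1) =>
    hB _ _ _ _ (hZd t ht) (hZd t' ht') (hF t ht) (hF t' ht')
  have hb1 := (dom_absC β).refl_right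
  -- The first summand of the bound controls the derivative `β * d t`, the second the remainder `β ^
  -- 2 * K`.
  refine ⟨fun t => β * d t, absC β * B + absC β ^ 2 * B, fun t ht => ?_⟩
  obtain ⟨d₀, K₀, hd₀, hdB, hKB, -⟩ := hB' t ht t ht
  have e1 : d₀ = d t := hd₀.unique (hd t ht)
  subst e1
  have hp1 : ∀ q, 0 ≤ coeff (absC β * B) q := fun q => ((dom_absC β).mul hdB).nonneg q
  have hp2 : ∀ q, 0 ≤ coeff (absC β ^ 2 * B) q := fun q =>
    (((dom_absC β).pow 2).mul hKB).nonneg q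
  refine ⟨⟨d t, hz t ▸ hd t ht, by rw [hβ]; ring⟩, fun q => ?_, fun t' ht' q => ?_⟩
  · refine (((dom_absC β).mul hdB) q).trans ?_
    rw [coeff_add]
    linarith [hp2 q]
  · obtain ⟨d₁, K, hd₁, -, hK, -, -, hT⟩ := hB' t ht t' ht'
    rw [hd₁.unique (hd t ht)] at hT
    have h1 : F (a + (b - a) * ofReal t') = F (a + (b - a) * ofReal t) +
        ofReal (t' - t) * (β * d t) + ofReal ((t' - t) ^ 2) * (β ^ 2 * K) := by
      rw [hT, ofReal_pow, ofReal_sub]; ring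
    rw [h1, coeff_add, coeff_add, coeff_ofReal_mul, coeff_ofReal_mul]
    have h2 := (((dom_absC β).pow 2).mul hK) q
    have h3 : coeff (F (a + (b - a) * ofReal t)) q + (t' - t) * coeff (β * d t) q +
        (t' - t) ^ 2 * coeff (β ^ 2 * K) q - coeff (F (a + (b - a) * ofReal t)) q -
        coeff (β * d t) q * (t' - t) = (t' - t) ^ 2 * coeff (β ^ 2 * K) q := by ring
    rw [h3, abs_mul, abs_of_nonneg (sq_nonneg _), mul_comm, coeff_add]
    refine mul_le_mul_of_nonneg_right ?_ (sq_nonneg _)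
    linarith [hp1 q]

/-- A simple function with nonnegative derivative increases from one endpoint to the other. -/
theorem le_of_isDerivOn_nonneg {G g : LeviCivita → LeviCivita} {I : Interval}
    (hG : IsSimpleOn G I.closed) (hd : IsDerivOn G g I) (h0 : ∀ x ∈ I.carrier, 0 ≤ g x) :
    G I.left ≤ G I.right := by
  rcases I.left_le_right.eq_or_lt with hI | hI
  · rw [hI]
  obtain ⟨x₀, hx₀, H, v, hrep⟩ := hG.exists_rep_closed hI
  obtain ⟨e, B, hB⟩ := hrep.exists_quadratic_approx hI.le
  set a := I.left
  set b := I.right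
  have hpos : 0 < b - a := sub_pos.2 hI
  have hmem : ∀ t ∈ Set.Ioo (0 : ℝ) 1, a + (b - a) * ofReal t ∈ Set.Ioo a b := by
    intro t ht
    have h0 : 0 < ofReal t := ofReal_zero ▸ ofReal_lt ht.1
    have h1 : ofReal t < 1 := ofReal_one ▸ ofReal_lt ht.2
    constructor <;> nlinarith
  have hIcc : ∀ t ∈ Set.Ioo (0 : ℝ) 1, t ∈ Set.Icc (0 : ℝ) 1 := fun t ht => ⟨ht.1.le, ht.2.le⟩
  have he : ∀ t ∈ Set.Ioo (0 : ℝ) 1, 0 ≤ e t := by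
    intro t ht
    obtain ⟨⟨d, hdw, het⟩, -, -⟩ := hB t (hIcc t ht)
    have hx := hmem t ht
    have hxI : a + (b - a) * ofReal t ∈ I.carrier := I.Ioo_subset hx
    -- The termwise derivative of the series agrees with `g` because derivatives are unique.
    have hdg : d / H = g (a + (b - a) * ofReal t) := by
      refine eq_of_deriv (F := G) hx (fun ε hε => ?_) fun ε hε => ?_
      · obtain ⟨δ, hδ, h⟩ := hrep.exists_deriv ⟨hx.1.le, hx.2.le⟩ hdw hε
        exact ⟨δ, hδ, fun y hy => h y ⟨hy.1.le, hy.2.le⟩⟩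
      · obtain ⟨δ, hδ, h⟩ := hd _ hxI ε hε
        exact ⟨δ, hδ, fun y hy => h y (I.Ioo_subset hy)⟩
    rw [het, hdg]
    exact mul_nonneg hpos.le (h0 _ hxI)
  have ha0 : a + (b - a) * ofReal 0 = a := by rw [ofReal_zero, mul_zero, add_zero]
  have hb1 : a + (b - a) * ofReal 1 = b := by rw [ofReal_one]; ring
  have key : ∀ q, (∀ t ∈ Set.Ioo (0 : ℝ) 1, 0 ≤ coeff (e t) q) →
      coeff (G a) q ≤ coeff (G b) q ∧
        (coeff (G a) q = coeff (G b) q → ∀ t ∈ Set.Ioo (0 : ℝ) 1, coeff (e t) q = 0) := by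
    intro q hq
    have := le_of_quadratic_approx (φ := fun t => coeff (G (a + (b - a) * ofReal t)) q)
      (D := fun t => coeff (e t) q) (C := coeff B q)
      (fun t ht t' ht' => (hB t ht).2.2 t' ht' q) hq
    simpa only [ha0, hb1] using this
  have key0 : ∀ q, (∀ t ∈ Set.Ioo (0 : ℝ) 1, coeff (e t) q = 0) →
      coeff (G a) q = coeff (G b) q := by
    intro q hq
    refine le_antisymm (key q fun t ht => (hq t ht).ge).1 ?_
    have := le_of_quadratic_approx (φ := fun t => -coeff (G (a + (b - a) * ofReal t)) q)
      (D := fun t => -coeff (e t) q) (C := coeff B q)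
      (fun t ht t' ht' => by
        have := (hB t ht).2.2 t' ht' q
        rw [← abs_neg] at this
        refine (le_of_eq ?_).trans this
        congr 1; ring) (fun t ht => by rw [hq t ht, neg_zero])
    have h1 := this.1
    simp only [ha0, hb1] at h1
    linarith
  -- Below the least of these exponents the end values of `G` agree. At that exponent the derivative
  -- is nonnegative, being there the first possible coefficient of `e t ≥ 0`, and somewhere nonzero,
  -- so the coefficient of `G` strictly increases.
  set Bad := {q | ∃ t ∈ Set.Ioo (0 : ℝ) 1, coeff (e t) q ≠ 0} with hBad
  have hlf : LeftFinite Bad := by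
    refine (leftFinite_supp B).mono ?_
    rintro q ⟨t, ht, hq⟩
    exact ((hB t (hIcc t ht)).2.1).hasSupp (S := {q | coeff B q ≠ 0}) (fun _ h => h) q hq
  rcases Bad.eq_empty_or_nonempty with hemp | hne
  · refine le_of_eq (coeff_ext fun q => key0 q fun t ht => ?_)
    by_contra hq
    have : q ∈ Bad := ⟨t, ht, hq⟩
    rw [hemp] at this
    exact this
  · have hwf := Set.isPWO_iff_isWF.1 hlf.isPWO
    set q₀ := hwf.min hne
    have hlow : ∀ q < q₀, ∀ t ∈ Set.Ioo (0 : ℝ) 1, coeff (e t) q = 0 := by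
      intro q hq t ht
      by_contra hne'
      exact hwf.not_lt_min hne (⟨t, ht, hne'⟩ : q ∈ Bad) hq
    obtain ⟨t, ht, hqt⟩ := hwf.min_mem hne
    have h1 := key q₀ fun t ht => coeff_nonneg_of_nonneg (he t ht) fun q hq => hlow q hq t ht
    refine (lt_iff_coeff.2 ⟨q₀, fun q hq => key0 q (hlow q hq), ?_⟩).le
    exact lt_of_le_of_ne h1.1 fun h => hqt (h1.2 h t ht)

/-! ### Antiderivatives -/

theorem IsDerivOn.sub {F G f g : LeviCivita → LeviCivita} {I : Interval} (hF : IsDerivOn F f I)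
    (hG : IsDerivOn G g I) : IsDerivOn (fun x => F x - G x) (fun x => f x - g x) I := by
  intro x hx ε hε
  obtain ⟨δ, hδ, h⟩ := hF x hx (ε / 2) (half_pos hε)
  obtain ⟨δ', hδ', h'⟩ := hG x hx (ε / 2) (half_pos hε)
  refine ⟨min δ δ', lt_min hδ hδ', fun y hy hyx => ?_⟩
  have h1 := h y hy (hyx.trans_le (min_le_left _ _))
  have h2 := h' y hy (hyx.trans_le (min_le_right _ _))
  have h3 := abs_sub (F y - F x - f x * (y - x)) (G y - G x - g x * (y - x))
  rw [show F y - G y - (F x - G x) - (f x - g x) * (y - x) =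
    (F y - F x - f x * (y - x)) - (G y - G x - g x * (y - x)) by ring]
  linarith

/-- `F` is an antiderivative of `f` on `I`, simple on the closed interval. -/
structure Prim (F f : LeviCivita → LeviCivita) (I : Interval) : Prop where
  simple : IsSimpleOn F I.closed
  deriv : IsDerivOn F f I

namespace Prim

variable {F G f g : LeviCivita → LeviCivita} {I J : Interval}

theorem sub (hF : Prim F f I) (hG : Prim G g I) :
    Prim (fun x => F x - G x) (fun x => f x - g x) I :=
  ⟨hF.simple.sub hG.simple, hF.deriv.sub hG.deriv⟩

theorem of_left_eq_right (F f : LeviCivita → LeviCivita) (h : I.left = I.right) : Prim F f I := by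
  refine ⟨isSimpleOn_of_left_eq_right F h, fun x hx ε _ => ⟨1, one_pos, fun y hy _ => ?_⟩⟩
  have hx' := I.subset_Icc hx
  have hy' := I.subset_Icc hy
  rw [← h, Set.Icc_self, Set.mem_singleton_iff] at hx' hy'
  simp [hx', hy']

theorem restrict (hF : Prim F f I) (hJI : J.carrier ⊆ I.carrier) : Prim F f J := by
  rcases J.left_le_right.eq_or_lt with hJ | hJ
  · exact of_left_eq_right F f hJ
  obtain ⟨hl, hr⟩ := Interval.Icc_subset_Icc hJI hJ
  refine ⟨hF.simple.restrict (Set.Icc_subset_Icc hl hr), fun x hx ε hε => ?_⟩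
  obtain ⟨δ, hδ, h⟩ := hF.deriv x (hJI hx) ε hε
  exact ⟨δ, hδ, fun y hy => h y (hJI hy)⟩

theorem linear (B : LeviCivita) (I : Interval) : Prim (fun x => B * x) (fun _ => B) I := by
  refine ⟨⟨I.left, ⟨le_rfl, I.left_le_right⟩,
    fun n => if n = 0 then B * I.left else if n = 1 then B else 0, fun x hx => ?_⟩,
    fun x hx ε hε => ⟨1, one_pos, fun y hy _ => ?_⟩⟩
  · have h1 := (hasWSum_of_finite (w := fun n => (if n = 0 then B * I.left else
      if n = 1 then B else 0) * (x - I.left) ^ n) (N := 2)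
      (fun n hn => by rw [if_neg (by omega), if_neg (by omega), zero_mul])).weakTendsto
    have h2 : B * I.left + B * (x - I.left) = B * x := by ring
    simpa [Finset.sum_range_succ, h2] using h1
  · rw [← mul_sub, sub_self, abs_zero]
    positivity

/-- The difference of the antiderivatives has a nonnegative derivative. Used in both directions with
`f = g`, this shows that the increment does not depend on the antiderivative. -/
theorem le (hF : Prim F f I) (hG : Prim G g I) (h : ∀ x ∈ I.carrier, f x ≤ g x) :
    F I.right - F I.left ≤ G I.right - G I.left := by
  have := le_of_isDerivOn_nonneg (hG.sub hF).simple (hG.sub hF).deriv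
    fun x hx => sub_nonneg.2 (h x hx)
  linarith

end Prim

theorem HasWSum.nat_succ {w : ℕ → LeviCivita} {s : LeviCivita} (h : HasWSum w s) (h0 : w 0 = 0) :
    HasWSum (fun n => w (n + 1)) s := by
  obtain ⟨S, hS, hw⟩ := h.supp
  refine ⟨⟨S, hS, fun n => hw (n + 1)⟩, fun q => ?_⟩
  have := (hasSum_nat_add_iff' 1).2 (h.hasSum q)
  simpa [h0, coeff_zero] using this

/-- Division by `n` only makes coefficients smaller. At `n = 0` the convention `0⁻¹ = 0` gives the
constant term `0`. -/
theorem Rapid.antideriv {v : ℕ → LeviCivita} (hv : Rapid v) (H : LeviCivita) :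
    Rapid fun n => ofReal (n : ℝ)⁻¹ * (H * v (n - 1)) := by
  have h1 : Rapid fun n => v n * H := hv.mul_polyGrowth
    ⟨⟨_, leftFinite_supp H, fun _ _ h => h⟩, fun q => ⟨|coeff H q|, 0, fun n => by simp⟩⟩
  obtain ⟨S, hS, hvS⟩ := h1.supp
  have hle : ∀ (n : ℕ) (q : ℚ), |coeff (ofReal (n : ℝ)⁻¹ * (H * v (n - 1))) q| ≤
      |coeff (v (n - 1) * H) q| := by
    intro n q
    rw [coeff_ofReal_mul, mul_comm H, abs_mul]
    refine mul_le_of_le_one_left (abs_nonneg _) ?_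
    rw [abs_of_nonneg (by positivity)]
    exact Nat.cast_inv_le_one n
  refine ⟨⟨S, hS, fun n q hq => hvS (n - 1) q fun h0 => hq ?_⟩, fun q k => ?_⟩
  · have := hle n q
    rw [h0, abs_zero] at this
    exact abs_nonpos_iff.1 this
  -- The shift of the index costs a factor `2 ^ k`, since `n + 2 ≤ 2 * (n + 1)`.
  · rw [← summable_nat_add_iff 1]
    refine Summable.of_nonneg_of_le (fun n => by positivity) (fun n => ?_)
      ((h1.summable q k).mul_left (2 ^ k))
    rw [← mul_assoc (2 ^ k : ℝ), ← _root_.mul_pow]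
    refine mul_le_mul ?_ (hle (n + 1) q) (abs_nonneg _) (by positivity)
    gcongr
    push_cast
    linarith [n.cast_nonneg (α := ℝ)]

/-- The series is integrated term by term. Rapid decay survives, so the antiderivative is defined on
the closed interval even if `f` is simple only on the open one. -/
theorem IsSimpleOn.exists_prim {f : LeviCivita → LeviCivita} {I : Interval}
    (h : IsSimpleOn f I) : ∃ F, Prim F f I := by
  rcases I.left_le_right.eq_or_lt with hI | hI
  · exact ⟨0, Prim.of_left_eq_right _ _ hI⟩
  obtain ⟨x₀, hx₀, H, v, hdist, hrep⟩ := h.exists_rep hI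
  have hV := hrep.rapid.antideriv H
  set V : ℕ → LeviCivita := fun n => ofReal (n : ℝ)⁻¹ * (H * v (n - 1)) with hVdef
  have hs : ∀ x, ∃ s, x ∈ Set.Icc I.left I.right →
      HasWSum (fun n => V n * ((x - x₀) / H) ^ n) s := by
    intro x
    by_cases hx : x ∈ Set.Icc I.left I.right
    · obtain ⟨s, hs⟩ := hV.exists_hasWSum_pow (abs_div_le_one hrep.ne_zero (hdist x hx))
      exact ⟨s, fun _ => hs⟩
    · exact ⟨0, fun h => absurd h hx⟩
  choose F hF using hs
  have hFrep : Rep F (Set.Icc I.left I.right) x₀ H V := ⟨hrep.ne_zero, hV, hdist, hF⟩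
  refine ⟨F, Rep.isSimpleOn (I := I.closed) hFrep hx₀, fun x hx ε hε => ?_⟩
  have hxI := I.subset_Icc hx
  obtain ⟨d, hd⟩ := hV.exists_hasWSum_deriv (abs_div_le_one hrep.ne_zero (hdist x hxI))
  -- The factor `H` built into the coefficients compensates the `1 / H` of the chain rule.
  have hdf : d = H * f x := by
    have h1 := hd.nat_succ (by simp)
    refine h1.unique ?_
    refine cast (congrArg (fun w => HasWSum w _) (funext fun n => ?_))
      ((hrep.hasWSum x hx).mul_left H)
    have h2 : ofReal ((n + 1 : ℕ) : ℝ)⁻¹ * ((n + 1 : ℕ) : LeviCivita) = 1 := by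
      rw [← ofReal_natCast, ← LC.ofReal_mul, inv_mul_cancel₀ (by positivity), ofReal_one]
    simp only [hVdef, Nat.add_sub_cancel]
    linear_combination (-(H * v n * ((x - x₀) / H) ^ n)) * h2
  obtain ⟨δ, hδ, h⟩ := hFrep.exists_deriv hxI hd hε
  rw [hdf, mul_div_cancel_left₀ _ hrep.ne_zero] at h
  exact ⟨δ, hδ, fun y hy => h y (I.subset_Icc hy)⟩

/-- All values of `f` have supports above the same exponent `m`, so a single monomial of lower
exponent bounds them. -/
theorem IsSimpleOn.exists_bound {f : LeviCivita → LeviCivita} {I : Interval}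
    (h : IsSimpleOn f I) : ∃ B, 0 < B ∧ ∀ x ∈ I.carrier, |f x| ≤ B := by
  rcases I.left_le_right.eq_or_lt with hI | hI
  · refine ⟨|f I.left| + 1, by positivity, fun x hx => ?_⟩
    have hx' := I.subset_Icc hx
    rw [← hI, Set.Icc_self, Set.mem_singleton_iff] at hx'
    rw [hx']
    linarith
  obtain ⟨x₀, hx₀, H, v, hdist, hrep⟩ := h.exists_rep hI
  obtain ⟨m, hm⟩ := hrep.rapid.exists_suppGE
  refine ⟨monomial (m - 1) 1, monomial_pos _ one_pos, fun x hx => ?_⟩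
  have hz : SuppGE 0 ((x - x₀) / H) := by
    have := abs_div_le_one hrep.ne_zero (hrep.dist_le x hx)
    rw [← ofReal_one] at this
    exact suppGE_of_abs_le_ofReal this
  have h1 : SuppGE m (f x) := (hrep.hasWSum x hx).suppGE fun n => by
    simpa using (hm n).mul (hz.pow_zero n)
  exact (h1.abs_lt_monomial (by linarith) one_pos).le

/-! ### The integral of a simple function -/

/-- An antiderivative that is simple on the closed interval is continuous there, so the endpoint
limits are its values. -/
theorem hasSimpleIntegral_iff {f : LeviCivita → LeviCivita} {I : Interval} {v : LeviCivita} :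
    HasSimpleIntegral f I v ↔
      IsSimpleOn f I ∧ ∃ F, Prim F f I ∧ v = F I.right - F I.left := by
  have hl : I.left ∈ Set.Icc I.left I.right := ⟨le_rfl, I.left_le_right⟩
  have hr : I.right ∈ Set.Icc I.left I.right := ⟨I.left_le_right, le_rfl⟩
  refine and_congr_right fun _ => exists_congr fun F => ⟨?_, ?_⟩
  · rintro ⟨hs, hd, α, β, hα, hβ, rfl⟩
    have : (𝓝[Set.Icc I.left I.right] I.left).NeBot := mem_closure_iff_nhdsWithin_neBot.1
      (subset_closure hl)
    have : (𝓝[Set.Icc I.left I.right] I.right).NeBot := mem_closure_iff_nhdsWithin_neBot.1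
      (subset_closure hr)
    rw [tendsto_nhds_unique hα (hs.tendsto hl), tendsto_nhds_unique hβ (hs.tendsto hr)]
    exact ⟨⟨hs, hd⟩, rfl⟩
  · rintro ⟨hF, rfl⟩
    exact ⟨hF.simple, hF.deriv, _, _, hF.simple.tendsto hl, hF.simple.tendsto hr, rfl⟩

open scoped Classical in
/-- The integral of a simple function. -/
noncomputable def simpleIntegral (f : LeviCivita → LeviCivita) (I : Interval) : LeviCivita :=
  if h : ∃ v, HasSimpleIntegral f I v then h.choose else 0

section SimpleIntegral

variable {F f g : LeviCivita → LeviCivita} {I : Interval}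

theorem Prim.simpleIntegral_eq (hF : Prim F f I) (hf : IsSimpleOn f I) :
    simpleIntegral f I = F I.right - F I.left := by
  have h : ∃ v, HasSimpleIntegral f I v := ⟨_, hasSimpleIntegral_iff.2 ⟨hf, F, hF, rfl⟩⟩
  rw [simpleIntegral, dif_pos h]
  obtain ⟨-, G, hG, hv⟩ := hasSimpleIntegral_iff.1 h.choose_spec
  rw [hv]
  exact le_antisymm (hG.le hF fun _ _ => le_rfl) (hF.le hG fun _ _ => le_rfl)

theorem HasSimpleIntegral.eq {v : LeviCivita} (h : HasSimpleIntegral f I v) :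
    v = simpleIntegral f I := by
  obtain ⟨hf, F, hF, rfl⟩ := hasSimpleIntegral_iff.1 h
  exact (hF.simpleIntegral_eq hf).symm

theorem IsSimpleOn.hasSimpleIntegral (hf : IsSimpleOn f I) :
    HasSimpleIntegral f I (simpleIntegral f I) := by
  obtain ⟨F, hF⟩ := hf.exists_prim
  rw [hF.simpleIntegral_eq hf]
  exact hasSimpleIntegral_iff.2 ⟨hf, F, hF, rfl⟩

theorem simpleIntegral_mono (hf : IsSimpleOn f I) (hg : IsSimpleOn g I)
    (h : ∀ x ∈ I.carrier, f x ≤ g x) : simpleIntegral f I ≤ simpleIntegral g I := by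
  obtain ⟨F, hF⟩ := hf.exists_prim
  obtain ⟨G, hG⟩ := hg.exists_prim
  rw [hF.simpleIntegral_eq hf, hG.simpleIntegral_eq hg]
  exact hF.le hG h

theorem simpleIntegral_sub (hf : IsSimpleOn f I) (hg : IsSimpleOn g I) :
    simpleIntegral (fun x => f x - g x) I = simpleIntegral f I - simpleIntegral g I := by
  obtain ⟨F, hF⟩ := hf.exists_prim
  obtain ⟨G, hG⟩ := hg.exists_prim
  rw [hF.simpleIntegral_eq hf, hG.simpleIntegral_eq hg, (hF.sub hG).simpleIntegral_eq (hf.sub hg)]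
  ring

theorem simpleIntegral_const (c : LeviCivita) (I : Interval) :
    simpleIntegral (fun _ => c) I = c * I.length := by
  rw [(Prim.linear c I).simpleIntegral_eq (isSimpleOn_const c I), Interval.length]
  ring

theorem simpleIntegral_congr (hf : IsSimpleOn f I) (h : ∀ x ∈ I.carrier, f x = g x) :
    simpleIntegral f I = simpleIntegral g I :=
  le_antisymm (simpleIntegral_mono hf (hf.congr h) fun x hx => (h x hx).le)
    (simpleIntegral_mono (hf.congr h) hf fun x hx => (h x hx).ge)

theorem abs_simpleIntegral_le (hf : IsSimpleOn f I) (hg : IsSimpleOn g I)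
    (h : ∀ x ∈ I.carrier, |f x| ≤ g x) : |simpleIntegral f I| ≤ simpleIntegral g I := by
  have h1 := simpleIntegral_mono hf hg fun x hx => (le_abs_self _).trans (h x hx)
  have h0 : simpleIntegral (fun x => 0 - f x) I = -simpleIntegral f I := by
    rw [simpleIntegral_sub (isSimpleOn_const 0 I) hf, simpleIntegral_const]
    ring
  have h2 := simpleIntegral_mono ((isSimpleOn_const 0 I).sub hf) hg fun x hx =>
    (zero_sub (f x)).le.trans ((neg_le_abs _).trans (h x hx))
  rw [h0] at h2
  exact abs_le'.2 ⟨h1, h2⟩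

theorem simpleIntegral_of_left_eq_right (h : I.left = I.right) : simpleIntegral f I = 0 := by
  rw [(Prim.of_left_eq_right 0 f h).simpleIntegral_eq (isSimpleOn_of_left_eq_right f h)]
  simp

end SimpleIntegral

/-! ### Subdivisions of finite families of intervals -/

/-- The points are listed in increasing order and the last one is repeated forever; the sequence is
only weakly monotone, so some atoms are empty. -/
theorem exists_monotone_range {α : Type*} [LinearOrder α] [Nonempty α] (P : Finset α) :
    ∃ p : ℕ → α, Monotone p ∧ ∀ x ∈ P, ∃ n, p n = x := by
  rcases P.eq_empty_or_nonempty with rfl | hP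
  · exact ⟨fun _ => Classical.arbitrary α, monotone_const, by simp⟩
  have hc : 0 < P.card := hP.card_pos
  have hlt : ∀ n, min n (P.card - 1) < P.card := fun n => by omega
  refine ⟨fun n => P.orderEmbOfFin rfl ⟨min n (P.card - 1), hlt n⟩, fun m n hmn => ?_,
    fun x hx => ?_⟩
  · refine (P.orderEmbOfFin rfl).monotone ?_
    exact min_le_min_right _ hmn
  · have : x ∈ Set.range (P.orderEmbOfFin rfl) := by rw [Finset.range_orderEmbOfFin]; exact hx
    obtain ⟨i, rfl⟩ := this
    refine ⟨i, congrArg _ (Fin.ext ?_)⟩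
    have := i.2
    simp only
    omega

/-- The open interval between two consecutive points of a monotone sequence. -/
def atom (p : ℕ → LeviCivita) (hp : Monotone p) (n : ℕ) : Interval where
  left := p n
  right := p (n + 1)
  left_le_right := hp n.le_succ
  carrier := Set.Ioo (p n) (p (n + 1))
  Ioo_subset := subset_rfl
  subset_Icc := Set.Ioo_subset_Icc_self

theorem atom_disjoint {p : ℕ → LeviCivita} (hp : Monotone p) :
    Pairwise fun m n => Disjoint (atom p hp m).carrier (atom p hp n).carrier := by
  have key : ∀ m n, m < n → Disjoint (atom p hp m).carrier (atom p hp n).carrier := by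
    intro m n hmn
    refine Set.disjoint_left.2 fun x hx hx' => ?_
    have h1 : p (m + 1) ≤ p n := hp hmn
    exact absurd (hx.2.trans_le h1) (not_lt.2 hx'.1.le)
  intro m n hmn
  rcases lt_or_gt_of_ne hmn with h | h
  · exact key m n h
  · exact (key n m h).symm

/-- The atoms with indices in `X` are nonempty and subdivide the interval `I`. -/
structure Subdivides (p : ℕ → LeviCivita) (X : Finset ℕ) (I : Interval) : Prop where
  lt : ∀ n ∈ X, p n < p (n + 1)
  le : ∀ n ∈ X, I.left ≤ p n ∧ p (n + 1) ≤ I.right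
  sum : ∀ G : LeviCivita → LeviCivita,
    ∑ n ∈ X, (G (p (n + 1)) - G (p n)) = G I.right - G I.left

/-- The increments of `G` telescope. Empty atoms contribute nothing and are filtered out, so that
every retained atom contains a point. -/
theorem exists_subdivides {p : ℕ → LeviCivita} (hp : Monotone p) {I : Interval}
    (hl : ∃ n, p n = I.left) (hr : ∃ n, p n = I.right) : ∃ X, Subdivides p X I := by
  obtain ⟨i, hi⟩ := hl
  obtain ⟨j, hj⟩ := hr
  refine ⟨(Finset.Ico i j).filter fun n => p n < p (n + 1), fun n hn => (Finset.mem_filter.1 hn).2,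
    fun n hn => ?_, fun G => ?_⟩
  · have := Finset.mem_Ico.1 (Finset.mem_filter.1 hn).1
    rw [← hi, ← hj]
    exact ⟨hp this.1, hp this.2⟩
  · rw [Finset.sum_filter_of_ne, ← hi, ← hj]
    · rcases le_total i j with hij | hij
      · rw [Finset.sum_Ico_eq_sub _ hij, Finset.sum_range_sub (fun n => G (p n)),
          Finset.sum_range_sub (fun n => G (p n))]
        ring
      · have h1 := I.left_le_right
        rw [← hi, ← hj] at h1
        rw [Finset.Ico_eq_empty_of_le hij, Finset.sum_empty, le_antisymm h1 (hp hij), sub_self]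
    · intro n _ hne
      refine lt_of_le_of_ne (hp n.le_succ) fun h => hne ?_
      rw [← h, sub_self]

theorem Subdivides.atom_subset {p : ℕ → LeviCivita} (hp : Monotone p) {X : Finset ℕ} {I : Interval}
    (h : Subdivides p X I) {n : ℕ} (hn : n ∈ X) : (atom p hp n).carrier ⊆ I.carrier :=
  (Set.Ioo_subset_Ioo (h.le n hn).1 (h.le n hn).2).trans I.Ioo_subset

theorem Subdivides.simpleIntegral_eq {p : ℕ → LeviCivita} (hp : Monotone p) {X : Finset ℕ}
    {I : Interval} (h : Subdivides p X I) {f : LeviCivita → LeviCivita} (hf : IsSimpleOn f I) :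
    simpleIntegral f I = ∑ n ∈ X, simpleIntegral f (atom p hp n) := by
  obtain ⟨F, hF⟩ := hf.exists_prim
  rw [hF.simpleIntegral_eq hf, ← h.sum F]
  refine Finset.sum_congr rfl fun n hn => ?_
  have hsub := h.atom_subset hp hn
  rw [(hF.restrict hsub).simpleIntegral_eq (hf.restrict hsub)]
  rfl

/-- The intervals `L k`, `k ∈ X`, are mutually disjoint subsets of `A` on which `f` is simple. -/
structure SimpleFamily (A : Set LeviCivita) (f : LeviCivita → LeviCivita) (L : ℕ → Interval)
    (X : Finset ℕ) : Prop where
  disjoint : ∀ i ∈ X, ∀ j ∈ X, i ≠ j → Disjoint (L i).carrier (L j).carrier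
  subset : ∀ k ∈ X, (L k).carrier ⊆ A
  simple : ∀ k ∈ X, IsSimpleOn f (L k)

/-- The total length of a finite family of intervals. -/
noncomputable def totalLength (L : ℕ → Interval) (X : Finset ℕ) : LeviCivita :=
  ∑ k ∈ X, (L k).length

/-- The sum of the integrals of `f` over a finite family of intervals. -/
noncomputable def totalIntegral (f : LeviCivita → LeviCivita) (L : ℕ → Interval) (X : Finset ℕ) :
    LeviCivita :=
  ∑ k ∈ X, simpleIntegral f (L k)

theorem totalLength_eq (L : ℕ → Interval) (X : Finset ℕ) :
    totalLength L X = totalIntegral (fun _ => 1) L X :=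
  Finset.sum_congr rfl fun k _ => by rw [simpleIntegral_const, one_mul]

theorem Interval.length_nonneg (I : Interval) : 0 ≤ I.length := sub_nonneg.2 I.left_le_right

theorem totalLength_mono (L : ℕ → Interval) {X Y : Finset ℕ} (h : X ⊆ Y) :
    totalLength L X ≤ totalLength L Y :=
  Finset.sum_le_sum_of_subset_of_nonneg h fun k _ _ => (L k).length_nonneg

theorem SimpleFamily.mono {A : Set LeviCivita} {f : LeviCivita → LeviCivita} {L : ℕ → Interval}
    {X Y : Finset ℕ} (h : SimpleFamily A f L Y) (hXY : X ⊆ Y) : SimpleFamily A f L X :=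
  ⟨fun i hi j hj => h.disjoint i (hXY hi) j (hXY hj), fun k hk => h.subset k (hXY hk),
    fun k hk => h.simple k (hXY hk)⟩

/-- The atoms with indices in `Y` subdivide the family of intervals `L k`, `k ∈ X`. -/
structure Refines (p : ℕ → LeviCivita) (hp : Monotone p) (Y : Finset ℕ) (L : ℕ → Interval)
    (X : Finset ℕ) : Prop where
  subset : ∀ n ∈ Y, ∃ k ∈ X, (atom p hp n).carrier ⊆ (L k).carrier
  total : ∀ f, (∀ k ∈ X, IsSimpleOn f (L k)) → totalIntegral f L X = totalIntegral f (atom p hp) Y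

theorem Refines.totalLength_eq {p : ℕ → LeviCivita} {hp : Monotone p} {Y : Finset ℕ}
    {L : ℕ → Interval} {X : Finset ℕ} (h : Refines p hp Y L X) :
    totalLength L X = totalLength (atom p hp) Y := by
  rw [LC.totalLength_eq, LC.totalLength_eq]
  exact h.total _ fun k _ => isSimpleOn_const 1 _

theorem exists_refines {p : ℕ → LeviCivita} (hp : Monotone p) {L : ℕ → Interval} {X : Finset ℕ}
    (hd : ∀ i ∈ X, ∀ j ∈ X, i ≠ j → Disjoint (L i).carrier (L j).carrier)
    (he : ∀ k ∈ X, (∃ n, p n = (L k).left) ∧ ∃ n, p n = (L k).right) :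
    ∃ Y, Refines p hp Y L X := by
  have hS : ∀ k, ∃ S, k ∈ X → Subdivides p S (L k) := fun k => by
    by_cases hk : k ∈ X
    · obtain ⟨S, hS⟩ := exists_subdivides hp (he k hk).1 (he k hk).2
      exact ⟨S, fun _ => hS⟩
    · exact ⟨∅, fun h => absurd h hk⟩
  choose S hS using hS
  refine ⟨X.biUnion S, fun n hn => ?_, fun f hf => ?_⟩
  · obtain ⟨k, hk, hn⟩ := Finset.mem_biUnion.1 hn
    exact ⟨k, hk, (hS k hk).atom_subset hp hn⟩
  · rw [totalIntegral, totalIntegral, Finset.sum_biUnion]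
    · exact Finset.sum_congr rfl fun k hk => (hS k hk).simpleIntegral_eq hp (hf k hk)
    · intro i hi j hj hij
      -- A nonempty atom cannot lie in two disjoint intervals.
      refine Finset.disjoint_left.2 fun n hn hn' => ?_
      obtain ⟨x, hx⟩ := exists_between ((hS i hi).lt n hn)
      exact Set.disjoint_left.1 (hd i hi j hj hij) ((hS i hi).atom_subset hp hn hx)
        ((hS j hj).atom_subset hp hn' hx)

/-- Cutting at all endpoints of both families reduces set operations on families of intervals to
operations on finite sets of indices. The endpoints lost affect neither lengths nor integrals. -/
theorem exists_common_refinement {L L' : ℕ → Interval} {X X' : Finset ℕ}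
    (hd : ∀ i ∈ X, ∀ j ∈ X, i ≠ j → Disjoint (L i).carrier (L j).carrier)
    (hd' : ∀ i ∈ X', ∀ j ∈ X', i ≠ j → Disjoint (L' i).carrier (L' j).carrier) :
    ∃ (p : ℕ → LeviCivita) (hp : Monotone p) (Y Y' : Finset ℕ),
      Refines p hp Y L X ∧ Refines p hp Y' L' X' := by
  classical
  obtain ⟨p, hp, h⟩ := exists_monotone_range
    ((X.image (fun k => (L k).left) ∪ X.image (fun k => (L k).right)) ∪
      (X'.image (fun k => (L' k).left) ∪ X'.image (fun k => (L' k).right)))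
  simp only [Finset.mem_union, Finset.mem_image] at h
  obtain ⟨Y, hY⟩ := exists_refines hp hd fun k hk =>
    ⟨h _ (Or.inl (Or.inl ⟨k, hk, rfl⟩)), h _ (Or.inl (Or.inr ⟨k, hk, rfl⟩))⟩
  obtain ⟨Y', hY'⟩ := exists_refines hp hd' fun k hk =>
    ⟨h _ (Or.inr (Or.inl ⟨k, hk, rfl⟩)), h _ (Or.inr (Or.inr ⟨k, hk, rfl⟩))⟩
  exact ⟨p, hp, Y, Y', hY, hY'⟩

theorem SimpleFamily.refine {A : Set LeviCivita} {f : LeviCivita → LeviCivita} {L : ℕ → Interval}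
    {X : Finset ℕ} (h : SimpleFamily A f L X) {p : ℕ → LeviCivita} {hp : Monotone p}
    {Y : Finset ℕ} (hY : Refines p hp Y L X) : SimpleFamily A f (atom p hp) Y := by
  refine ⟨fun i _ j _ hij => atom_disjoint hp hij, fun n hn => ?_, fun n hn => ?_⟩
  · obtain ⟨k, hk, hs⟩ := hY.subset n hn
    exact hs.trans (h.subset k hk)
  · obtain ⟨k, hk, hs⟩ := hY.subset n hn
    exact (h.simple k hk).restrict hs

theorem SimpleFamily.union_atom {A : Set LeviCivita} {f : LeviCivita → LeviCivita}
    {p : ℕ → LeviCivita} {hp : Monotone p} {Y Y' : Finset ℕ}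
    (h : SimpleFamily A f (atom p hp) Y) (h' : SimpleFamily A f (atom p hp) Y') :
    SimpleFamily A f (atom p hp) (Y ∪ Y') := by
  refine ⟨fun i _ j _ hij => atom_disjoint hp hij, fun n hn => ?_, fun n hn => ?_⟩
  · rcases Finset.mem_union.1 hn with hn | hn
    · exact h.subset n hn
    · exact h'.subset n hn
  · rcases Finset.mem_union.1 hn with hn | hn
    · exact h.simple n hn
    · exact h'.simple n hn

/-! ### Finite families as sequences -/

/-- The empty interval. -/
noncomputable def emptyInterval : Interval where
  left := 0
  right := 0
  left_le_right := le_rfl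
  carrier := ∅
  Ioo_subset := by simp
  subset_Icc := Set.empty_subset _

/-- A finite family of intervals as a sequence. -/
noncomputable def pad (L : ℕ → Interval) (X : Finset ℕ) (n : ℕ) : Interval :=
  if n ∈ X then L n else emptyInterval

theorem pad_mutuallyDisjoint {L : ℕ → Interval} {X : Finset ℕ}
    (hd : ∀ i ∈ X, ∀ j ∈ X, i ≠ j → Disjoint (L i).carrier (L j).carrier) :
    MutuallyDisjoint (pad L X) := by
  intro i j hij
  simp only [pad]
  split_ifs with hi hj hj
  · exact hd i hi j hj hij
  · exact Set.disjoint_empty _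
  · exact Set.empty_disjoint _
  · exact Set.empty_disjoint _

theorem seriesTo_pad (L : ℕ → Interval) (X : Finset ℕ) {Ψ : Interval → LeviCivita}
    (h : Ψ emptyInterval = 0) : SeriesTo (fun n => Ψ (pad L X n)) (∑ k ∈ X, Ψ (L k)) := by
  obtain ⟨N, hN⟩ := X.exists_nat_subset_range
  refine tendsto_const_nhds.congr' ?_
  filter_upwards [eventually_ge_atTop N] with M hM
  rw [← Finset.sum_subset (hN.trans (Finset.range_subset_range.2 hM))]
  · exact Finset.sum_congr rfl fun k hk => by rw [pad, if_pos hk]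
  · intro k _ hk
    rw [pad, if_neg hk, h]

theorem SimpleFamily.pad_subset {A : Set LeviCivita} {f : LeviCivita → LeviCivita}
    {L : ℕ → Interval} {X : Finset ℕ} (h : SimpleFamily A f L X) :
    (⋃ n, (pad L X n).carrier) ⊆ A := by
  refine Set.iUnion_subset fun n => ?_
  rw [pad]
  split_ifs with hn
  · exact h.subset n hn
  · exact Set.empty_subset _

theorem SimpleFamily.pad_simple {A : Set LeviCivita} {f : LeviCivita → LeviCivita}
    {L : ℕ → Interval} {X : Finset ℕ} (h : SimpleFamily A f L X) (n : ℕ) :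
    IsSimpleOn f (pad L X n) := by
  rw [pad]
  split_ifs with hn
  · exact h.simple n hn
  · exact isSimpleOn_of_left_eq_right f rfl

theorem seriesTo_pad_length (L : ℕ → Interval) (X : Finset ℕ) :
    SeriesTo (fun n => (pad L X n).length) (totalLength L X) :=
  seriesTo_pad L X (Ψ := Interval.length) (sub_self 0)

theorem SimpleFamily.totalLength_le {A : Set LeviCivita} {f : LeviCivita → LeviCivita}
    {L : ℕ → Interval} {X : Finset ℕ} (h : SimpleFamily A f L X) {μ : LeviCivita}
    (hμ : IsMeasureOf A μ) : totalLength L X ≤ μ :=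
  hμ.1.1 ⟨pad L X, pad_mutuallyDisjoint h.disjoint, h.pad_subset, seriesTo_pad_length L X⟩

/-! ### Integration over measurable sets -/

theorem IsMeasureOf.unique {A : Set LeviCivita} {μ μ' : LeviCivita} (h : IsMeasureOf A μ)
    (h' : IsMeasureOf A μ') : μ = μ' := h.1.unique h'.1

section

variable {A : Set LeviCivita} {μ : LeviCivita} {f g h φ : LeviCivita → LeviCivita}

theorem simpleFamily_range {I : ℕ → Interval} (hI : I ∈ simpleFamilies A f) (N : ℕ) :
    SimpleFamily A f I (Finset.range N) :=
  ⟨fun _ _ _ _ hij => hI.1 hij, fun k _ => (Set.subset_iUnion _ k).trans hI.2.1,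
    fun k _ => hI.2.2 k⟩

theorem MeasurableFun.exists_simpleFamily (hf : MeasurableFun A f) (hμ : IsMeasureOf A μ)
    {ε : LeviCivita} (hε : 0 < ε) : ∃ L X, SimpleFamily A f L X ∧ μ - totalLength L X < ε := by
  obtain ⟨-, μ', hμ', h⟩ := hf
  rw [hμ'.unique hμ] at h
  obtain ⟨I, s, hd, hsub, hs, hlt, hsimple⟩ := h (ε / 2) (half_pos hε)
  obtain ⟨N, hN⟩ :=
    (LinearOrderedAddCommGroup.tendsto_nhds.1 hs (ε / 2) (half_pos hε)).exists
  refine ⟨I, Finset.range N, simpleFamily_range ⟨hd, hsub, hsimple⟩ N, ?_⟩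
  have := (abs_lt.1 hN).1
  rw [totalLength]
  linarith

/-- A finite family padded with empty intervals is an admissible sequence, so the limit condition
specializes to finite sums. -/
theorem HasIntegral.exists_delta {w : LeviCivita} (hφ : HasIntegral A φ w) (hμ : IsMeasureOf A μ)
    {ε : LeviCivita} (hε : 0 < ε) : ∃ δ : LeviCivita, 0 < δ ∧ ∀ L X, SimpleFamily A φ L X →
      μ - totalLength L X < δ → |totalIntegral φ L X - w| < ε := by
  obtain ⟨-, μ', hμ', h⟩ := hφ
  rw [hμ'.unique hμ] at h
  obtain ⟨δ, hδ, h⟩ := h ε hε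
  refine ⟨δ, hδ, fun L X hL hlt => ?_⟩
  have h0 := hL.totalLength_le hμ
  obtain ⟨σ, t, hσ, ht, hlt'⟩ := h (pad L X)
    ⟨pad_mutuallyDisjoint hL.disjoint, hL.pad_subset, hL.pad_simple⟩ _ (seriesTo_pad_length L X)
    (by rwa [abs_of_nonneg (sub_nonneg.2 h0)])
  have h1 : σ = fun n => simpleIntegral φ (pad L X n) := funext fun n => (hσ n).eq
  rw [h1] at ht
  have h2 := seriesTo_pad L X (Ψ := simpleIntegral φ) (simpleIntegral_of_left_eq_right rfl)
  rwa [tendsto_nhds_unique ht h2] at hlt'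

/-! ### Absolute continuity and existence of the integral. -/

/-- The integrals of `f` over finite families of small total length are small. -/
def AbsCont (A : Set LeviCivita) (f : LeviCivita → LeviCivita) : Prop :=
  ∀ ε : LeviCivita, 0 < ε → ∃ δ : LeviCivita, 0 < δ ∧ ∀ L X, SimpleFamily A f L X →
    totalLength L X < δ → |totalIntegral f L X| < ε

theorem SimpleFamily.totalLength_union_le {p : ℕ → LeviCivita} {hp : Monotone p}
    {Y Y' : Finset ℕ} (hf : SimpleFamily A f (atom p hp) Y)
    (hg : SimpleFamily A g (atom p hp) Y') (hμ : IsMeasureOf A μ) :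
    totalLength (atom p hp) (Y ∪ Y') ≤ μ :=
  SimpleFamily.totalLength_le (f := fun _ => 1)
    (SimpleFamily.union_atom ⟨hf.disjoint, hf.subset, fun _ _ => isSimpleOn_const 1 _⟩
      ⟨hg.disjoint, hg.subset, fun _ _ => isSimpleOn_const 1 _⟩) hμ

theorem sum_union_eq_add_sdiff {u : ℕ → LeviCivita} (Y Y' : Finset ℕ) :
    ∑ n ∈ Y ∪ Y', u n = ∑ n ∈ Y, u n + ∑ n ∈ Y' \ Y, u n := by
  rw [← Finset.union_sdiff_self_eq_union, Finset.sum_union Finset.disjoint_sdiff]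

/-- Take a family that nearly exhausts `A`. With the small family adjoined, and with the small
family removed, it still nearly exhausts `A`, so both sums are close to `w`; their difference is the
integral over the small family. -/
theorem HasIntegral.absCont {w : LeviCivita} (hφ : HasIntegral A φ w) : AbsCont A φ := by
  obtain ⟨hm, μ, hμ, -⟩ := id hφ
  intro ε hε
  obtain ⟨δ, hδ, h⟩ := hφ.exists_delta hμ (half_pos hε)
  obtain ⟨K, Z, hK, hKlt⟩ := hm.exists_simpleFamily hμ (half_pos hδ)
  refine ⟨δ / 2, half_pos hδ, fun L X hL hlt => ?_⟩
  obtain ⟨p, hp, Y, Y', hY, hY'⟩ := exists_common_refinement hL.disjoint hK.disjoint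
  have hU := (hL.refine hY).union_atom (hK.refine hY')
  have hV := (hK.refine hY').mono (Finset.sdiff_subset (s := Y') (t := Y))
  rw [hY.totalLength_eq] at hlt
  rw [hY'.totalLength_eq] at hKlt
  have e1 : totalLength (atom p hp) (Y ∪ Y') =
      totalLength (atom p hp) Y + totalLength (atom p hp) (Y' \ Y) := sum_union_eq_add_sdiff Y Y'
  have e2 : totalIntegral φ (atom p hp) (Y ∪ Y') =
      totalIntegral φ (atom p hp) Y + totalIntegral φ (atom p hp) (Y' \ Y) :=
    sum_union_eq_add_sdiff Y Y'
  have e3 := totalLength_mono (atom p hp) (Finset.subset_union_right (s₁ := Y) (s₂ := Y'))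
  have i1 := h _ _ hU (by linarith)
  have i2 := h _ _ hV (by linarith)
  rw [hY.total φ hL.simple]
  rw [abs_lt] at i1 i2 ⊢
  constructor <;> linarith [i1.1, i1.2, i2.1, i2.2]

theorem SimpleFamily.exists_bound {L : ℕ → Interval} {X : Finset ℕ} (hL : SimpleFamily A f L X) :
    ∃ B, 0 < B ∧ ∀ k ∈ X, ∀ x ∈ (L k).carrier, |f x| ≤ B := by
  have h : ∀ k, ∃ B, 0 < B ∧ (k ∈ X → ∀ x ∈ (L k).carrier, |f x| ≤ B) := by
    intro k
    by_cases hk : k ∈ X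
    · obtain ⟨B, hB, h⟩ := (hL.simple k hk).exists_bound
      exact ⟨B, hB, fun _ => h⟩
    · exact ⟨1, one_pos, fun h => absurd h hk⟩
  choose B hB h using h
  refine ⟨1 + ∑ k ∈ X, B k, add_pos_of_pos_of_nonneg one_pos
    (Finset.sum_nonneg fun k _ => (hB k).le), fun k hk x hx => ?_⟩
  have h1 := Finset.single_le_sum (f := B) (fun k _ => (hB k).le) hk
  linarith [h k hk x hx, one_pos (α := LeviCivita)]

theorem abs_totalIntegral_le {L : ℕ → Interval} {X : Finset ℕ} (hf : SimpleFamily A f L X)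
    (hg : ∀ k ∈ X, IsSimpleOn g (L k)) (h : ∀ k ∈ X, ∀ x ∈ (L k).carrier, |f x| ≤ g x) :
    |totalIntegral f L X| ≤ totalIntegral g L X :=
  (Finset.abs_sum_le_sum_abs _ _).trans (Finset.sum_le_sum fun k hk =>
    abs_simpleIntegral_le (hf.simple k hk) (hg k hk) (h k hk))

/-- On the part of the small family where `φ` is simple too, the integral is bounded by that of `φ`.
On the rest a bound `B` for `f` on this finite family is available, and the length of the rest can
be made smaller than `ε / (2 B)`. -/
theorem AbsCont.of_abs_le (hφ : AbsCont A φ) (hm : MeasurableFun A φ)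
    (hle : ∀ x ∈ A, |f x| ≤ φ x) : AbsCont A f := by
  obtain ⟨-, μ, hμ, -⟩ := id hm
  intro ε hε
  obtain ⟨δ, hδ, h⟩ := hφ (ε / 2) (half_pos hε)
  refine ⟨δ, hδ, fun L X hL hlt => ?_⟩
  obtain ⟨B, hB, hbound⟩ := hL.exists_bound
  obtain ⟨K, Z, hK, hKlt⟩ := hm.exists_simpleFamily hμ (ε := ε / 2 / B) (by positivity)
  obtain ⟨p, hp, Y, Y', hY, hY'⟩ := exists_common_refinement hL.disjoint hK.disjoint
  have hYf := hL.refine hY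
  have hYφ := hK.refine hY'
  have hU := hYφ.totalLength_union_le hYf hμ
  rw [hY.totalLength_eq] at hlt
  rw [hY'.totalLength_eq] at hKlt
  have e1 : totalLength (atom p hp) (Y' ∪ Y) =
      totalLength (atom p hp) Y' + totalLength (atom p hp) (Y \ Y') := sum_union_eq_add_sdiff Y' Y
  have e2 : totalIntegral f (atom p hp) Y = totalIntegral f (atom p hp) (Y ∩ Y') +
      totalIntegral f (atom p hp) (Y \ Y') := (Finset.sum_inter_add_sum_sdiff Y Y' _).symm
  have i1 : |totalIntegral f (atom p hp) (Y \ Y')| ≤ B * totalLength (atom p hp) (Y \ Y') := by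
    have h1 := abs_totalIntegral_le (hYf.mono (Finset.sdiff_subset (t := Y'))) (g := fun _ => B)
      (fun _ _ => isSimpleOn_const B _) (fun n hn x hx => by
        obtain ⟨k, hk, hs⟩ := hY.subset n (Finset.sdiff_subset hn)
        exact hbound k hk x (hs hx))
    refine h1.trans_eq ?_
    rw [totalIntegral, totalLength, Finset.mul_sum]
    exact Finset.sum_congr rfl fun k _ => simpleIntegral_const B _
  have i2 : |totalIntegral f (atom p hp) (Y ∩ Y')| ≤ totalIntegral φ (atom p hp) (Y ∩ Y') :=
    abs_totalIntegral_le (hYf.mono Finset.inter_subset_left)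
      (hYφ.mono Finset.inter_subset_right).simple fun n hn x hx =>
        hle x (hYf.subset n (Finset.inter_subset_left hn) hx)
  have i3 := h _ _ (hYφ.mono (Finset.inter_subset_right (s₁ := Y)))
    ((totalLength_mono _ Finset.inter_subset_left).trans_lt hlt)
  have i4 : B * totalLength (atom p hp) (Y \ Y') < ε / 2 := by
    rw [mul_comm, ← lt_div_iff₀ hB]
    linarith
  rw [hY.total f hL.simple, e2]
  have i5 := abs_add_le (totalIntegral f (atom p hp) (Y ∩ Y'))
    (totalIntegral f (atom p hp) (Y \ Y'))
  have i6 := le_abs_self (totalIntegral φ (atom p hp) (Y ∩ Y'))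
  linarith

/-- After refinement, each of two nearly exhausting families exceeds the other by a family of small
length. -/
theorem AbsCont.cauchy (hf : AbsCont A f) (hμ : IsMeasureOf A μ) {ε : LeviCivita} (hε : 0 < ε) :
    ∃ δ : LeviCivita, 0 < δ ∧ ∀ L X L' X', SimpleFamily A f L X → SimpleFamily A f L' X' →
      μ - totalLength L X < δ → μ - totalLength L' X' < δ →
      |totalIntegral f L X - totalIntegral f L' X'| < ε := by
  obtain ⟨δ, hδ, h⟩ := hf (ε / 2) (half_pos hε)
  refine ⟨δ, hδ, fun L X L' X' hL hL' hlt hlt' => ?_⟩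
  obtain ⟨p, hp, Y, Y', hY, hY'⟩ := exists_common_refinement hL.disjoint hL'.disjoint
  have hU := (hL.refine hY).totalLength_union_le (hL'.refine hY') hμ
  have hU' := (hL'.refine hY').totalLength_union_le (hL.refine hY) hμ
  rw [hY.totalLength_eq] at hlt
  rw [hY'.totalLength_eq] at hlt'
  have e1 : totalLength (atom p hp) (Y ∪ Y') =
      totalLength (atom p hp) Y + totalLength (atom p hp) (Y' \ Y) := sum_union_eq_add_sdiff Y Y'
  have e2 : totalLength (atom p hp) (Y' ∪ Y) =
      totalLength (atom p hp) Y' + totalLength (atom p hp) (Y \ Y') := sum_union_eq_add_sdiff Y' Y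
  have e3 : totalIntegral f (atom p hp) (Y ∪ Y') =
      totalIntegral f (atom p hp) Y + totalIntegral f (atom p hp) (Y' \ Y) :=
    sum_union_eq_add_sdiff Y Y'
  have e4 : totalIntegral f (atom p hp) (Y ∪ Y') =
      totalIntegral f (atom p hp) Y' + totalIntegral f (atom p hp) (Y \ Y') := by
    rw [Finset.union_comm]
    exact sum_union_eq_add_sdiff Y' Y
  have i1 := h _ _ ((hL.refine hY).mono (Finset.sdiff_subset (t := Y'))) (by linarith)
  have i2 := h _ _ ((hL'.refine hY').mono (Finset.sdiff_subset (t := Y))) (by linarith)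
  rw [hY.total f hL.simple, hY'.total f hL'.simple]
  rw [abs_lt] at i1 i2 ⊢
  constructor <;> linarith [i1.1, i1.2, i2.1, i2.2]

theorem monomial_anti {m n : ℚ} (h : m ≤ n) : monomial n 1 ≤ monomial m 1 := by
  rcases h.eq_or_lt with rfl | h
  · exact le_rfl
  · exact (lt_of_abs_lt ((suppGE_monomial n 1).abs_lt_monomial h one_pos)).le

theorem exists_nat_monomial_lt {ε : LeviCivita} (hε : 0 < ε) :
    ∃ N : ℕ, ∀ n ≥ N, monomial n 1 < ε := by
  obtain ⟨m, hm⟩ := exists_monomial_lt hε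
  obtain ⟨N, hN⟩ := exists_nat_ge m
  refine ⟨N, fun n hn => (monomial_anti (hN.trans ?_)).trans_lt hm⟩
  exact_mod_cast hn

theorem AbsCont.exists_hasIntegral (hf : AbsCont A f) (hm : MeasurableFun A f) :
    ∃ v, HasIntegral A f v := by
  obtain ⟨-, μ, hμ, -⟩ := id hm
  -- Monomials of growing exponent tend to zero, so a sequence of families is enough to construct
  -- the limit.
  have hfam := fun n : ℕ => hm.exists_simpleFamily hμ (monomial_pos n one_pos)
  choose L X hL hlt using hfam
  obtain ⟨v, hv⟩ : ∃ v, Tendsto (fun n => totalIntegral f (L n) (X n)) atTop (𝓝 v) := by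
    refine exists_tendsto fun m => ?_
    obtain ⟨δ, hδ, h⟩ := hf.cauchy hμ (monomial_pos m one_pos)
    obtain ⟨N, hN⟩ := exists_nat_monomial_lt hδ
    refine ⟨N, fun n hn => ?_⟩
    exact SuppGE.of_abs_le (h _ _ _ _ (hL n) (hL N) ((hlt n).trans (hN n hn))
      ((hlt N).trans (hN N le_rfl))).le (suppGE_monomial m 1)
  refine ⟨v, hm, μ, hμ, fun ε hε => ?_⟩
  have hε3 : 0 < ε / 3 := by positivity
  obtain ⟨δ, hδ, h⟩ := hf.cauchy hμ hε3
  refine ⟨δ, hδ, fun I hI s hs hμs => ?_⟩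
  -- The lengths tend to zero, hence so do the integrals, and in this field that makes their series
  -- converge.
  have hσ : Tendsto (fun n => simpleIntegral f (I n)) atTop (𝓝 0) := by
    rw [LinearOrderedAddCommGroup.tendsto_nhds]
    intro η hη
    obtain ⟨δ', hδ', h'⟩ := hf η hη
    filter_upwards [LinearOrderedAddCommGroup.tendsto_nhds.1 hs.tendsto_zero δ' hδ'] with n hn
    have hfam : SimpleFamily A f I {n} :=
      (simpleFamily_range hI (n + 1)).mono (by simp)
    have := h' I {n} hfam (by
      rw [totalLength, Finset.sum_singleton]
      rw [sub_zero] at hn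
      exact lt_of_abs_lt hn)
    rwa [totalIntegral, Finset.sum_singleton, ← sub_zero (simpleIntegral f (I n))] at this
  obtain ⟨t, ht⟩ := exists_seriesTo hσ
  refine ⟨_, t, fun n => (hI.2.2 n).hasSimpleIntegral, ht, ?_⟩
  have h1 : Tendsto (fun N => μ - totalLength I (Finset.range N)) atTop (𝓝 (μ - s)) :=
    tendsto_const_nhds.sub hs
  have h2 := h1.eventually_lt_const (lt_of_abs_lt hμs)
  obtain ⟨N, hN1, hN2⟩ := (h2.and (LinearOrderedAddCommGroup.tendsto_nhds.1 ht _ hε3)).exists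
  obtain ⟨M, hM⟩ := exists_nat_monomial_lt hδ
  obtain ⟨n, hn1, hn2⟩ := ((eventually_ge_atTop M).and
    (LinearOrderedAddCommGroup.tendsto_nhds.1 hv _ hε3)).exists
  have h3 := h _ _ _ _ (simpleFamily_range hI N) (hL n) hN1 ((hlt n).trans (hM n hn1))
  rw [totalIntegral] at h3
  rw [abs_lt] at hN2 hn2 h3 ⊢
  constructor <;> linarith [hN2.1, hN2.2, hn2.1, hn2.2, h3.1, h3.2]

/-! ### Comparison and subtraction of integrals. -/

/-- Atoms belonging to both refined families lose at most the sum of the two defects. Comparisons of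
integrals over `A` thereby reduce to single intervals. -/
theorem MeasurableFun.exists_common_simpleFamily (hf : MeasurableFun A f)
    (hg : MeasurableFun A g) (hμ : IsMeasureOf A μ) {ε : LeviCivita} (hε : 0 < ε) :
    ∃ L X, SimpleFamily A f L X ∧ SimpleFamily A g L X ∧ μ - totalLength L X < ε := by
  obtain ⟨L, X, hL, hlt⟩ := hf.exists_simpleFamily hμ (half_pos hε)
  obtain ⟨L', X', hL', hlt'⟩ := hg.exists_simpleFamily hμ (half_pos hε)
  obtain ⟨p, hp, Y, Y', hY, hY'⟩ := exists_common_refinement hL.disjoint hL'.disjoint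
  have hYf := hL.refine hY
  have hYg := hL'.refine hY'
  rw [hY.totalLength_eq] at hlt
  rw [hY'.totalLength_eq] at hlt'
  have hU := hYg.totalLength_union_le hYf hμ
  have e1 : totalLength (atom p hp) (Y' ∪ Y) =
      totalLength (atom p hp) Y' + totalLength (atom p hp) (Y \ Y') := sum_union_eq_add_sdiff Y' Y
  have e2 : totalLength (atom p hp) Y = totalLength (atom p hp) (Y ∩ Y') +
      totalLength (atom p hp) (Y \ Y') := (Finset.sum_inter_add_sum_sdiff Y Y' _).symm
  exact ⟨atom p hp, Y ∩ Y', hYf.mono Finset.inter_subset_left, hYg.mono Finset.inter_subset_right,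
    by linarith⟩

theorem MeasurableFun.of_common (hf : MeasurableFun A f) (hg : MeasurableFun A g)
    (hs : ∀ I : Interval, I.carrier ⊆ A → IsSimpleOn f I → IsSimpleOn g I → IsSimpleOn h I) :
    MeasurableFun A h := by
  obtain ⟨hA, μ, hμ, -⟩ := id hf
  refine ⟨hA, μ, hμ, fun ε hε => ?_⟩
  obtain ⟨L, X, hLf, hLg, hlt⟩ := hf.exists_common_simpleFamily hg hμ hε
  have hL : SimpleFamily A h L X := ⟨hLf.disjoint, hLf.subset, fun k hk =>
    hs (L k) (hLf.subset k hk) (hLf.simple k hk) (hLg.simple k hk)⟩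
  exact ⟨pad L X, _, pad_mutuallyDisjoint hL.disjoint, hL.pad_subset, seriesTo_pad_length L X,
    hlt, hL.pad_simple⟩

theorem HasIntegral.mono {u v : LeviCivita} (hf : HasIntegral A f u) (hg : HasIntegral A g v)
    (h : ∀ x ∈ A, f x ≤ g x) : u ≤ v := by
  obtain ⟨hfm, μ, hμ, -⟩ := id hf
  by_contra! hlt
  have hε : 0 < (u - v) / 2 := by linarith
  obtain ⟨δ, hδ, hd⟩ := hf.exists_delta hμ hε
  obtain ⟨δ', hδ', hd'⟩ := hg.exists_delta hμ hε
  obtain ⟨L, X, hLf, hLg, hLt⟩ := hfm.exists_common_simpleFamily hg.1 hμ (lt_min hδ hδ')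
  have h1 := hd L X hLf (hLt.trans_le (min_le_left _ _))
  have h2 := hd' L X hLg (hLt.trans_le (min_le_right _ _))
  have h3 : totalIntegral f L X ≤ totalIntegral g L X := Finset.sum_le_sum fun k hk =>
    simpleIntegral_mono (hLf.simple k hk) (hLg.simple k hk) fun x hx => h x (hLf.subset k hk hx)
  rw [abs_lt] at h1 h2
  linarith [h1.1, h2.2]

theorem HasIntegral.unique {u v : LeviCivita} (hf : HasIntegral A f u) (hg : HasIntegral A f v) :
    u = v :=
  le_antisymm (hf.mono hg fun _ _ => le_rfl) (hg.mono hf fun _ _ => le_rfl)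

theorem HasIntegral.sub_eq {u v w : LeviCivita} (hf : HasIntegral A f u) (hg : HasIntegral A g v)
    (hh : HasIntegral A h w) (hfg : ∀ x ∈ A, f x - g x = h x) : u - v = w := by
  obtain ⟨hfm, μ, hμ, -⟩ := id hf
  by_contra hne
  have hε : 0 < |u - v - w| / 3 := by
    have := abs_pos.2 (sub_ne_zero.2 hne)
    positivity
  obtain ⟨δ, hδ, hd⟩ := hf.exists_delta hμ hε
  obtain ⟨δ', hδ', hd'⟩ := hg.exists_delta hμ hε
  obtain ⟨δ'', hδ'', hd''⟩ := hh.exists_delta hμ hε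
  obtain ⟨L, X, hLf, hLg, hLt⟩ :=
    hfm.exists_common_simpleFamily hg.1 hμ (lt_min hδ (lt_min hδ' hδ''))
  have hsub : ∀ k ∈ X, IsSimpleOn (fun x => f x - g x) (L k) := fun k hk =>
    (hLf.simple k hk).sub (hLg.simple k hk)
  have hcongr : ∀ k ∈ X, ∀ x ∈ (L k).carrier, f x - g x = h x := fun k hk x hx =>
    hfg x (hLf.subset k hk hx)
  have hLh : SimpleFamily A h L X := ⟨hLf.disjoint, hLf.subset, fun k hk =>
    (hsub k hk).congr (hcongr k hk)⟩
  have h1 := hd L X hLf (hLt.trans_le (min_le_left _ _))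
  have h2 := hd' L X hLg (hLt.trans_le ((min_le_right _ _).trans (min_le_left _ _)))
  have h3 := hd'' L X hLh (hLt.trans_le ((min_le_right _ _).trans (min_le_right _ _)))
  have h4 : totalIntegral f L X - totalIntegral g L X = totalIntegral h L X := by
    rw [totalIntegral, totalIntegral, totalIntegral, ← Finset.sum_sub_distrib]
    refine Finset.sum_congr rfl fun k hk => ?_
    rw [← simpleIntegral_sub (hLf.simple k hk) (hLg.simple k hk),
      simpleIntegral_congr (hsub k hk) (hcongr k hk)]
  rw [abs_lt] at h1 h2 h3
  have h5 : |u - v - w| < |u - v - w| := by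
    nth_rewrite 1 [abs_lt]
    constructor <;> linarith [h1.1, h1.2, h2.1, h2.2, h3.1, h3.2]
  exact lt_irrefl _ h5

/-- A measurable function dominated by an integrable one is integrable. -/
theorem HasIntegral.exists_of_abs_le {w : LeviCivita} (hφ : HasIntegral A φ w)
    (hf : MeasurableFun A f) (hle : ∀ x ∈ A, |f x| ≤ φ x) : ∃ v, HasIntegral A f v :=
  (hφ.absCont.of_abs_le hφ.1 hle).exists_hasIntegral hf

end

/-! ### Standard parts -/

theorem st_mono {x y : LeviCivita} (h : x ≤ y) : st x ≤ st y :=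
  sInf_le_sInf fun _ ⟨r, hr, hs⟩ => ⟨r, h.trans hr, hs⟩

theorem IsFinite.of_abs_le {x y : LeviCivita} (hy : IsFinite y) (h : |x| ≤ |y|) : IsFinite x := by
  obtain ⟨r, hr⟩ := hy
  exact ⟨r, h.trans_lt hr⟩

/-- A finite element has no negative exponents, so its position among the reals is decided by its
coefficient at `0`, up to an infinitesimal. This makes `st` additive on finite elements. -/
theorem IsFinite.st_eq {x : LeviCivita} (hx : IsFinite x) : st x = (coeff x 0 : EReal) := by
  obtain ⟨R, hR⟩ := hx
  have h0 : SuppGE 0 x := suppGE_of_abs_le_ofReal hR.le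
  refine le_antisymm (le_of_forall_gt_imp_ge_of_dense fun a ha => ?_) (le_sInf ?_)
  · obtain ⟨r, hr, hra⟩ := EReal.lt_iff_exists_real_btwn.1 ha
    have hxr : x < ofReal r := by
      refine lt_iff_coeff.2 ⟨0, fun q hq => ?_, ?_⟩
      · rw [h0 q hq, suppGE_ofReal r q hq]
      · rw [coeff_ofReal, if_pos rfl]
        exact_mod_cast hr
    have hmem : (r : EReal) ∈ {s : EReal | ∃ r : ℝ, x ≤ ofReal r ∧ s = r} := ⟨r, hxr.le, rfl⟩
    exact (sInf_le hmem).trans hra.le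
  · rintro _ ⟨r, hr, rfl⟩
    have := coeff_nonneg_of_nonneg (sub_nonneg.2 hr) ((suppGE_ofReal r).sub h0)
    rw [coeff_sub, coeff_ofReal, if_pos rfl] at this
    exact_mod_cast sub_nonneg.1 this

/-! ### The `M`-integral of integrable functions -/

/-- The supremum is attained at `f` itself; finiteness of `v` plays no part. -/
theorem HasIntegral.lowerMIntegral_eq {A : Set LeviCivita} {f : LeviCivita → LeviCivita}
    {v : LeviCivita} (hf : MemL1 A f) (hv : HasIntegral A f v) : lowerMIntegral A f = st v := by
  refine le_antisymm (sSup_le ?_) (le_sSup ⟨f, v, hf, fun _ _ => le_rfl, hv, rfl⟩)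
  rintro _ ⟨g, u, -, hgf, hu, rfl⟩
  exact st_mono (hu.mono hv hgf)

theorem HasIntegral.upperMIntegral_eq {A : Set LeviCivita} {f : LeviCivita → LeviCivita}
    {v : LeviCivita} (hf : MemL1 A f) (hv : HasIntegral A f v) : upperMIntegral A f = st v := by
  refine le_antisymm (sInf_le ⟨f, v, hf, fun _ _ => le_rfl, hv, rfl⟩) (le_sInf ?_)
  rintro _ ⟨g, u, -, hgf, hu, rfl⟩
  exact st_mono (hv.mono hu hgf)

theorem HasIntegral.basicMIntegrable {A : Set LeviCivita} {f : LeviCivita → LeviCivita}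
    {v : LeviCivita} (hf : MemL1 A f) (hv : HasIntegral A f v) (hfin : IsFinite v)
    (h0 : BoundedOn A f ∨ ∀ x ∈ A, 0 ≤ f x) : BasicMIntegrable A f := by
  by_cases hb : BoundedOn A f
  · exact Or.inl ⟨hb, (hv.lowerMIntegral_eq hf).trans (hv.upperMIntegral_eq hf).symm⟩
  · refine Or.inr ⟨hb, h0.resolve_left hb, ?_⟩
    rw [hv.lowerMIntegral_eq hf, hfin.st_eq]
    exact EReal.coe_lt_top _

/-- A maximum of simple functions need not be simple. This form reduces the positive part to `f` and
`|f|`, which are both measurable by assumption. -/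
theorem pos_eq (f : LeviCivita → LeviCivita) (x : LeviCivita) :
    ofReal (1 / 2) * (|f x| + f x) = pos f x := by
  have h : ofReal (1 / 2) + ofReal (1 / 2) = 1 := by
    rw [← ofReal_add, add_halves, ofReal_one]
  rw [pos]
  rcases abs_cases (f x) with ⟨h1, h2⟩ | ⟨h1, h2⟩
  · rw [h1, max_eq_left h2]
    linear_combination f x * h
  · rw [h1, max_eq_right h2.le, neg_add_cancel, mul_zero]

theorem neg_eq_pos_neg (f : LeviCivita → LeviCivita) : neg f = pos fun x => -f x := rfl

theorem pos_nonneg (f : LeviCivita → LeviCivita) (x : LeviCivita) : 0 ≤ pos f x := le_max_right _ _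

theorem neg_nonneg (f : LeviCivita → LeviCivita) (x : LeviCivita) : 0 ≤ neg f x := le_max_right _ _

theorem pos_le_abs (f : LeviCivita → LeviCivita) (x : LeviCivita) : pos f x ≤ |f x| :=
  max_le (le_abs_self _) (abs_nonneg _)

theorem neg_le_abs_apply (f : LeviCivita → LeviCivita) (x : LeviCivita) : neg f x ≤ |f x| :=
  max_le (neg_le_abs _) (abs_nonneg _)

theorem pos_sub_neg (f : LeviCivita → LeviCivita) (x : LeviCivita) : pos f x - neg f x = f x := by
  rw [pos, neg]
  rcases le_total (f x) 0 with h | h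
  · rw [max_eq_right h, max_eq_left (by linarith)]; ring
  · rw [max_eq_left h, max_eq_right (by linarith)]; ring

theorem IsSimpleOn.pos {f : LeviCivita → LeviCivita} {I : Interval} (hf : IsSimpleOn f I)
    (hf' : IsSimpleOn (fun x => |f x|) I) : IsSimpleOn (pos f) I :=
  ((hf'.add hf).ofReal_mul (r := 1 / 2) (by norm_num [abs_of_pos])).congr fun x _ => pos_eq f x

theorem IsSimpleOn.neg_part {f : LeviCivita → LeviCivita} {I : Interval} (hf : IsSimpleOn f I)
    (hf' : IsSimpleOn (fun x => |f x|) I) : IsSimpleOn (LC.neg f) I := by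
  rw [neg_eq_pos_neg]
  exact hf.neg.pos (by simpa only [abs_neg] using hf')

/-- A nonnegative measurable function dominated by a function with finite integral is in `L¹`
and has a finite integral. -/
theorem HasIntegral.exists_isFinite_of_le {A : Set LeviCivita} {g φ : LeviCivita → LeviCivita}
    {w : LeviCivita} (hφ : HasIntegral A φ w) (hw : IsFinite w) (hg : MeasurableFun A g)
    (h0 : ∀ x, 0 ≤ g x) (hle : ∀ x, g x ≤ φ x) :
    ∃ v, HasIntegral A g v ∧ IsFinite v ∧ MemL1 A g := by
  have habs : (fun x => |g x|) = g := funext fun x => abs_of_nonneg (h0 x)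
  obtain ⟨v, hv⟩ := hφ.exists_of_abs_le hg fun x _ => (abs_of_nonneg (h0 x)).le.trans (hle x)
  -- The integral `z` of the zero function exists by domination, and it vanishes because `z - z =
  -- z`; this gives `0 ≤ v`.
  have hzero : MeasurableFun A fun _ => 0 := hg.of_common hg fun I _ _ _ => isSimpleOn_const 0 I
  obtain ⟨z, hz⟩ := hφ.exists_of_abs_le hzero fun x _ => by
    rw [abs_zero]; exact (h0 x).trans (hle x)
  have hz0 : z - z = z := hz.sub_eq hz hz fun _ _ => sub_zero 0
  rw [sub_self] at hz0
  have hv0 : 0 ≤ v := hz0 ▸ hz.mono hv fun x _ => h0 x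
  refine ⟨v, hv, hw.of_abs_le ?_, hg, v, by rwa [habs]⟩
  rw [abs_of_nonneg hv0]
  exact (hv.mono hφ fun x _ => hle x).trans (le_abs_self w)

end LC

theorem mainTheorem9 (A : Set LC.LeviCivita) (hA : LC.MeasurableSubset A)
    (f : LC.LeviCivita → LC.LeviCivita) (hf : LC.MemL1 A f)
    (hfin : ∃ w, LC.HasIntegral A (fun x => |f x|) w ∧ LC.IsFinite w) :
    LC.MIntegrable A f ∧ (∃ v, LC.HasIntegral A f v) ∧
      ∀ v, LC.HasIntegral A f v → LC.mIntegral A f = LC.st v := by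
  obtain ⟨w, hw, hwf⟩ := hfin
  -- The dominating function is `|f|` itself.
  obtain ⟨v, hv⟩ := hw.exists_of_abs_le hf.1 fun x _ => le_rfl
  obtain ⟨p, hp, hpf, hpL⟩ := hw.exists_isFinite_of_le hwf
    (hf.1.of_common hw.1 fun I _ h h' => h.pos h') (LC.pos_nonneg f) (LC.pos_le_abs f)
  obtain ⟨n, hn, hnf, hnL⟩ := hw.exists_isFinite_of_le hwf
    (hf.1.of_common hw.1 fun I _ h h' => h.neg_part h') (LC.neg_nonneg f) (LC.neg_le_abs_apply f)
  have hpn : p - n = v := hp.sub_eq hn hv fun x _ => LC.pos_sub_neg f x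
  have hvf : LC.IsFinite v := by
    obtain ⟨r, hr⟩ := hpf
    obtain ⟨s, hs⟩ := hnf
    refine ⟨r + s, ?_⟩
    rw [← hpn, LC.ofReal_add]
    exact (abs_sub p n).trans_lt (add_lt_add hr hs)
  have hpB := hp.basicMIntegrable hpL hpf (Or.inr fun x _ => LC.pos_nonneg f x)
  have hnB := hn.basicMIntegrable hnL hnf (Or.inr fun x _ => LC.neg_nonneg f x)
  have hst : LC.st v = LC.st p - LC.st n := by
    rw [hvf.st_eq, hpf.st_eq, hnf.st_eq, ← hpn, LC.coeff_sub, EReal.coe_sub]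
  refine ⟨?_, ⟨v, hv⟩, fun v' hv' => ?_⟩
  · rw [LC.MIntegrable]
    split_ifs with h1 h2
    · exact hv.basicMIntegrable hf hvf h1
    · exact hnB
    · exact ⟨hpB, hnB⟩
  · rw [hv'.unique hv, LC.mIntegral]
    split_ifs with h1 h2
    · exact hv.lowerMIntegral_eq hf
    -- For nonpositive `f` the positive part vanishes on `A`, so `p = 0` and the formula for `st v`
    -- reduces to the negative part alone.
    · have hp0 : ∀ x ∈ A, LC.pos f x = 0 := fun x hx => max_eq_right (h2 x hx)
      have h3 : p - p = p := hp.sub_eq hp hp fun x hx => by rw [hp0 x hx, sub_zero]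
      rw [sub_self] at h3
      rw [hn.lowerMIntegral_eq hnL, hst, hpf.st_eq, ← h3, LC.coeff_zero, EReal.coe_zero, zero_sub]
    · rw [hp.lowerMIntegral_eq hpL, hn.lowerMIntegral_eq hnL, hst]
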